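/- Let $d,m,n\ge 0$. Let $\mathfrak{gl}(m|n)$ be the general linear Lie superalgebra of $\mathbb C^{m|n}$ and let $S=S(\mathbb C^d\otimes\mathbb C^{m|n})=\mathrm{Sym}(\mathbb C^d\otimes\mathbb C^m)\otimes\Lambda(\mathbb C^d\otimes\mathbb C^n)$ be the supersymmetric algebra of $\mathbb C^d\otimes\mathbb C^{m|n}$, with homogeneous components $S^k=\bigoplus_{p+q=k}\mathrm{Sym}^p(\mathbb C^d\otimes\mathbb C^m)\otimes\Lambda^q(\mathbb C^d\otimes\mathbb C^n)$. The commuting natural actions of $\mathfrak{gl}(d)$ and $\mathfrak{gl}(m|n)$ on $\mathbb C^d\otimes\mathbb C^{m|n}$ extend to actions on $S$ by (super)derivations, which preserve each $S^k$. (1) The images of $U(\mathfrak{gl}(d))$ and $U(\mathfrak{gl}(m|n))$ satisfy the double centralizer property: for every $k\ge 0$, each of the images of $U(\mathfrak{gl}(d))$ and $U(\mathfrak{gl}(m|n))$ in $\mathrm{End}(S^k)$ is the centralizer of the other; and in $\mathrm{End}(S)$ the centralizer of each image is the closure of the other image in the finite topology, i.e. the set of the operators which on every finite set of vectors agree with an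 element of that image. (2) For a weight $\lambda$, let $L_d(\lambda)$ and $L_{m|n}(\lambda)$ denote the quotients by the sum of all proper submodules of the Verma modules of highest weight $\lambda$ over $\mathfrak{gl}(d)$ and $\mathfrak{gl}(m|n)$, with respect to the Borel subalgebras of upper triangular matrices (for $\mathfrak{gl}(m|n)$, the $m$ even basis vectors come before the $n$ odd ones). For a partition $\lambda$ with $\lambda_{m+1}\le n$ (an $(m|n)$-hook partition) let $\lambda^\natural=\sum_{i=1}^m\lambda_i\delta_i+\sum_{j=1}^n\nu_j\epsilon_j$, where $\delta_i$, $\epsilon_j$ are the coordinate functions on the even and the odd diagonal entries and $\nu$ is the transpose of $(\lambda_{m+1},\lambda_{m+2},\dots)$. Then for every $(m|n)$-hook partition $\lambda$ of length $\ell(\lambda)\le d$ the modules $L_d(\lambda)$ and $L_{m|n}(\lambda^\natural)$ are simple, and as a $(\mathfrak{gl}(d),\mathfrak{gl}(m|n))$-module $$S(\mathbb C^d\otimes\mathbb C^{m|n})\;\cong\;\bigoplus_{\lambda_{m+1}\le n,\ \ell(\lambda)\le d}L_d(\lambda)\otimes L_{m|n}(\lambda^\natural).$$ -/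

import Mathlib

open scoped TensorProduct DirectSum Kronecker

noncomputable section

namespace SuperHowe

set_option linter.unusedSectionVars false
set_option linter.unusedSimpArgs false

attribute [local instance 100] LieRing.ofAssociativeRing

/-! ### The general linear Lie superalgebra and its enveloping superalgebra -/

section GlSuper

variable (α β : Type) [Fintype α] [Fintype β] [DecidableEq α] [DecidableEq β]

/-- The underlying space of `gl(V)`, `V` the superspace with even basis `α` and odd basis `β`. -/
abbrev GlSuper : Type := Matrix (α ⊕ β) (α ⊕ β) ℂ

variable {α β}

/-- The parity of a basis index. -/
def par : α ⊕ β → ZMod 2 := Sum.elim (fun _ => 0) (fun _ => 1)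

/-- The sign `(-1)^{ab}`. -/
def sgn (a b : ZMod 2) : ℂ := (-1) ^ (a.val * b.val)

/-- `X` is homogeneous of parity `a`: only the matrix units `E_{ij}` with `|i| + |j| = a` occur. -/
def IsHomog (a : ZMod 2) (X : GlSuper α β) : Prop :=
  ∀ i j, X i j ≠ 0 → par i + par j = a

/-- The super bracket `[X, Y] = XY - (-1)^{ab} YX` of elements of parities `a` and `b`. -/
def superBracket (a b : ZMod 2) (X Y : GlSuper α β) : GlSuper α β :=
  X * Y - sgn a b • (Y * X)

variable (α β)

/-- The relations `XY - (-1)^{|X||Y|} YX = [X, Y]` for homogeneous `X`, `Y`. -/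
inductive UGlSuperRel :
    TensorAlgebra ℂ (GlSuper α β) → TensorAlgebra ℂ (GlSuper α β) → Prop
  | bracket (a b : ZMod 2) (X Y : GlSuper α β) (hX : IsHomog a X) (hY : IsHomog b Y) :
      UGlSuperRel
        (TensorAlgebra.ι ℂ X * TensorAlgebra.ι ℂ Y
          - sgn a b • (TensorAlgebra.ι ℂ Y * TensorAlgebra.ι ℂ X))
        (TensorAlgebra.ι ℂ (superBracket a b X Y))

/-- The universal enveloping superalgebra of `gl(V)`. -/
def UGlSuper : Type := RingQuot (UGlSuperRel α β)

instance : Ring (UGlSuper α β) := inferInstanceAs (Ring (RingQuot (UGlSuperRel α β)))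

instance : Algebra ℂ (UGlSuper α β) :=
  inferInstanceAs (Algebra ℂ (RingQuot (UGlSuperRel α β)))

/-- The canonical map `gl(V) → U(gl(V))`. -/
def UGlSuper.ι : GlSuper α β →ₗ[ℂ] UGlSuper α β :=
  (RingQuot.mkAlgHom ℂ (UGlSuperRel α β)).toLinearMap ∘ₗ TensorAlgebra.ι ℂ

variable {α β}

/-- Universal property of `U(gl(V))`. -/
def UGlSuper.lift {A : Type} [Ring A] [Algebra ℂ A] (f : GlSuper α β →ₗ[ℂ] A)
    (hf : ∀ (a b : ZMod 2) (X Y : GlSuper α β), IsHomog a X → IsHomog b Y →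
      f X * f Y - sgn a b • (f Y * f X) = f (superBracket a b X Y)) :
    UGlSuper α β →ₐ[ℂ] A :=
  RingQuot.liftAlgHom ℂ ⟨TensorAlgebra.lift ℂ f, by
    intro x y h
    induction h with
    | bracket a b X Y hX hY => simpa using hf a b X Y hX hY⟩

theorem UGlSuper.lift_ι {A : Type} [Ring A] [Algebra ℂ A] (f : GlSuper α β →ₗ[ℂ] A)
    (hf : ∀ (a b : ZMod 2) (X Y : GlSuper α β), IsHomog a X → IsHomog b Y →
      f X * f Y - sgn a b • (f Y * f X) = f (superBracket a b X Y)) (X : GlSuper α β) :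
    UGlSuper.lift f hf (UGlSuper.ι α β X) = f X := by
  have h := RingQuot.liftAlgHom_mkAlgHom_apply (S := ℂ) (s := UGlSuperRel α β)
    (TensorAlgebra.lift ℂ f) (by
      intro x y h
      induction h with
      | bracket a b X Y hX hY => simpa using hf a b X Y hX hY) (TensorAlgebra.ι ℂ X)
  exact h.trans (TensorAlgebra.lift_ι_apply f X)

theorem UGlSuper.hom_ext {A : Type} [Ring A] [Algebra ℂ A] {f g : UGlSuper α β →ₐ[ℂ] A}
    (h : ∀ X, f (UGlSuper.ι α β X) = g (UGlSuper.ι α β X)) : f = g := by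
  apply RingQuot.ringQuot_ext' ℂ
  apply TensorAlgebra.hom_ext
  ext1 X
  exact h X

end GlSuper

/-- The universal enveloping algebra of `gl(d)`. -/
abbrev UGl (d : ℕ) : Type := UniversalEnvelopingAlgebra ℂ (Matrix (Fin d) (Fin d) ℂ)

/-- The canonical map `gl(d) → U(gl(d))`. -/
def UGl.ι (d : ℕ) : Matrix (Fin d) (Fin d) ℂ →ₗ[ℂ] UGl d :=
  (UniversalEnvelopingAlgebra.ι ℂ : Matrix (Fin d) (Fin d) ℂ →ₗ⁅ℂ⁆ UGl d)

/-! ### Simple highest weight modules -/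

section HighestWeight

variable {I : Type} [LT I] {U : Type} [Ring U] [Algebra ℂ U]

/-- For elements `e i j` of `U` (the matrix units, `e i j` with `i < j` spanning the nilradical of
the standard Borel subalgebra and the `e i i` the Cartan subalgebra) and a weight `wt`, the left
ideal generated by `e i j` for `i < j` and `e i i - wt i`. -/
def vermaIdeal (e : I → I → U) (wt : I → ℂ) : Submodule U U :=
  Submodule.span U
    ({x | ∃ i j, i < j ∧ x = e i j} ∪ {x | ∃ i, x = e i i - algebraMap ℂ U (wt i)})

/-- The Verma module of highest weight `wt`. -/
abbrev Verma (e : I → I → U) (wt : I → ℂ) : Type := U ⧸ vermaIdeal e wt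

/-- The sum of all proper submodules of the Verma module. -/
def vermaRadical (e : I → I → U) (wt : I → ℂ) : Submodule U (Verma e wt) :=
  sSup {N | N ≠ ⊤}

/-- The simple highest weight module: the quotient of the Verma module by its largest proper
submodule. -/
abbrev SimpleHW (e : I → I → U) (wt : I → ℂ) : Type := Verma e wt ⧸ vermaRadical e wt

end HighestWeight

/-- The simple `gl(d)`-module `L_d(wt)`. -/
abbrev LGl (d : ℕ) (wt : Fin d → ℂ) : Type :=
  SimpleHW (fun i j => UGl.ι d (Matrix.single i j 1)) wt

/-- The simple `gl(m|n)`-module `L_{m|n}(wt)`, with respect to the standard Borel subalgebra: the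
index set is ordered with the `m` even indices before the `n` odd ones. -/
abbrev LGlSuper (m n : ℕ) (wt : Fin m ⊕ₗ Fin n → ℂ) : Type :=
  SimpleHW (I := Fin m ⊕ₗ Fin n)
    (fun i j => UGlSuper.ι (Fin m) (Fin n) (Matrix.single (ofLex i) (ofLex j) 1)) wt

/-! ### Hook partitions and their weights -/

/-- `(m|n)`-hook partitions `λ` (that is, `λ_{m+1} ≤ n`; rows are numbered from `0` here) of length
at most `d`. -/
def HookPartition (d m n : ℕ) : Type :=
  {μ : YoungDiagram // μ.rowLen m ≤ n ∧ μ.colLen 0 ≤ d}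

/-- A partition as a weight of `gl(d)`. -/
def glWeight (d : ℕ) (μ : YoungDiagram) : Fin d → ℂ := fun i => (μ.rowLen i : ℂ)

/-- The weight `μ^♮` of `gl(m|n)`: the first `m` rows of `μ`, followed by the column lengths of the
diagram `(μ_{m+1}, μ_{m+2}, …)` (the truncated difference `μ'_j - m`). -/
def naturalWeight (m n : ℕ) (μ : YoungDiagram) : Fin m ⊕ₗ Fin n → ℂ := fun i =>
  Sum.elim (fun a : Fin m => (μ.rowLen a : ℂ)) (fun b : Fin n => ((μ.colLen b - m : ℕ) : ℂ))
    (ofLex i)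

/-! ### The supersymmetric algebra and the action of `gl(V)` on it -/

section SuperSym

variable (α β : Type) [Fintype α] [Fintype β] [DecidableEq α] [DecidableEq β]

/-- The supersymmetric algebra `S(V) = S(V₀) ⊗ Λ(V₁)` of the superspace `V` with even basis `α` and
odd basis `β`; `S(V₀)` is the polynomial algebra on the basis `α`. -/
def SuperSym : Type := MvPolynomial α ℂ ⊗[ℂ] ExteriorAlgebra ℂ (β → ℂ)

instance : AddCommGroup (SuperSym α β) :=
  inferInstanceAs (AddCommGroup (MvPolynomial α ℂ ⊗[ℂ] ExteriorAlgebra ℂ (β → ℂ)))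

instance : Module ℂ (SuperSym α β) :=
  inferInstanceAs (Module ℂ (MvPolynomial α ℂ ⊗[ℂ] ExteriorAlgebra ℂ (β → ℂ)))

/-- The identity map `S(V₀) ⊗ Λ(V₁) → S(V)`. -/
def ofTensor : MvPolynomial α ℂ ⊗[ℂ] ExteriorAlgebra ℂ (β → ℂ) ≃ₗ[ℂ] SuperSym α β :=
  LinearEquiv.refl ℂ (MvPolynomial α ℂ ⊗[ℂ] ExteriorAlgebra ℂ (β → ℂ))

/-- The degree `k` component `S^k(V) = ⨁_{p + q = k} S^p(V₀) ⊗ Λ^q(V₁)`. -/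
def superSymPow (k : ℕ) : Submodule ℂ (SuperSym α β) :=
  ⨆ pq : {pq : ℕ × ℕ // pq.1 + pq.2 = k},
    (Submodule.map₂ (TensorProduct.mk ℂ _ _)
      (MvPolynomial.homogeneousSubmodule α ℂ pq.1.1) (⋀[ℂ]^pq.1.2 (β → ℂ))).map
        (ofTensor α β).toLinearMap

variable {α β}

theorem superSym_ext {S T : Module.End ℂ (SuperSym α β)}
    (h : ∀ f w, S (ofTensor α β (f ⊗ₜ w)) = T (ofTensor α β (f ⊗ₜ w))) : S = T := by
  have h' : S ∘ₗ (ofTensor α β).toLinearMap = T ∘ₗ (ofTensor α β).toLinearMap :=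
    TensorProduct.ext' h
  ext v
  obtain ⟨x, rfl⟩ := (ofTensor α β).surjective v
  exact LinearMap.congr_fun h' x

/-- Left multiplication by the odd basis vector `b` on the exterior algebra. -/
def extMul (b : β) : Module.End ℂ (ExteriorAlgebra ℂ (β → ℂ)) :=
  LinearMap.mulLeft ℂ (ExteriorAlgebra.ι ℂ (Pi.single b 1))

/-- The left odd derivation `∂/∂η_b` of the exterior algebra. -/
def extDer (b : β) : Module.End ℂ (ExteriorAlgebra ℂ (β → ℂ)) :=
  CliffordAlgebra.contractLeft (Q := (0 : QuadraticForm ℂ (β → ℂ))) (LinearMap.proj b)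

/-- Left multiplication by a basis vector of `V` on `S(V)`. -/
def gen (i : α ⊕ β) : Module.End ℂ (SuperSym α β) :=
  (ofTensor α β).conj (Sum.elim (fun a => (LinearMap.mulLeft ℂ (MvPolynomial.X a)).rTensor _)
    (fun b => (extMul b).lTensor _) i)

/-- The superderivation of `S(V)` dual to a basis vector of `V`. -/
def der (i : α ⊕ β) : Module.End ℂ (SuperSym α β) :=
  (ofTensor α β).conj (Sum.elim (fun a => ((MvPolynomial.pderiv a).toLinearMap :
      MvPolynomial α ℂ →ₗ[ℂ] MvPolynomial α ℂ).rTensor _)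
    (fun b => (extDer b).lTensor _) i)

theorem gen_inl (a : α) (f : MvPolynomial α ℂ) (w : ExteriorAlgebra ℂ (β → ℂ)) :
    gen (.inl a) (ofTensor α β (f ⊗ₜ w)) = ofTensor α β ((MvPolynomial.X a * f) ⊗ₜ w) := by
  simp [gen, LinearEquiv.conj_apply]

theorem gen_inr (b : β) (f : MvPolynomial α ℂ) (w : ExteriorAlgebra ℂ (β → ℂ)) :
    gen (.inr b) (ofTensor α β (f ⊗ₜ w)) = ofTensor α β (f ⊗ₜ extMul b w) := by
  simp [gen, LinearEquiv.conj_apply]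

theorem der_inl (a : α) (f : MvPolynomial α ℂ) (w : ExteriorAlgebra ℂ (β → ℂ)) :
    der (.inl a) (ofTensor α β (f ⊗ₜ w)) = ofTensor α β (MvPolynomial.pderiv a f ⊗ₜ w) := by
  simp [der, LinearEquiv.conj_apply]

theorem der_inr (b : β) (f : MvPolynomial α ℂ) (w : ExteriorAlgebra ℂ (β → ℂ)) :
    der (.inr b) (ofTensor α β (f ⊗ₜ w)) = ofTensor α β (f ⊗ₜ extDer b w) := by
  simp [der, LinearEquiv.conj_apply]

/-- The action of `gl(V)` on `S(V)` by superderivations extending the natural action on `V`: the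
matrix unit `E_{ij}` acts as `z_i ∂/∂z_j`. -/
def symAct : GlSuper α β →ₗ[ℂ] Module.End ℂ (SuperSym α β) where
  toFun M := ∑ i, ∑ j, M i j • (gen i * der j)
  map_add' M N := by simp [add_smul, Finset.sum_add_distrib]
  map_smul' c M := by simp [Finset.smul_sum, mul_smul]

/-! The operators satisfy the super canonical commutation relations. -/

theorem sgn_mul_self (a b : ZMod 2) : sgn a b * sgn a b = 1 := by
  unfold sgn
  rw [← mul_pow]; simp

theorem sgn_comm (a b : ZMod 2) : sgn a b = sgn b a := by
  unfold sgn
  rw [mul_comm]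

theorem sgn_add_left (a b c : ZMod 2) : sgn (a + b) c = sgn a c * sgn b c := by
  unfold sgn
  have hz : ∀ x : ZMod 2, x = 0 ∨ x = 1 := by decide
  rcases hz a with rfl | rfl <;> rcases hz b with rfl | rfl <;> rcases hz c with rfl | rfl <;>
    simp [show (1 + 1 : ZMod 2) = 0 from rfl, ZMod.val_one]

theorem sgn_add_right (a b c : ZMod 2) : sgn a (b + c) = sgn a b * sgn a c := by
  rw [sgn_comm, sgn_add_left, sgn_comm b, sgn_comm c]

theorem gen_mul_gen (i j : α ⊕ β) :
    gen i * gen j = sgn (par i) (par j) • (gen j * gen i) := by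
  rcases i with a | a <;> rcases j with b | b <;>
    refine superSym_ext fun f w => ?_
  · simp [gen_inl, gen_inr, par, sgn]; ring_nf
  · simp [gen_inl, gen_inr, par, sgn]
  · simp [gen_inl, gen_inr, par, sgn]
  · have h := ExteriorAlgebra.ι_add_mul_swap (R := ℂ) (Pi.single a 1 : β → ℂ) (Pi.single b 1)
    have h2 := eq_neg_of_add_eq_zero_left h
    simp [gen_inl, gen_inr, par, sgn, extMul, ← mul_assoc, ZMod.val_one, h2, TensorProduct.tmul_neg]

theorem der_mul_der (i j : α ⊕ β) :
    der i * der j = sgn (par i) (par j) • (der j * der i) := by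
  rcases i with a | a <;> rcases j with b | b <;>
    refine superSym_ext fun f w => ?_
  · have h : MvPolynomial.pderiv a (MvPolynomial.pderiv b f)
        = MvPolynomial.pderiv b (MvPolynomial.pderiv a f) := by
      induction f using MvPolynomial.induction_on with
      | C c => simp
      | add p q hp hq => simp [hp, hq]
      | mul_X p c hp =>
        have hz : ∀ x y : α, MvPolynomial.pderiv x
            ((Pi.single y 1 : α → MvPolynomial α ℂ) c) = 0 := by
          intro x y
          by_cases h : c = y <;> simp [h]
        simp only [MvPolynomial.pderiv_mul, MvPolynomial.pderiv_X, map_add, hp, hz]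
        ring
    simp [der_inl, der_inr, par, sgn, h]
  · simp [der_inl, der_inr, par, sgn]
  · simp [der_inl, der_inr, par, sgn]
  · have h := CliffordAlgebra.contractLeft_comm (Q := (0 : QuadraticForm ℂ (β → ℂ)))
      (LinearMap.proj a) (LinearMap.proj b) w
    simp [der_inl, der_inr, par, sgn, extDer, ZMod.val_one, h, TensorProduct.tmul_neg]

theorem der_mul_gen (i j : α ⊕ β) :
    der i * gen j = sgn (par i) (par j) • (gen j * der i) + if i = j then 1 else 0 := by
  rcases i with a | a <;> rcases j with b | b <;>
    refine superSym_ext fun f w => ?_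
  · by_cases h : a = b
    · subst h
      simp [gen_inl, gen_inr, der_inl, der_inr, par, sgn, TensorProduct.add_tmul]
    · simp [gen_inl, gen_inr, der_inl, der_inr, par, sgn, h, Ne.symm h]
  · simp [gen_inl, gen_inr, der_inl, der_inr, par, sgn]
  · simp [gen_inl, gen_inr, der_inl, der_inr, par, sgn]
  · have h := CliffordAlgebra.contractLeft_ι_mul (Q := (0 : QuadraticForm ℂ (β → ℂ)))
      (LinearMap.proj a) (Pi.single b 1) w
    have h' : extDer a (extMul b w) = (Pi.single b 1 : β → ℂ) a • w - extMul b (extDer a w) := h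
    by_cases hab : a = b
    · subst hab
      simp [gen_inl, gen_inr, der_inl, der_inr, par, sgn, ZMod.val_one, h', TensorProduct.tmul_sub]
      abel
    · simp [gen_inl, gen_inr, der_inl, der_inr, par, sgn, ZMod.val_one, h', hab, TensorProduct.tmul_neg]

theorem bracket_of_relations {A : Type} [Ring A] [Algebra ℂ A] (z t : α ⊕ β → A)
    (hz : ∀ i j, z i * z j = sgn (par i) (par j) • (z j * z i))
    (ht : ∀ i j, t i * t j = sgn (par i) (par j) • (t j * t i))
    (htz : ∀ i j, t i * z j = sgn (par i) (par j) • (z j * t i) + if i = j then 1 else 0)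
    (a b : ZMod 2) (X Y : GlSuper α β) (hX : IsHomog a X) (hY : IsHomog b Y) :
    (∑ i, ∑ j, X i j • (z i * t j)) * (∑ i, ∑ j, Y i j • (z i * t j))
      - sgn a b • ((∑ i, ∑ j, Y i j • (z i * t j)) * (∑ i, ∑ j, X i j • (z i * t j)))
    = ∑ i, ∑ j, superBracket a b X Y i j • (z i * t j) := by
  have unit_mul : ∀ i j k l, (z i * t j) * (z k * t l) = (if j = k then z i * t l else 0)
      + sgn (par j) (par k) • (z i * z k * (t j * t l)) := by
    intro i j k l
    calc (z i * t j) * (z k * t l) = z i * (t j * z k) * t l := by simp only [mul_assoc]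
      _ = _ := by
        rw [htz]
        split_ifs <;> simp [mul_add, add_mul, mul_assoc, add_comm]
  have unit_comm : ∀ i j k l, (z i * t j) * (z k * t l)
        - sgn (par i + par j) (par k + par l) • ((z k * t l) * (z i * t j))
      = (if j = k then z i * t l else 0)
        - sgn (par i + par j) (par k + par l) • (if l = i then z k * t j else 0) := by
    intro i j k l
    rw [unit_mul, unit_mul, hz k i, ht l j]
    simp only [smul_add, smul_smul, smul_mul_assoc, mul_smul_comm]
    have h : sgn (par i + par j) (par k + par l) *
        (sgn (par l) (par i) * (sgn (par l) (par j) * sgn (par k) (par i)))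
          = sgn (par j) (par k) := by
      rw [sgn_add_left, sgn_add_right, sgn_add_right, sgn_comm (par l) (par i),
        sgn_comm (par k) (par i), sgn_comm (par l) (par j)]
      have h1 := sgn_mul_self (par i) (par k)
      have h2 := sgn_mul_self (par i) (par l)
      have h3 := sgn_mul_self (par j) (par l)
      linear_combination (sgn (par j) (par k) * sgn (par i) (par l) ^ 2
        * sgn (par j) (par l) ^ 2) * h1 + (sgn (par j) (par k) * sgn (par j) (par l) ^ 2) * h2
        + sgn (par j) (par k) * h3
    simp only [h]
    abel
  have swap : ∀ f : α ⊕ β → α ⊕ β → α ⊕ β → α ⊕ β → A,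
      ∑ i, ∑ j, ∑ k, ∑ l, f i j k l = ∑ k, ∑ l, ∑ i, ∑ j, f i j k l := by
    intro f
    have h : ∀ g : (α ⊕ β) → (α ⊕ β) → A, ∑ i, ∑ j, g i j
        = ∑ p : (α ⊕ β) × (α ⊕ β), g p.1 p.2 := fun g => (Fintype.sum_prod_type' g).symm
    simp only [h]
    exact Finset.sum_comm
  have mul_act : ∀ X Y : GlSuper α β, ∑ i, ∑ j, (X * Y) i j • (z i * t j)
      = ∑ i, ∑ j, ∑ k, ∑ l, (X i j * Y k l) • (if j = k then z i * t l else 0) := by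
    intro X Y
    refine Finset.sum_congr rfl fun i _ => ?_
    simp only [smul_ite, smul_zero]
    simp only [Matrix.mul_apply, Finset.sum_smul]
    rw [Finset.sum_comm]
    refine Finset.sum_congr rfl fun j _ => ?_
    rw [Finset.sum_comm]
    refine Finset.sum_congr rfl fun l _ => ?_
    simp
  have act_mul : ∀ X Y : GlSuper α β,
      (∑ i, ∑ j, X i j • (z i * t j)) * (∑ i, ∑ j, Y i j • (z i * t j))
      = ∑ i, ∑ j, ∑ k, ∑ l, (X i j * Y k l) • ((z i * t j) * (z k * t l)) := by
    intro X Y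
    simp only [Finset.sum_mul, Finset.mul_sum, smul_mul_smul_comm]
    exact swap (fun k l i j => (X i j * Y k l) • ((z i * t j) * (z k * t l)))
  have expand : ∑ i, ∑ j, superBracket a b X Y i j • (z i * t j)
      = (∑ i, ∑ j, (X * Y) i j • (z i * t j))
        - sgn a b • ∑ i, ∑ j, (Y * X) i j • (z i * t j) := by
    simp only [superBracket, Matrix.sub_apply, Matrix.smul_apply, sub_smul,
      Finset.sum_sub_distrib, Finset.smul_sum, smul_assoc]
  rw [expand, act_mul, act_mul, mul_act, mul_act,
    swap (fun i j k l => (Y i j * X k l) • ((z i * t j) * (z k * t l))),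
    swap (fun i j k l => (Y i j * X k l) • (if j = k then z i * t l else 0))]
  simp only [Finset.smul_sum, ← Finset.sum_sub_distrib]
  refine Finset.sum_congr rfl fun i _ => Finset.sum_congr rfl fun j _ =>
    Finset.sum_congr rfl fun k _ => Finset.sum_congr rfl fun l _ => ?_
  by_cases h1 : X i j = 0
  · simp [h1]
  by_cases h2 : Y k l = 0
  · simp [h2]
  have h := unit_comm i j k l
  rw [hX i j h1, hY k l h2] at h
  rw [mul_comm (Y k l), smul_comm (sgn a b), smul_comm (sgn a b), ← smul_sub, ← smul_sub, h]

theorem symAct_apply (X : GlSuper α β) : symAct X = ∑ i, ∑ j, X i j • (gen i * der j) := rfl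

/-- The action of `gl(V)` on `S(V)` respects the super bracket. -/
theorem symAct_bracket (a b : ZMod 2) (X Y : GlSuper α β) (hX : IsHomog a X) (hY : IsHomog b Y) :
    symAct X * symAct Y - sgn a b • (symAct Y * symAct X) = symAct (superBracket a b X Y) :=
  bracket_of_relations gen der gen_mul_gen der_mul_der der_mul_gen a b X Y hX hY

theorem map_mem_superSymPow {k l : ℕ} (T : Module.End ℂ (SuperSym α β))
    (h : ∀ p q : ℕ, p + q = k → ∀ f ∈ MvPolynomial.homogeneousSubmodule α ℂ p,
      ∀ w ∈ ⋀[ℂ]^q (β → ℂ), T (ofTensor α β (f ⊗ₜ w)) ∈ superSymPow α β l)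
    {v : SuperSym α β} (hv : v ∈ superSymPow α β k) : T v ∈ superSymPow α β l := by
  suffices superSymPow α β k ≤ (superSymPow α β l).comap T from this hv
  refine iSup_le fun pq => Submodule.map_le_iff_le_comap.2 <|
    Submodule.map₂_le.2 fun f hf w hw => ?_
  exact h _ _ pq.2 f hf w hw

theorem tmul_mem_superSymPow {p q k : ℕ} (hpq : p + q = k) {f : MvPolynomial α ℂ}
    (hf : f ∈ MvPolynomial.homogeneousSubmodule α ℂ p) {w : ExteriorAlgebra ℂ (β → ℂ)}
    (hw : w ∈ ⋀[ℂ]^q (β → ℂ)) : ofTensor α β (f ⊗ₜ[ℂ] w) ∈ superSymPow α β k :=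
  Submodule.mem_iSup_of_mem ⟨(p, q), hpq⟩
    (Submodule.mem_map_of_mem (Submodule.apply_mem_map₂ _ hf hw))

theorem extMul_mem (b : β) {q : ℕ} {w : ExteriorAlgebra ℂ (β → ℂ)} (hw : w ∈ ⋀[ℂ]^q (β → ℂ)) :
    extMul b w ∈ ⋀[ℂ]^(q + 1) (β → ℂ) := by
  rw [ExteriorAlgebra.exteriorPower, pow_succ']
  exact Submodule.mul_mem_mul (LinearMap.mem_range_self _ _) hw

theorem extDer_zero (b : β) {w : ExteriorAlgebra ℂ (β → ℂ)} (hw : w ∈ ⋀[ℂ]^0 (β → ℂ)) :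
    extDer b w = 0 := by
  rw [ExteriorAlgebra.exteriorPower, pow_zero] at hw
  obtain ⟨c, rfl⟩ := Submodule.mem_one.1 hw
  exact CliffordAlgebra.contractLeft_algebraMap (Q := (0 : QuadraticForm ℂ (β → ℂ))) _ c

theorem extDer_mem (b : β) {q : ℕ} {w : ExteriorAlgebra ℂ (β → ℂ)}
    (hw : w ∈ ⋀[ℂ]^(q + 1) (β → ℂ)) : extDer b w ∈ ⋀[ℂ]^q (β → ℂ) := by
  induction q generalizing w with
  | zero =>
    rw [ExteriorAlgebra.exteriorPower, zero_add, pow_one] at hw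
    obtain ⟨v, rfl⟩ := hw
    rw [ExteriorAlgebra.exteriorPower, pow_zero]
    refine Submodule.mem_one.2 ⟨v b, ?_⟩
    exact (CliffordAlgebra.contractLeft_ι (Q := (0 : QuadraticForm ℂ (β → ℂ)))
      (LinearMap.proj b) v).symm
  | succ q ih =>
    rw [ExteriorAlgebra.exteriorPower, pow_succ'] at hw
    refine Submodule.mul_induction_on hw ?_ ?_
    · rintro _ ⟨v, rfl⟩ x hx
      have h : extDer b (ExteriorAlgebra.ι ℂ v * x)
          = v b • x - ExteriorAlgebra.ι ℂ v * extDer b x :=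
        CliffordAlgebra.contractLeft_ι_mul _ _ _
      rw [h]
      refine Submodule.sub_mem _ (Submodule.smul_mem _ _ hx) ?_
      rw [ExteriorAlgebra.exteriorPower, pow_succ']
      exact Submodule.mul_mem_mul (LinearMap.mem_range_self _ _) (ih hx)
    · intro x y hx hy
      rw [map_add]
      exact Submodule.add_mem _ hx hy

theorem pderiv_zero (a : α) {f : MvPolynomial α ℂ}
    (hf : f ∈ MvPolynomial.homogeneousSubmodule α ℂ 0) : MvPolynomial.pderiv a f = 0 := by
  rw [MvPolynomial.homogeneousSubmodule_zero] at hf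
  obtain ⟨c, rfl⟩ := Submodule.mem_one.1 hf
  exact MvPolynomial.pderiv_C

theorem gen_mem (i : α ⊕ β) {k : ℕ} {v : SuperSym α β} (hv : v ∈ superSymPow α β k) :
    gen i v ∈ superSymPow α β (k + 1) := by
  refine map_mem_superSymPow _ (fun p q hpq f hf w hw => ?_) hv
  rcases i with a | b
  · rw [gen_inl]
    refine tmul_mem_superSymPow (p := 1 + p) (q := q) (by omega) ?_ hw
    exact (MvPolynomial.isHomogeneous_X ℂ a).mul hf
  · rw [gen_inr]
    exact tmul_mem_superSymPow (p := p) (q := q + 1) (by omega) hf (extMul_mem b hw)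

theorem der_mem (i : α ⊕ β) {k : ℕ} {v : SuperSym α β} (hv : v ∈ superSymPow α β (k + 1)) :
    der i v ∈ superSymPow α β k := by
  refine map_mem_superSymPow _ (fun p q hpq f hf w hw => ?_) hv
  rcases i with a | b
  · rcases p with _ | p
    · have h : MvPolynomial.pderiv a f = 0 := pderiv_zero a hf
      simp [der_inl, h]
    · rw [der_inl]
      refine tmul_mem_superSymPow (p := p) (q := q) (by omega) ?_ hw
      simpa using MvPolynomial.IsHomogeneous.pderiv (i := a) hf
  · rcases q with _ | q
    · simp [der_inr, extDer_zero b hw]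
    · rw [der_inr]
      exact tmul_mem_superSymPow (p := p) (q := q) (by omega) hf (extDer_mem b hw)

theorem der_zero (i : α ⊕ β) {v : SuperSym α β} (hv : v ∈ superSymPow α β 0) : der i v = 0 := by
  suffices superSymPow α β 0 ≤ LinearMap.ker (der i) from this hv
  refine iSup_le fun pq => Submodule.map_le_iff_le_comap.2 <|
    Submodule.map₂_le.2 fun f hf w hw => ?_
  obtain ⟨⟨p, q⟩, hpq⟩ := pq
  obtain ⟨rfl, rfl⟩ : p = 0 ∧ q = 0 := by
    simp only at hpq
    omega
  rcases i with a | b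
  · simp [der_inl, pderiv_zero a hf]
  · simp [der_inr, extDer_zero b hw]

/-- The action of `gl(V)` preserves each `S^k(V)`. -/
theorem symAct_mem (X : GlSuper α β) {k : ℕ} {v : SuperSym α β} (hv : v ∈ superSymPow α β k) :
    symAct X v ∈ superSymPow α β k := by
  rw [symAct_apply]
  simp only [LinearMap.sum_apply, LinearMap.smul_apply, Module.End.mul_apply]
  refine Submodule.sum_mem _ fun i _ => Submodule.sum_mem _ fun j _ => Submodule.smul_mem _ _ ?_
  rcases k with _ | k
  · rw [der_zero j hv, map_zero]
    exact Submodule.zero_mem _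
  · exact gen_mem i (der_mem j hv)

end SuperSym

/-! ### The commuting actions on `S(ℂ^d ⊗ ℂ^{m|n})` -/

section Howe

variable (d m n : ℕ)

/-- `S(ℂ^d ⊗ ℂ^{m|n})`; the even part of `ℂ^d ⊗ ℂ^{m|n}` is `ℂ^d ⊗ ℂ^m`, the odd part is
`ℂ^d ⊗ ℂ^n`. -/
abbrev HoweSpace : Type := SuperSym (Fin d × Fin m) (Fin d × Fin n)

/-- `S^k(ℂ^d ⊗ ℂ^{m|n})`. -/
abbrev howePow (k : ℕ) : Submodule ℂ (HoweSpace d m n) :=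
  superSymPow (Fin d × Fin m) (Fin d × Fin n) k

variable {d m n}

/-- An operator on `ℂ^d ⊗ ℂ^{m|n}` as an element of `gl(dm|dn)`. -/
def tensorIndex (M : Matrix (Fin d × (Fin m ⊕ Fin n)) (Fin d × (Fin m ⊕ Fin n)) ℂ) :
    GlSuper (Fin d × Fin m) (Fin d × Fin n) :=
  M.reindex (Equiv.prodSumDistrib _ _ _) (Equiv.prodSumDistrib _ _ _)

/-- The action `X ⊗ 1` of `gl(d)` on `ℂ^d ⊗ ℂ^{m|n}`. -/
def onLeft : Matrix (Fin d) (Fin d) ℂ →ₗ[ℂ] GlSuper (Fin d × Fin m) (Fin d × Fin n) where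
  toFun X := tensorIndex (X ⊗ₖ (1 : GlSuper (Fin m) (Fin n)))
  map_add' X Y := by ext i j; simp [tensorIndex, add_mul]
  map_smul' c X := by ext i j; simp [tensorIndex, mul_assoc]

/-- The action `1 ⊗ X` of `gl(m|n)` on `ℂ^d ⊗ ℂ^{m|n}`. -/
def onRight : GlSuper (Fin m) (Fin n) →ₗ[ℂ] GlSuper (Fin d × Fin m) (Fin d × Fin n) where
  toFun X := tensorIndex ((1 : Matrix (Fin d) (Fin d) ℂ) ⊗ₖ X)
  map_add' X Y := by ext i j; simp [tensorIndex, mul_add]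
  map_smul' c X := by ext i j; simp [tensorIndex, mul_left_comm]

theorem onLeft_mul (X Y : Matrix (Fin d) (Fin d) ℂ) :
    (onLeft (X * Y) : GlSuper (Fin d × Fin m) (Fin d × Fin n)) = onLeft X * onLeft Y := by
  change tensorIndex _ = tensorIndex _ * tensorIndex _
  simp only [tensorIndex, Matrix.reindex_apply, Matrix.submatrix_mul_equiv,
    ← Matrix.mul_kronecker_mul, one_mul]

theorem onRight_mul (X Y : GlSuper (Fin m) (Fin n)) :
    (onRight (X * Y) : GlSuper (Fin d × Fin m) (Fin d × Fin n)) = onRight X * onRight Y := by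
  change tensorIndex _ = tensorIndex _ * tensorIndex _
  simp only [tensorIndex, Matrix.reindex_apply, Matrix.submatrix_mul_equiv,
    ← Matrix.mul_kronecker_mul, one_mul]

theorem isHomog_onLeft (X : Matrix (Fin d) (Fin d) ℂ) :
    IsHomog 0 (onLeft X : GlSuper (Fin d × Fin m) (Fin d × Fin n)) := by
  rintro (⟨i, a⟩ | ⟨i, a⟩) (⟨j, b⟩ | ⟨j, b⟩) h <;>
    simp [onLeft, tensorIndex, par, Matrix.one_apply] at h ⊢
  rfl

theorem isHomog_onRight {a : ZMod 2} {X : GlSuper (Fin m) (Fin n)} (hX : IsHomog a X) :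
    IsHomog a (onRight X : GlSuper (Fin d × Fin m) (Fin d × Fin n)) := by
  rintro (⟨i, x⟩ | ⟨i, x⟩) (⟨j, y⟩ | ⟨j, y⟩) h
  all_goals
    simp only [onRight, tensorIndex, LinearMap.coe_mk, AddHom.coe_mk, Matrix.reindex_apply,
      Matrix.submatrix_apply, Equiv.prodSumDistrib_symm_apply_left,
      Equiv.prodSumDistrib_symm_apply_right, Matrix.kroneckerMap_apply] at h
    exact hX _ _ (right_ne_zero_of_mul h)

variable (d m n)

/-- The action of `U(gl(d))` on `S(ℂ^d ⊗ ℂ^{m|n})`. -/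
def glRep : UGl d →ₐ[ℂ] Module.End ℂ (HoweSpace d m n) :=
  UniversalEnvelopingAlgebra.lift ℂ
    { symAct ∘ₗ onLeft with
      map_lie' := by
        intro X Y
        have h := symAct_bracket 0 0 (onLeft X : GlSuper (Fin d × Fin m) (Fin d × Fin n))
          (onLeft Y) (isHomog_onLeft X) (isHomog_onLeft Y)
        have hs : sgn 0 0 = 1 := by simp [sgn]
        simp only [hs, one_smul, superBracket] at h
        change symAct (onLeft (X * Y - Y * X)) = symAct (onLeft X) * symAct (onLeft Y)
          - symAct (onLeft Y) * symAct (onLeft X)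
        rw [h, map_sub, onLeft_mul, onLeft_mul] }

/-- The action of `gl(m|n)` on `S(ℂ^d ⊗ ℂ^{m|n})`. -/
def glSuperAct : GlSuper (Fin m) (Fin n) →ₗ[ℂ] Module.End ℂ (HoweSpace d m n) :=
  symAct ∘ₗ onRight

theorem glSuperAct_bracket (a b : ZMod 2) (X Y : GlSuper (Fin m) (Fin n)) (hX : IsHomog a X)
    (hY : IsHomog b Y) :
    glSuperAct d m n X * glSuperAct d m n Y - sgn a b • (glSuperAct d m n Y * glSuperAct d m n X)
      = glSuperAct d m n (superBracket a b X Y) := by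
  have h := symAct_bracket a b (onRight X : GlSuper (Fin d × Fin m) (Fin d × Fin n))
    (onRight Y) (isHomog_onRight hX) (isHomog_onRight hY)
  refine h.trans (congrArg symAct ?_)
  simp only [superBracket, map_sub, map_smul, onRight_mul]

/-- The action of `U(gl(m|n))` on `S(ℂ^d ⊗ ℂ^{m|n})`. -/
def glSuperRep : UGlSuper (Fin m) (Fin n) →ₐ[ℂ] Module.End ℂ (HoweSpace d m n) :=
  UGlSuper.lift (glSuperAct d m n) (glSuperAct_bracket d m n)

/-- The operators preserving a subspace. -/
def stabilizer {M : Type} [AddCommGroup M] [Module ℂ M] (p : Submodule ℂ M) :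
    Subalgebra ℂ (Module.End ℂ M) where
  carrier := {T | ∀ v ∈ p, T v ∈ p}
  mul_mem' hS hT v hv := hS _ (hT v hv)
  add_mem' hS hT v hv := p.add_mem (hS v hv) (hT v hv)
  algebraMap_mem' c _ hv := p.smul_mem c hv

theorem glRep_mem (k : ℕ) (u : UGl d) {v : HoweSpace d m n} (hv : v ∈ howePow d m n k) :
    glRep d m n u v ∈ howePow d m n k := by
  suffices h : ∀ x : TensorAlgebra ℂ (Matrix (Fin d) (Fin d) ℂ),
      glRep d m n (UniversalEnvelopingAlgebra.mkAlgHom ℂ _ x) ∈ stabilizer (howePow d m n k) by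
    obtain ⟨x, rfl⟩ := RingCon.mkₐ_surjective (α := ℂ)
      (UniversalEnvelopingAlgebra.ringCon ℂ (Matrix (Fin d) (Fin d) ℂ)) u
    exact h x v hv
  intro x
  induction x using TensorAlgebra.induction with
  | algebraMap c =>
    rw [AlgHom.commutes, AlgHom.commutes]
    exact Subalgebra.algebraMap_mem _ c
  | ι X =>
    have h : glRep d m n (UniversalEnvelopingAlgebra.mkAlgHom ℂ _ (TensorAlgebra.ι ℂ X))
        = symAct (onLeft X) := UniversalEnvelopingAlgebra.lift_ι_apply' ℂ _ X
    rw [h]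
    exact fun v hv => symAct_mem _ hv
  | mul x y hx hy =>
    rw [map_mul, map_mul]
    exact Subalgebra.mul_mem _ hx hy
  | add x y hx hy =>
    rw [map_add, map_add]
    exact Subalgebra.add_mem _ hx hy

theorem glSuperRep_mem (k : ℕ) (u : UGlSuper (Fin m) (Fin n)) {v : HoweSpace d m n}
    (hv : v ∈ howePow d m n k) : glSuperRep d m n u v ∈ howePow d m n k := by
  suffices h : ∀ x : TensorAlgebra ℂ (GlSuper (Fin m) (Fin n)),
      glSuperRep d m n (RingQuot.mkAlgHom ℂ (UGlSuperRel (Fin m) (Fin n)) x)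
        ∈ stabilizer (howePow d m n k) by
    obtain ⟨x, rfl⟩ := RingQuot.mkAlgHom_surjective ℂ (UGlSuperRel (Fin m) (Fin n)) u
    exact h x v hv
  intro x
  induction x using TensorAlgebra.induction with
  | algebraMap c =>
    rw [AlgHom.commutes]
    exact (congrArg (· ∈ stabilizer (howePow d m n k)) ((glSuperRep d m n).commutes c)).mpr
      (Subalgebra.algebraMap_mem _ c)
  | ι X =>
    have h : glSuperRep d m n (UGlSuper.ι _ _ X) = symAct (onRight X) :=
      UGlSuper.lift_ι (glSuperAct d m n) (glSuperAct_bracket d m n) X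
    exact (congrArg (· ∈ stabilizer (howePow d m n k)) h).mpr fun v hv => symAct_mem _ hv
  | mul x y hx hy =>
    rw [map_mul]
    exact (congrArg (· ∈ stabilizer (howePow d m n k)) ((glSuperRep d m n).map_mul _ _)).mpr
      (Subalgebra.mul_mem _ hx hy)
  | add x y hx hy =>
    rw [map_add]
    exact (congrArg (· ∈ stabilizer (howePow d m n k)) ((glSuperRep d m n).map_add _ _)).mpr
      (Subalgebra.add_mem _ hx hy)

/-- The restriction of a representation to an invariant subspace. -/
def restrictRep {U M : Type} [Ring U] [Algebra ℂ U] [AddCommGroup M] [Module ℂ M]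
    (ρ : U →ₐ[ℂ] Module.End ℂ M) (p : Submodule ℂ M) (h : ∀ (u : U) {v : M}, v ∈ p → ρ u v ∈ p) :
    U →ₐ[ℂ] Module.End ℂ p where
  toFun u := (ρ u).restrict fun _ hv => h u hv
  map_one' := by ext v; simp
  map_mul' u u' := by ext v; simp
  map_zero' := by ext v; simp
  map_add' u u' := by ext v; simp
  commutes' c := by ext v; simp [Module.algebraMap_end_apply]

/-- The action of `U(gl(d))` on `S^k(ℂ^d ⊗ ℂ^{m|n})`. -/
def glRepPow (k : ℕ) : UGl d →ₐ[ℂ] Module.End ℂ (howePow d m n k) :=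
  restrictRep (glRep d m n) (howePow d m n k) (glRep_mem d m n k)

/-- The action of `U(gl(m|n))` on `S^k(ℂ^d ⊗ ℂ^{m|n})`. -/
def glSuperRepPow (k : ℕ) : UGlSuper (Fin m) (Fin n) →ₐ[ℂ] Module.End ℂ (howePow d m n k) :=
  restrictRep (glSuperRep d m n) (howePow d m n k) (glSuperRep_mem d m n k)

/-- The closure of an algebra of operators in the finite topology (pointwise convergence, the space
being discrete): `T` agrees with an element of `A` on every finite set of vectors. -/
def finiteClosure {M : Type} [AddCommGroup M] [Module ℂ M] (A : Subalgebra ℂ (Module.End ℂ M)) :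
    Set (Module.End ℂ M) :=
  {T | ∀ s : Finset M, ∃ a ∈ A, ∀ v ∈ s, T v = a v}

end Howe

end SuperHowe
end

open scoped TensorProduct DirectSum Kronecker

noncomputable section

namespace SuperHowe

set_option linter.unusedSectionVars false
set_option linter.unusedSimpArgs false

attribute [local instance 100] LieRing.ofAssociativeRing

/-! Write z_{ia} for the generators of S and ∂_{ia} for the dual superderivations. The matrix units
act by `rowOp i j` = Σ_a z_{ia}∂_{ja} and `colOp a b` = Σ_i z_{ia}∂_{ib}, which commute by the super
canonical commutation relations.

Double centralizer. Iterating Euler's identity shows that on S^k the sum over all words of k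
generators followed by the matching derivations is k! (`sum_genWord_derWord`). Grouping the words by
their columns factors this through copies of the tensor power (ℂ^d)^{⊗k}, by the gl(d)-equivariant
maps `wordMap` and `coordMap`. An operator on S^k commuting with gl(d) thus becomes a family of
gl(d)-endomorphisms of the tensor power. By Schur–Weyl duality (`mem_span_permRep`) these are
combinations of permutations. Carried back to S^k, a permutation becomes a multiple of Σ_I G_{I,A}
D_{I,B}, which lies in the image of U(gl(m|n)) by recursion on k (`wordOp_mem`). This gives
`exists_glSuperRep_eq`. The same maps show that S is semisimple over gl(d), and the other
centralizer follows from Jacobson density. On all of S, the Euler operator belongs to both images.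
Hence an operator in a centralizer preserves degrees, and Lagrange polynomials in the Euler operator
glue the finitely many degrees that matter.

Decomposition. By semisimplicity S is determined over gl(d) by its spaces `rowSing` of singular
vectors of given weight. Two nonzero vectors of such a space are related by an endomorphism of some
S^k, hence by U(gl(m|n)) (`exists_col_smul_eq`), so the space is zero or a simple gl(m|n)-module. It
remains to find the weights that occur and the gl(m|n)-highest weight of each space. For the latter,
`Peeled.step` applies to a joint singular vector the highest nonvanishing power of one even
derivation. This removes a row and a column and shows that their two weights equal the exponent.
When only odd variables are left, the vector is compared with an explicit odd monomial of the same
gl(d)-weight: both lie in one simple gl(m|n)-module, and being singular for one Borel subalgebra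
they have the same gl(m|n)-weight (`joint_weight`). Every hook partition does occur: its first n
columns give an odd monomial, and each later column, of length at most m, gives a minor of the even
variables (`exists_singular_truncated`).

Highest weight theory is used only in a weak form, without a PBW theorem. The Verma module is
controlled by a single height element of the Cartan subalgebra, and the simple quotients are
recognised inside semisimple modules (`MatrixUnits.exists_simpleHW`). -/

/-! ### Highest weight theory for algebras generated by matrix units -/

section Triangular

variable {I U M : Type} [Fintype I] [DecidableEq I] [Ring U] [Algebra ℂ U]
  [AddCommGroup M] [Module ℂ M] [Module U M] [IsScalarTower ℂ U M]

/-- The relations of matrix units in an enveloping (super)algebra that highest weight theory uses. -/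
structure MatrixUnits (e : I → I → U) : Prop where
  adjoin_eq : Algebra.adjoin ℂ (Set.range fun p : I × I => e p.1 p.2) = ⊤
  comm : ∀ i j k l, ∃ s : ℂ, e i j * e k l - s • (e k l * e i j)
    ∈ Submodule.span ℂ (Set.range fun p : I × I => e p.1 p.2)
  cartan : ∀ i k l, e i i * e k l = e k l * e i i
    + ((if i = k then 1 else 0) - (if i = l then 1 else 0) : ℂ) • e k l

/-- `v` is a singular vector of weight `wt` for the Borel subalgebra of the order of the
indices by the height `c`. -/
def IsSingular (e : I → I → U) (c : I → ℕ) (wt : I → ℂ) (v : M) : Prop :=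
  (∀ i j, c i < c j → e i j • v = 0) ∧ ∀ i, e i i • v = wt i • v

/-- The element of the Cartan subalgebra whose adjoint eigenvalues are the height differences. -/
def heightElt (e : I → I → U) (c : I → ℕ) : U := ∑ i, (-(c i : ℂ)) • e i i

/-- The eigenvalue of the height element on a weight vector. -/
def heightVal (c : I → ℕ) (wt : I → ℂ) : ℂ := ∑ i, (-(c i : ℂ)) * wt i

variable (M) in
/-- The action of the height element. -/
abbrev heightEnd (e : I → I → U) (c : I → ℕ) : Module.End ℂ M :=
  Algebra.lsmul ℂ ℂ M (heightElt e c)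

variable (M) in
/-- The sum of the eigenspaces below the eigenvalue `a`. -/
def below (e : I → I → U) (c : I → ℕ) (a : ℂ) : Submodule ℂ M :=
  ⨆ r : ℕ, (heightEnd M e c).eigenspace (a - (r + 1 : ℕ))

variable {e : I → I → U} {c : I → ℕ} {wt : I → ℂ} {v : M}

/-- By the Cartan relations every matrix unit is an eigenvector for commutation with the height
element. Strictly lower triangular units therefore lower height eigenvalues by positive integers,
and strictly upper ones raise them. -/
theorem MatrixUnits.height_mul (h : MatrixUnits e) (k l : I) :
    heightElt e c * e k l = e k l * heightElt e c + ((c l : ℂ) - c k) • e k l := by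
  simp only [heightElt, Finset.sum_mul, Finset.mul_sum, smul_mul_assoc, mul_smul_comm, h.cartan,
    smul_add, Finset.sum_add_distrib, smul_smul, ← Finset.sum_smul]
  congr 2
  simp only [mul_sub, mul_ite, mul_one, mul_zero, Finset.sum_sub_distrib, Finset.sum_ite_eq',
    Finset.mem_univ, if_true]
  ring

theorem IsSingular.height (hv : IsSingular e c wt v) :
    v ∈ (heightEnd M e c).eigenspace (heightVal c wt) := by
  rw [Module.End.mem_eigenspace_iff]
  simp only [heightEnd, Algebra.lsmul_coe, heightElt, Finset.sum_smul, smul_assoc, hv.2,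
    heightVal, smul_smul]

theorem MatrixUnits.smul_mem_eigenspace (h : MatrixUnits e) (k l : I) {a : ℂ} {x : M}
    (hx : x ∈ (heightEnd M e c).eigenspace a) :
    e k l • x ∈ (heightEnd M e c).eigenspace (a + ((c l : ℂ) - c k)) := by
  rw [Module.End.mem_eigenspace_iff] at hx ⊢
  simp only [heightEnd, Algebra.lsmul_coe] at hx ⊢
  rw [← mul_smul, h.height_mul, add_smul, mul_smul, hx, smul_assoc, add_smul,
    ← algebraMap_smul U a x, ← mul_smul, ← Algebra.commutes, mul_smul, algebraMap_smul]

/-- A subspace which contains a singular vector and is stable under the strictly lower triangular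
matrix units contains the submodule generated by the singular vector. -/
theorem MatrixUnits.smul_mem_of_lower (h : MatrixUnits e) (hc : Function.Injective c)
    (hv : IsSingular e c wt v) (X : Submodule ℂ M) (hvX : v ∈ X)
    (hX : ∀ k l, c l < c k → ∀ x ∈ X, e k l • x ∈ X) (u : U) : u • v ∈ X := by
  -- Instead of ordering monomials as in PBW, take the least subspace with the two properties and
  -- show that all matrix units preserve it.
  let C : Set (Submodule ℂ M) := {X | v ∈ X ∧ ∀ k l, c l < c k → ∀ x ∈ X, e k l • x ∈ X}
  set X₀ := sInf C with hX₀
  have hX₀C : X₀ ∈ C := by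
    refine ⟨Submodule.mem_sInf.2 fun p hp => hp.1, fun k l hkl x hx => ?_⟩
    exact Submodule.mem_sInf.2 fun p hp => hp.2 k l hkl x (Submodule.mem_sInf.1 hx p hp)
  -- `Y` collects the vectors of `X₀` which no matrix unit moves out of `X₀`. Once `Y` is in `C`,
  -- minimality gives `X₀ ≤ Y`.
  let Y : Submodule ℂ M :=
    { carrier := {x | x ∈ X₀ ∧ ∀ i j, e i j • x ∈ X₀}
      add_mem' := fun {x y} hx hy => ⟨add_mem hx.1 hy.1, fun i j => by
        rw [smul_add]; exact add_mem (hx.2 i j) (hy.2 i j)⟩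
      zero_mem' := ⟨zero_mem _, fun i j => by simp⟩
      smul_mem' := fun t x hx => ⟨Submodule.smul_mem _ t hx.1, fun i j => by
        have : e i j • t • x = t • e i j • x := by
          rw [← algebraMap_smul U t x, ← mul_smul, ← Algebra.commutes, mul_smul, algebraMap_smul]
        rw [this]; exact Submodule.smul_mem _ t (hx.2 i j)⟩ }
  have hY : Y ∈ C := by
    refine ⟨⟨hX₀C.1, fun i j => ?_⟩, fun k l hkl x hx => ⟨hX₀C.2 k l hkl x hx.1, fun i j => ?_⟩⟩
    · rcases lt_trichotomy (c i) (c j) with hij | hij | hij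
      · rw [hv.1 i j hij]; exact zero_mem _
      · obtain rfl := hc hij
        rw [hv.2 i]; exact Submodule.smul_mem _ _ hX₀C.1
      · exact hX₀C.2 i j hij v hX₀C.1
    · obtain ⟨s, hs⟩ := h.comm i j k l
      have hz : ∀ z ∈ Submodule.span ℂ (Set.range fun p : I × I => e p.1 p.2), z • x ∈ X₀ := by
        intro z hz
        induction hz using Submodule.span_induction with
        | mem z hz => obtain ⟨p, rfl⟩ := hz; exact hx.2 _ _
        | zero => simp
        | add y z _ _ hy hz => rw [add_smul]; exact add_mem hy hz
        | smul t z _ hz => rw [smul_assoc]; exact Submodule.smul_mem _ _ hz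
      have h1 := hz _ hs
      -- Lower stability of `Y`: the supercommutator is a combination of matrix units, harmless on
      -- `x ∈ Y`, and in the other term the lower unit acts last, on a vector of `X₀`.
      have h2 : e i j • e k l • x
          = (e i j * e k l - s • (e k l * e i j)) • x + s • e k l • e i j • x := by
        rw [sub_smul, smul_assoc, mul_smul, mul_smul]; abel
      rw [h2]
      exact add_mem h1 (Submodule.smul_mem _ _ (hX₀C.2 k l hkl _ (hx.2 i j)))
  have hYle : X₀ ≤ Y := sInf_le hY
  have hst : ∀ u : U, ∀ x ∈ X₀, u • x ∈ X₀ := by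
    intro u
    have hu : u ∈ Algebra.adjoin ℂ (Set.range fun p : I × I => e p.1 p.2) := by
      rw [h.adjoin_eq]; trivial
    induction hu using Algebra.adjoin_induction with
    | mem z hz => obtain ⟨p, rfl⟩ := hz; exact fun x hx => (hYle hx).2 _ _
    | algebraMap t => intro x hx; rw [algebraMap_smul]; exact Submodule.smul_mem _ _ hx
    | add y z _ _ hy hz => intro x hx; rw [add_smul]; exact add_mem (hy x hx) (hz x hx)
    | mul y z _ _ hy hz => intro x hx; rw [mul_smul]; exact hy _ (hz x hx)
  exact (sInf_le (show X ∈ C from ⟨hvX, hX⟩) : X₀ ≤ X) (hst u v hX₀C.1)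

theorem MatrixUnits.smul_mem_below (h : MatrixUnits e) {a : ℂ} {k l : I} (hkl : c l < c k)
    {x : M} (hx : x ∈ (heightEnd M e c).eigenspace a) : e k l • x ∈ below M e c a := by
  have h1 := h.smul_mem_eigenspace (c := c) k l hx
  obtain ⟨t, ht⟩ := Nat.exists_eq_add_of_lt hkl
  refine Submodule.mem_iSup_of_mem t ?_
  convert h1 using 2
  rw [ht]; push_cast; ring

theorem below_mono (a : ℂ) (r : ℕ) : below M e c (a - r) ≤ below M e c a := by
  refine iSup_le fun s => ?_
  refine le_iSup_of_le (r + s) (le_of_eq ?_)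
  congr 1; push_cast; ring

theorem MatrixUnits.below_stable (h : MatrixUnits e) {a : ℂ} {k l : I} (hkl : c l < c k)
    {x : M} (hx : x ∈ below M e c a) : e k l • x ∈ below M e c a := by
  refine Submodule.iSup_induction (p := fun r : ℕ => (heightEnd M e c).eigenspace (a - (r + 1 : ℕ)))
    (motive := fun x => e k l • x ∈ below M e c a) hx ?_ (by simp) ?_
  · intro r x hx
    exact below_mono a (r + 1) (h.smul_mem_below hkl hx)
  · intro x y hx hy; rw [smul_add]; exact add_mem hx hy

/-- The line of `v` together with everything of smaller height is stable under the lower units, so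
it absorbs the whole submodule generated by `v`. -/
theorem MatrixUnits.smul_mem_sup (h : MatrixUnits e) (hc : Function.Injective c)
    (hv : IsSingular e c wt v) (u : U) :
    u • v ∈ (ℂ ∙ v) ⊔ below M e c (heightVal c wt) := by
  refine h.smul_mem_of_lower hc hv _
    (Submodule.mem_sup_left (Submodule.mem_span_singleton_self v)) ?_ u
  intro k l hkl x hx
  obtain ⟨y, hy, z, hz, rfl⟩ := Submodule.mem_sup.1 hx
  refine Submodule.mem_sup_right ?_
  rw [smul_add]
  refine add_mem (h.smul_mem_below hkl ?_) (h.below_stable hkl hz)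
  exact (Submodule.span_singleton_le_iff_mem _ _).2 hv.height hy

theorem disjoint_below (a : ℂ) : Disjoint ((heightEnd M e c).eigenspace a) (below M e c a) := by
  refine (Module.End.eigenspaces_iSupIndep (heightEnd M e c) a).mono_right ?_
  refine iSup_le fun r => le_iSup₂_of_le (a - (r + 1 : ℕ)) ?_ le_rfl
  simp only [ne_eq, sub_eq_self]
  exact_mod_cast Nat.succ_ne_zero r

/-- A vector below `a` has finitely many height components, all with eigenvalues different from `a`.
The product of the corresponding linear factors separates it from the eigenvalue `a`. -/
theorem exists_polynomial_below (a : ℂ) {x : M} (hx : x ∈ below M e c a) :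
    ∃ p : Polynomial ℂ, Polynomial.aeval (heightEnd M e c) p x = 0 ∧ p.eval a ≠ 0 := by
  refine Submodule.iSup_induction (p := fun r : ℕ => (heightEnd M e c).eigenspace (a - (r + 1 : ℕ)))
    (motive := fun x => ∃ p : Polynomial ℂ, Polynomial.aeval (heightEnd M e c) p x = 0 ∧
      p.eval a ≠ 0) hx ?_ ⟨1, by simp⟩ ?_
  · intro r x hx
    rw [Module.End.mem_eigenspace_iff] at hx
    refine ⟨Polynomial.X - Polynomial.C (a - (r + 1 : ℕ)), ?_, ?_⟩
    · rw [map_sub, Polynomial.aeval_X, Polynomial.aeval_C, LinearMap.sub_apply, hx,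
        Module.algebraMap_end_apply, sub_self]
    · simp only [Polynomial.eval_sub, Polynomial.eval_X, Polynomial.eval_C, sub_sub_cancel]
      exact_mod_cast Nat.succ_ne_zero r
  · rintro x y ⟨p, hp, hp'⟩ ⟨q, hq, hq'⟩
    refine ⟨p * q, ?_, by simp [hp', hq']⟩
    rw [map_add]
    have h1 : Polynomial.aeval (heightEnd M e c) (p * q) y = 0 := by
      rw [map_mul, Module.End.mul_apply, hq, map_zero]
    have h2 : Polynomial.aeval (heightEnd M e c) (p * q) x = 0 := by
      rw [mul_comm, map_mul, Module.End.mul_apply, hp, map_zero]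
    rw [h1, h2, add_zero]

theorem aeval_lsmul_mem (N : Submodule U M) (z : U) (p : Polynomial ℂ) {x : M} (hx : x ∈ N) :
    Polynomial.aeval (Algebra.lsmul ℂ ℂ M z) p x ∈ N := by
  have : Polynomial.aeval (Algebra.lsmul ℂ ℂ M z) p
      = Algebra.lsmul ℂ ℂ M (Polynomial.aeval z p) := by
    rw [← Polynomial.aeval_algHom_apply]
  rw [this]
  exact N.smul_mem _ hx

/-- In a module generated by a singular vector, proper submodules lie below that vector. -/
theorem MatrixUnits.le_below (h : MatrixUnits e) (hc : Function.Injective c)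
    (hv : IsSingular e c wt v) (hgen : Submodule.span U {v} = ⊤) {N : Submodule U M} (hN : N ≠ ⊤)
    {x : M} (hx : x ∈ N) : x ∈ below M e c (heightVal c wt) := by
  have hx' : x ∈ Submodule.span U {v} := by rw [hgen]; trivial
  obtain ⟨u, rfl⟩ := Submodule.mem_span_singleton.1 hx'
  obtain ⟨y, hy, q, hq, hyq⟩ := Submodule.mem_sup.1 (h.smul_mem_sup hc hv u)
  obtain ⟨t, rfl⟩ := Submodule.mem_span_singleton.1 hy
  by_cases ht : t = 0
  · rw [← hyq, ht, zero_smul, zero_add]; exact hq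
  exfalso
  apply hN
  -- Were the coefficient `t` of `v` nonzero, this polynomial in the height element would erase the
  -- lower part and leave a nonzero multiple of `v` inside `N`.
  obtain ⟨p, hp, hpa⟩ := exists_polynomial_below _ hq
  have h1 := aeval_lsmul_mem N (heightElt e c) p hx
  rw [← hyq, map_add, hp, add_zero, map_smul,
    Module.End.aeval_apply_of_mem_apply_eq_smul
      (Module.End.mem_eigenspace_iff.1 hv.height), smul_smul] at h1
  have h2 : v ∈ N := by
    have h3 := N.smul_mem (algebraMap ℂ U (t * p.eval (heightVal c wt))⁻¹) h1
    rw [algebraMap_smul, smul_smul, inv_mul_cancel₀ (mul_ne_zero ht hpa), one_smul] at h3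
    exact h3
  rw [eq_top_iff, ← hgen, Submodule.span_singleton_le_iff_mem]
  exact h2

/-- In a module generated by a singular vector, the sum of all proper submodules is proper. -/
theorem MatrixUnits.sSup_ne_top (h : MatrixUnits e) (hc : Function.Injective c)
    (hv : IsSingular e c wt v) (hv0 : v ≠ 0) (hgen : Submodule.span U {v} = ⊤) :
    sSup {N : Submodule U M | N ≠ ⊤} ≠ ⊤ := by
  intro htop
  have hvm : v ∈ sSup {N : Submodule U M | N ≠ ⊤} := by rw [htop]; trivial
  rw [sSup_eq_iSup'] at hvm
  have hb : v ∈ below M e c (heightVal c wt) := by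
    refine Submodule.iSup_induction (p := fun N : {N : Submodule U M | N ≠ ⊤} => (N : Submodule U M))
      (motive := fun x => x ∈ below M e c (heightVal c wt)) hvm ?_ (zero_mem _)
      (fun x y hx hy => add_mem hx hy)
    intro N x hx
    exact h.le_below hc hv hgen N.2 hx
  exact hv0 ((Submodule.mem_bot ℂ).1 ((disjoint_below _).le_bot ⟨hv.height, hb⟩))

/-- Singular vectors which generate each other have the same weight. -/
theorem MatrixUnits.weight_eq (h : MatrixUnits e) (hc : Function.Injective c)
    {wt' : I → ℂ} {v' : M} (hv : IsSingular e c wt v) (hv' : IsSingular e c wt' v')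
    (hv0 : v ≠ 0) (hv0' : v' ≠ 0) {b b' : U} (hb : b • v = v') (hb' : b' • v' = v) : wt = wt' := by
  have key : ∀ {wt wt' : I → ℂ} {v v' : M}, IsSingular e c wt v → IsSingular e c wt' v' → v' ≠ 0 →
      ∀ b : U, b • v = v' → ∃ r : ℕ, heightVal c wt' = heightVal c wt - r := by
    intro wt wt' v v' hv hv' hv0' b hb
    by_contra hne
    push Not at hne
    have h1 : v' ∈ ⨆ (j : ℂ) (_ : j ≠ heightVal c wt'), (heightEnd M e c).eigenspace j := by
      have h2 := h.smul_mem_sup hc hv b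
      rw [hb] at h2
      refine (sup_le ?_ ?_ : (ℂ ∙ v) ⊔ below M e c (heightVal c wt) ≤ _) h2
      · rw [Submodule.span_singleton_le_iff_mem]
        refine Submodule.mem_iSup_of_mem (heightVal c wt) (Submodule.mem_iSup_of_mem ?_ hv.height)
        have := hne 0
        simpa using this.symm
      · exact iSup_le fun r => le_iSup₂_of_le (heightVal c wt - (r + 1 : ℕ)) (hne (r + 1)).symm le_rfl
    exact hv0' ((Submodule.mem_bot ℂ).1
      ((Module.End.eigenspaces_iSupIndep (heightEnd M e c) _).le_bot ⟨hv'.height, h1⟩))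
  -- The height can only drop in each direction, so both vectors have the same height. Then `v'` has
  -- no component below `v`, and is a multiple of it.
  obtain ⟨r, hr⟩ := key hv hv' hv0' b hb
  obtain ⟨r', hr'⟩ := key hv' hv hv0 b' hb'
  have hr0 : r = 0 := by
    have : ((r + r' : ℕ) : ℂ) = 0 := by push_cast; linear_combination hr + hr'
    have := Nat.cast_eq_zero.1 this
    omega
  have ha : heightVal c wt' = heightVal c wt := by rw [hr, hr0]; simp
  have h2 := h.smul_mem_sup hc hv b
  rw [hb] at h2
  obtain ⟨y, hy, q, hq, hyq⟩ := Submodule.mem_sup.1 h2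
  obtain ⟨t, rfl⟩ := Submodule.mem_span_singleton.1 hy
  have hq0 : q = 0 := by
    refine (Submodule.mem_bot ℂ).1 ((disjoint_below (e := e) (c := c) (heightVal c wt)).le_bot ⟨?_, hq⟩)
    have : q = v' - t • v := by rw [← hyq]; abel
    rw [this]
    exact sub_mem (ha ▸ hv'.height) (Submodule.smul_mem _ _ hv.height)
  rw [hq0, add_zero] at hyq
  funext i
  have h3 := hv'.2 i
  have h4 : e i i • t • v = t • e i i • v := by
    rw [← algebraMap_smul U t v, ← mul_smul, ← Algebra.commutes, mul_smul, algebraMap_smul]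
  rw [← hyq, h4, hv.2, smul_comm, hyq] at h3
  exact smul_left_injective ℂ hv0' h3

/-- A nonzero finite-dimensional module contains a singular vector. -/
theorem MatrixUnits.exists_singular (h : MatrixUnits e) (c : I → ℕ) [FiniteDimensional ℂ M]
    [Nontrivial M] : ∃ (v : M) (wt : I → ℂ), v ≠ 0 ∧ IsSingular e c wt v := by
  classical
  let K : Submodule ℂ M := ⨅ (p : I × I) (_ : c p.1 < c p.2),
    LinearMap.ker (Algebra.lsmul ℂ ℂ M (e p.1 p.2))
  have hK : ∀ x, x ∈ K ↔ ∀ i j, c i < c j → e i j • x = 0 := by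
    intro x
    simp [K, Submodule.mem_iInf]
  have hK0 : ∃ x ∈ K, x ≠ 0 := by
    have hfin : {a : ℂ | (heightEnd M e c).HasEigenvalue a}.Finite :=
      Module.End.finite_hasEigenvalue _
    obtain ⟨a₀, ha₀⟩ := Module.End.exists_eigenvalue (heightEnd M e c)
    -- A height eigenvector whose eigenvalue has maximal real part is killed by the raising units,
    -- since these would increase that real part.
    obtain ⟨a, ha, hmax⟩ := hfin.exists_maximalFor Complex.re _ ⟨a₀, ha₀⟩
    obtain ⟨x, hx⟩ := Module.End.HasEigenvalue.exists_hasEigenvector ha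
    refine ⟨x, (hK x).2 fun i j hij => ?_, hx.2⟩
    by_contra hne
    have h1 := h.smul_mem_eigenspace (c := c) i j hx.1
    have h2 := hmax (Module.End.hasEigenvalue_of_hasEigenvector ⟨h1, hne⟩)
    have h3 : (c i : ℝ) < c j := by exact_mod_cast hij
    simp only [Complex.add_re, Complex.sub_re, Complex.natCast_re] at h2
    linarith [h2 (by linarith)]
  have hcomm : ∀ (t : ℂ) (u : U) (x : M), u • t • x = t • u • x := by
    intro t u x
    rw [← algebraMap_smul U t x, ← mul_smul, ← Algebra.commutes, mul_smul, algebraMap_smul]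
  -- The diagonal units commute and preserve `K`, so a common eigenvector in `K` is found by adding
  -- one index at a time.
  suffices hs : ∀ s : Finset I, ∃ (wt : I → ℂ) (x : M), x ≠ 0 ∧ x ∈ K ∧ ∀ i ∈ s, e i i • x = wt i • x by
    obtain ⟨wt, x, hx0, hxK, hx⟩ := hs Finset.univ
    exact ⟨x, wt, hx0, (hK x).1 hxK, fun i => hx i (Finset.mem_univ i)⟩
  intro s
  induction s using Finset.induction_on with
  | empty =>
    obtain ⟨x, hx, hx0⟩ := hK0
    exact ⟨0, x, hx0, hx, by simp⟩
  | insert j s hj ih =>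
    obtain ⟨wt, x, hx0, hxK, hx⟩ := ih
    let K' : Submodule ℂ M := K ⊓ ⨅ (i : I) (_ : i ∈ s),
      LinearMap.ker (Algebra.lsmul ℂ ℂ M (e i i) - wt i • 1)
    have hK' : ∀ x, x ∈ K' ↔ x ∈ K ∧ ∀ i ∈ s, e i i • x = wt i • x := by
      intro x
      simp [K', Submodule.mem_iInf, sub_eq_zero]
    have hst : ∀ x ∈ K', Algebra.lsmul ℂ ℂ M (e j j) x ∈ K' := by
      intro x hx
      rw [hK'] at hx ⊢
      rw [hK] at hx ⊢
      simp only [Algebra.lsmul_coe]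
      refine ⟨fun k l hkl => ?_, fun i hi => ?_⟩
      · have h1 := h.cartan j k l
        have h2 : e k l * e j j = e j j * e k l
          - ((if j = k then 1 else 0) - (if j = l then 1 else 0) : ℂ) • e k l := by rw [h1]; abel
        rw [← mul_smul, h2, sub_smul, mul_smul, smul_assoc, hx.1 k l hkl, smul_zero, smul_zero,
          sub_zero]
      · rw [← mul_smul, h.cartan i j j, sub_self, zero_smul, add_zero, mul_smul, hx.2 i hi, hcomm]
    have : Nontrivial K' := ⟨⟨x, (hK' x).2 ⟨hxK, hx⟩⟩, 0, fun h0 => hx0 (congrArg Subtype.val h0)⟩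
    obtain ⟨a, ha⟩ := Module.End.exists_eigenvalue ((Algebra.lsmul ℂ ℂ M (e j j)).restrict hst)
    obtain ⟨y, hy⟩ := Module.End.HasEigenvalue.exists_hasEigenvector ha
    have hy1 : e j j • (y : M) = a • (y : M) := congrArg Subtype.val hy.apply_eq_smul
    have hyK := (hK' y).1 y.2
    refine ⟨Function.update wt j a, y, fun h0 => hy.2 (Subtype.ext h0), hyK.1, fun i hi => ?_⟩
    rcases Finset.mem_insert.1 hi with rfl | hi
    · simpa using hy1
    · have : i ≠ j := fun hij => hj (hij ▸ hi)
      rw [Function.update_of_ne this]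
      exact hyK.2 i hi

end Triangular

/-! ### Verma modules and their simple quotients inside semisimple modules -/

section VermaQuotient

variable {I U M : Type} [Fintype I] [DecidableEq I] [LT I] [Ring U] [Algebra ℂ U]
  [AddCommGroup M] [Module ℂ M] [Module U M] [IsScalarTower ℂ U M]
  {e : I → I → U} {c : I → ℕ} {wt : I → ℂ} {v : M}

/-- The highest weight vector of the Verma module. -/
def Verma.hw (e : I → I → U) (wt : I → ℂ) : Verma e wt := Submodule.Quotient.mk 1

/-- The highest weight vector of the simple highest weight module. -/
def SimpleHW.hw (e : I → I → U) (wt : I → ℂ) : SimpleHW e wt := Submodule.Quotient.mk (Verma.hw e wt)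

theorem Verma.smul_hw (u : U) : u • Verma.hw e wt = Submodule.Quotient.mk u := by
  rw [Verma.hw, ← Submodule.Quotient.mk_smul, smul_eq_mul, mul_one]

theorem Verma.span_hw : Submodule.span U {Verma.hw e wt} = ⊤ := by
  rw [eq_top_iff]
  intro x _
  obtain ⟨u, rfl⟩ := Submodule.Quotient.mk_surjective _ x
  exact Submodule.mem_span_singleton.2 ⟨u, Verma.smul_hw u⟩

theorem Verma.isSingular_hw (hlt : ∀ i j, c i < c j → i < j) : IsSingular e c wt (Verma.hw e wt) := by
  constructor
  · intro i j hij
    rw [Verma.smul_hw, Submodule.Quotient.mk_eq_zero]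
    exact Submodule.subset_span (Or.inl ⟨i, j, hlt i j hij, rfl⟩)
  · intro i
    rw [← algebraMap_smul U (wt i), Verma.smul_hw, Verma.smul_hw, Submodule.Quotient.eq]
    exact Submodule.subset_span (Or.inr ⟨i, rfl⟩)

/-- The homomorphism from the Verma module defined by a singular vector. -/
def Verma.lift (hlt : ∀ i j, i < j → c i < c j) (hv : IsSingular e c wt v) : Verma e wt →ₗ[U] M :=
  (vermaIdeal e wt).liftQ (LinearMap.toSpanSingleton U M v) <| by
    rw [vermaIdeal, Submodule.span_le]
    rintro x (⟨i, j, hij, rfl⟩ | ⟨i, rfl⟩)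
    · simpa using hv.1 i j (hlt i j hij)
    · simp [sub_smul, hv.2 i]

theorem Verma.lift_hw (hlt : ∀ i j, i < j → c i < c j) (hv : IsSingular e c wt v) :
    Verma.lift hlt hv (Verma.hw e wt) = v := by
  simp [Verma.lift, Verma.hw]

/-- A singular vector of a semisimple module generates a copy of the simple highest weight
module. -/
theorem MatrixUnits.exists_simpleHW (h : MatrixUnits e) (hc : Function.Injective c)
    (hlt : ∀ i j, i < j ↔ c i < c j) [IsSemisimpleModule U M] (hv : IsSingular e c wt v)
    (hv0 : v ≠ 0) : IsSimpleModule U (SimpleHW e wt) ∧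
      ∃ φ : SimpleHW e wt →ₗ[U] M, Function.Injective φ ∧ φ (SimpleHW.hw e wt) = v := by
  set φ₀ := Verma.lift (fun i j hij => (hlt i j).1 hij) hv with hφ₀
  have hφv : φ₀ (Verma.hw e wt) = v := Verma.lift_hw _ hv
  have hw0 : Verma.hw e wt ≠ 0 := fun h0 => hv0 (by rw [← hφv, h0, map_zero])
  have hrad : vermaRadical e wt ≠ ⊤ :=
    h.sSup_ne_top hc (Verma.isSingular_hw fun i j hij => (hlt i j).2 hij) hw0 Verma.span_hw
  have hle : ∀ N : Submodule U (Verma e wt), N ≠ ⊤ → N ≤ vermaRadical e wt :=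
    fun N hN => le_sSup hN
  have hker : LinearMap.ker φ₀ ≠ ⊤ := by
    intro htop
    have : Verma.hw e wt ∈ LinearMap.ker φ₀ := by rw [htop]; trivial
    exact hv0 (by rw [← hφv]; exact this)
  -- Take a complement `C` of the image of the radical. If its preimage were proper it would lie in
  -- the radical, which would then be everything. So `φ₀` maps into `C`, and the image of the
  -- radical, contained in `C` and disjoint from it, is zero.
  have heq : vermaRadical e wt = LinearMap.ker φ₀ := by
    refine le_antisymm ?_ (hle _ hker)
    obtain ⟨C, hC⟩ := exists_isCompl ((vermaRadical e wt).map φ₀)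
    have hCtop : C.comap φ₀ = ⊤ := by
      by_contra hne
      apply hrad
      rw [eq_top_iff]
      intro x _
      have hx : φ₀ x ∈ (vermaRadical e wt).map φ₀ ⊔ C := by rw [hC.sup_eq_top]; trivial
      obtain ⟨y, ⟨r, hr, rfl⟩, z, hz, hyz⟩ := Submodule.mem_sup.1 hx
      have h1 : x - r ∈ C.comap φ₀ := by
        rw [Submodule.mem_comap, map_sub, ← hyz, add_sub_cancel_left]; exact hz
      have := add_mem (hle _ hne h1) hr
      rwa [sub_add_cancel] at this
    intro x hx
    have h1 : φ₀ x ∈ (vermaRadical e wt).map φ₀ ⊓ C := by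
      refine ⟨Submodule.mem_map_of_mem hx, ?_⟩
      have : x ∈ C.comap φ₀ := by rw [hCtop]; trivial
      exact this
    rw [hC.inf_eq_bot] at h1
    exact h1
  refine ⟨isSimpleModule_iff_isCoatom.2 ⟨hrad, fun N hN => ?_⟩,
    (vermaRadical e wt).liftQ φ₀ heq.le, ?_, ?_⟩
  · by_contra hne
    exact absurd (hle N hne) (not_le_of_gt hN)
  · rw [← LinearMap.ker_eq_bot, Submodule.ker_liftQ_eq_bot]
    exact heq.ge
  · rw [SimpleHW.hw, Submodule.liftQ_apply, hφv]

end VermaQuotient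

/-! ### Double commutants of semisimple modules -/

section Bicommutant

variable {R M : Type} [Ring R] [Algebra ℂ R] [AddCommGroup M] [Module ℂ M] [Module R M]
  [IsScalarTower ℂ R M]

/-- An operator on a finite-dimensional semisimple module commuting with all endomorphisms of the
module is given by an element of the algebra. -/
theorem exists_smul_of_commute [FiniteDimensional ℂ M] [IsSemisimpleModule R M]
    (T : Module.End ℂ M) (hT : ∀ (g : M →ₗ[R] M) (x : M), T (g x) = g (T x)) :
    ∃ r : R, ∀ x, T x = r • x := by
  -- The hypothesis says that `T` belongs to the bicommutant. The density theorem on a finite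
  -- spanning set then gives one element acting as `T` everywhere.
  let f : Module.End (Module.End R M) M :=
    { toFun := T
      map_add' := map_add T
      map_smul' := fun g x => hT g x }
  obtain ⟨s, hs⟩ := (Module.Finite.fg_top : (⊤ : Submodule ℂ M).FG)
  obtain ⟨r, hr⟩ := jacobson_density f s
  refine ⟨r, fun x => ?_⟩
  have hx : x ∈ Submodule.span ℂ (s : Set M) := by rw [hs]; trivial
  induction hx using Submodule.span_induction with
  | mem y hy => exact hr y hy
  | zero => simp
  | add y z _ _ hy hz => rw [map_add, smul_add, hy, hz]
  | smul t y _ hy =>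
    rw [map_smul, hy, ← algebraMap_smul R t y, ← mul_smul, ← Algebra.commutes, mul_smul,
      algebraMap_smul]

/-- A finite-dimensional semisimple module is semisimple over an algebra which acts through all
endomorphisms of the module. -/
theorem isSemisimpleModule_of_moduleEnd {R' : Type} [Ring R'] [Module R' M]
    [FiniteDimensional ℂ M] [IsSemisimpleModule R M]
    (h₁ : ∀ (r : R') , ∃ g : M →ₗ[R] M, ∀ x, r • x = g x)
    (h₂ : ∀ g : M →ₗ[R] M, ∃ r : R', ∀ x, r • x = g x) : IsSemisimpleModule R' M := by
  have : Module.Finite R M := Module.Finite.of_restrictScalars_finite ℂ R M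
  -- A finitely generated semisimple module has a semisimple endomorphism ring, so complements exist
  -- over that ring. The hypotheses identify its submodules with the `R'`-submodules.
  have : IsSemisimpleRing (Module.End R M) := IsSemisimpleRing.moduleEnd R M
  refine { exists_isCompl := fun p => ?_ }
  let p' : Submodule (Module.End R M) M :=
    { p with
      smul_mem' := fun g x hx => by
        obtain ⟨r, hr⟩ := h₂ g
        change g x ∈ p
        rw [← hr]; exact p.smul_mem r hx }
  obtain ⟨q, hq⟩ := exists_isCompl p'
  let q' : Submodule R' M :=
    { q with
      smul_mem' := fun r x hx => by
        obtain ⟨g, hg⟩ := h₁ r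
        change r • x ∈ q
        rw [hg]; exact q.smul_mem g hx }
  refine ⟨q', ?_⟩
  refine ⟨Submodule.disjoint_def.2 fun x hx hx' =>
    Submodule.disjoint_def.1 hq.1 x (show x ∈ p' from hx) (show x ∈ q from hx'), ?_⟩
  have h3 := hq.2
  rw [codisjoint_iff, eq_top_iff] at h3 ⊢
  intro x _
  obtain ⟨y, hy, z, hz, hyz⟩ := Submodule.mem_sup.1 (h3 (Submodule.mem_top (x := x)))
  exact Submodule.mem_sup.2 ⟨y, hy, z, hz, hyz⟩

end Bicommutant

/-! ### Operators on tensor powers commuting with the general linear Lie algebra -/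

section SchurWeyl

variable {κ ι : Type} [Fintype κ] [DecidableEq κ] [Fintype ι] [DecidableEq ι]

/-- The tensor product of a family of matrices, as a matrix indexed by words. -/
def tensorMat (Y : κ → Matrix ι ι ℂ) : Matrix (κ → ι) (κ → ι) ℂ :=
  .of fun I J => ∏ p, Y p (I p) (J p)

theorem tensorMat_mul (Y Z : κ → Matrix ι ι ℂ) : tensorMat Y * tensorMat Z = tensorMat (Y * Z) := by
  ext I J
  simp only [tensorMat, Matrix.mul_apply, Matrix.of_apply, Pi.mul_apply, Finset.prod_univ_sum,
    Fintype.piFinset_univ, Finset.prod_mul_distrib]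

theorem tensorMat_one : tensorMat (1 : κ → Matrix ι ι ℂ) = 1 := by
  ext I J
  simp only [tensorMat, Matrix.of_apply, Pi.one_apply, Matrix.one_apply]
  by_cases h : I = J
  · simp [h]
  · obtain ⟨p, hp⟩ := Function.ne_iff.1 h
    rw [if_neg h]
    exact Finset.prod_eq_zero (Finset.mem_univ p) (if_neg hp)

theorem tensorMat_single (I J : κ → ι) :
    tensorMat (fun p => Matrix.single (I p) (J p) (1 : ℂ)) = Matrix.single I J 1 := by
  ext K L
  simp only [tensorMat, Matrix.of_apply, Matrix.single_apply]
  by_cases h : I = K ∧ J = L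
  · simp [h.1, h.2]
  · rw [if_neg h]
    have : ∃ p, ¬ (I p = K p ∧ J p = L p) := by
      by_contra hne
      push Not at hne
      exact h ⟨funext fun p => (hne p).1, funext fun p => (hne p).2⟩
    obtain ⟨p, hp⟩ := this
    exact Finset.prod_eq_zero (Finset.mem_univ p) (if_neg hp)

variable (κ) in
/-- The action of a matrix on the tensor power by derivations. -/
def coprodMat (X : Matrix ι ι ℂ) : Matrix (κ → ι) (κ → ι) ℂ := ∑ p, tensorMat (Pi.mulSingle p X)

/-- The symmetrization of a tensor product of matrices. -/
def symMat (Y : κ → Matrix ι ι ℂ) : Matrix (κ → ι) (κ → ι) ℂ :=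
  ∑ τ : Equiv.Perm κ, tensorMat (Y ∘ τ)

theorem symMat_comp (Y : κ → Matrix ι ι ℂ) (σ : Equiv.Perm κ) : symMat (Y ∘ σ) = symMat Y :=
  Fintype.sum_equiv (Equiv.mulLeft σ) _ _ fun _ => rfl

/-- In the summand of `τ`, acting in slot `p` multiplies the factor with label `τ p`. Reindexing the
slots by these labels makes the modified family independent of `τ`. -/
theorem coprodMat_mul_symMat (X : Matrix ι ι ℂ) (Y : κ → Matrix ι ι ℂ) :
    coprodMat κ X * symMat Y = ∑ s, symMat (Function.update Y s (X * Y s)) := by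
  have h1 : coprodMat κ X * symMat Y
      = ∑ τ : Equiv.Perm κ, ∑ p, tensorMat (Pi.mulSingle p X * (Y ∘ τ)) := by
    simp only [coprodMat, symMat, Finset.mul_sum, Finset.sum_mul, tensorMat_mul]
  rw [h1]
  simp only [symMat]
  conv_rhs => rw [Finset.sum_comm]
  refine Finset.sum_congr rfl fun τ _ => ?_
  refine Fintype.sum_equiv τ _ (fun s => tensorMat (Function.update Y s (X * Y s) ∘ τ))
    fun p => congrArg tensorMat ?_
  funext q
  by_cases h : q = p
  · subst h; simp
  · simp [h]

/-- Induction on the number of nonidentity factors. Replace one such factor by 1 and let it act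
again by derivations: when it lands on an identity factor it restores the wanted symmetrization, and
otherwise the number of nonidentity factors has dropped. -/
theorem symMat_mem_adjoin (Y : κ → Matrix ι ι ℂ) :
    symMat Y ∈ Algebra.adjoin ℂ (Set.range (coprodMat (ι := ι) κ)) := by
  induction hn : (Finset.univ.filter fun p => Y p ≠ 1).card using Nat.strong_induction_on
    generalizing Y with
  | _ n ih =>
  by_cases hY : ∃ q, Y q ≠ 1
  · obtain ⟨q, hq⟩ := hY
    set Y' := Function.update Y q 1 with hY'
    have hcard : (Finset.univ.filter fun p => Y' p ≠ 1).card < n := by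
      rw [← hn]
      refine Finset.card_lt_card (Finset.ssubset_iff_of_subset ?_ |>.2 ⟨q, by simp [hq], by simp [hY']⟩)
      intro p hp
      simp only [Finset.mem_filter, Finset.mem_univ, true_and] at hp ⊢
      by_cases hpq : p = q
      · simp [hpq, hq]
      · simpa [hY', Function.update_of_ne hpq] using hp
    have h1 := coprodMat_mul_symMat (Y q) Y'
    rw [← Finset.sum_filter_add_sum_filter_not Finset.univ (fun s => Y' s = 1)] at h1
    -- Placing `Y q` in another empty slot `s` differs from `Y` by the transposition of `s` and `q`,
    -- invisible after symmetrization. So `symMat Y` appears once per identity factor of `Y'`, hence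
    -- with nonzero multiplicity.
    have h2 : ∀ s ∈ Finset.univ.filter (fun s => Y' s = 1),
        symMat (Function.update Y' s (Y q * Y' s)) = symMat Y := by
      intro s hs
      have hs1 : Y' s = 1 := by simpa using hs
      rw [← symMat_comp Y (Equiv.swap s q), hs1, mul_one]
      congr 1
      funext p
      by_cases hps : p = s
      · subst hps; simp
      · rw [Function.update_of_ne hps]
        by_cases hpq : p = q
        · subst hpq
          have : Y s = 1 := by rwa [hY', Function.update_of_ne (Ne.symm hps)] at hs1
          simp [hY', this]
        · simp [hY', Function.update_of_ne hpq, Equiv.swap_apply_of_ne_of_ne hps hpq]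
    rw [Finset.sum_congr rfl h2, Finset.sum_const] at h1
    set N := (Finset.univ.filter (fun s => Y' s = 1)).card with hN
    have hN0 : (N : ℂ) ≠ 0 := by
      have : 0 < N := Finset.card_pos.2 ⟨q, by simp [hY']⟩
      exact_mod_cast this.ne'
    have h3 : (N : ℂ) • symMat Y ∈ Algebra.adjoin ℂ (Set.range (coprodMat (ι := ι) κ)) := by
      have h4 : (N : ℂ) • symMat Y = coprodMat κ (Y q) * symMat Y'
          - ∑ s with ¬ Y' s = 1, symMat (Function.update Y' s (Y q * Y' s)) := by
        rw [h1, Nat.cast_smul_eq_nsmul]; abel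
      rw [h4]
      refine sub_mem (mul_mem (Algebra.subset_adjoin ⟨_, rfl⟩) (ih _ hcard _ rfl))
        (sum_mem fun s hs => ih _ (lt_of_le_of_lt (Finset.card_le_card ?_) hcard) _ rfl)
      intro p hp
      simp only [Finset.mem_filter, Finset.mem_univ, true_and] at hp hs ⊢
      by_cases hps : p = s
      · rwa [hps]
      · rwa [Function.update_of_ne hps] at hp
    have h5 := Subalgebra.smul_mem _ h3 (N : ℂ)⁻¹
    rwa [smul_smul, inv_mul_cancel₀ hN0, one_smul] at h5
  · push Not at hY
    have : Y = 1 := funext hY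
    subst this
    have h1 : symMat (1 : κ → Matrix ι ι ℂ) = ∑ τ : Equiv.Perm κ, 1 :=
      Finset.sum_congr rfl fun τ _ => by
        rw [show (1 : κ → Matrix ι ι ℂ) ∘ τ = 1 from rfl, tensorMat_one]
    rw [h1]
    exact sum_mem fun _ _ => one_mem _

/-- The matrices invariant under permutations of the tensor factors are generated by the action
of the Lie algebra. -/
theorem mem_adjoin_of_invariant (X : Matrix (κ → ι) (κ → ι) ℂ)
    (hX : ∀ (τ : Equiv.Perm κ) I J, X (I ∘ τ) (J ∘ τ) = X I J) :
    X ∈ Algebra.adjoin ℂ (Set.range (coprodMat (ι := ι) κ)) := by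
  -- Averaging an invariant matrix over the permutations turns each matrix unit in its expansion
  -- into a symmetrized tensor product.
  have h1 : (Fintype.card (Equiv.Perm κ) : ℂ) • X
      = ∑ I, ∑ J, X I J • symMat (fun p => Matrix.single (I p) (J p) (1 : ℂ)) := by
    have h2 : ∀ I J : κ → ι, symMat (fun p => Matrix.single (I p) (J p) (1 : ℂ))
        = ∑ τ : Equiv.Perm κ, Matrix.single (I ∘ τ) (J ∘ τ) 1 := fun I J =>
      Finset.sum_congr rfl fun τ _ => tensorMat_single (I ∘ τ) (J ∘ τ)
    have h3 : ∀ τ : Equiv.Perm κ, ∑ I, ∑ J, X I J • Matrix.single (I ∘ τ) (J ∘ τ) (1 : ℂ) = X := by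
      intro τ
      conv_rhs => rw [Matrix.matrix_eq_sum_single X]
      refine Fintype.sum_equiv (Equiv.arrowCongr τ.symm (Equiv.refl ι)) _ _ fun I => ?_
      refine Fintype.sum_equiv (Equiv.arrowCongr τ.symm (Equiv.refl ι)) _ _ fun J => ?_
      change _ = Matrix.single (I ∘ τ) (J ∘ τ) (X (I ∘ τ) (J ∘ τ))
      rw [hX, Matrix.smul_single, smul_eq_mul, mul_one]
    simp only [h2, Finset.smul_sum]
    have h4 : ∑ I, ∑ J, ∑ τ : Equiv.Perm κ, X I J • Matrix.single (I ∘ τ) (J ∘ τ) (1 : ℂ)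
        = ∑ τ : Equiv.Perm κ, ∑ I, ∑ J, X I J • Matrix.single (I ∘ τ) (J ∘ τ) (1 : ℂ) := by
      rw [Finset.sum_comm]
      rw [Finset.sum_congr rfl fun J _ => Finset.sum_comm]
      rw [Finset.sum_comm]
      exact Finset.sum_congr rfl fun τ _ => Finset.sum_comm
    rw [h4, Finset.sum_congr rfl fun τ _ => h3 τ, Finset.sum_const, Finset.card_univ,
      Nat.cast_smul_eq_nsmul]
  have hc : (Fintype.card (Equiv.Perm κ) : ℂ) ≠ 0 := by exact_mod_cast Fintype.card_ne_zero
  have h5 : (Fintype.card (Equiv.Perm κ) : ℂ) • X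
      ∈ Algebra.adjoin ℂ (Set.range (coprodMat (ι := ι) κ)) := by
    rw [h1]
    exact sum_mem fun I _ => sum_mem fun J _ => Subalgebra.smul_mem _ (symMat_mem_adjoin _) _
  have h6 := Subalgebra.smul_mem _ h5 (Fintype.card (Equiv.Perm κ) : ℂ)⁻¹
  rwa [smul_smul, inv_mul_cancel₀ hc, one_smul] at h6

variable (κ ι) in
/-- The permutation of tensor factors. -/
def permRep : Representation ℂ (Equiv.Perm κ) ((κ → ι) → ℂ) where
  toFun τ := LinearMap.funLeft ℂ ℂ fun I => I ∘ τ
  map_one' := rfl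
  map_mul' _ _ := rfl

theorem permRep_apply (τ : Equiv.Perm κ) (f : (κ → ι) → ℂ) (I : κ → ι) :
    permRep κ ι τ f I = f (I ∘ τ) := rfl

/-- An operator commuting with permutations of the tensor factors is generated by the action of
the Lie algebra. -/
theorem mem_adjoin_of_commute_permRep (g : Module.End ℂ ((κ → ι) → ℂ))
    (hg : ∀ τ f, g (permRep κ ι τ f) = permRep κ ι τ (g f)) :
    LinearMap.toMatrix' g ∈ Algebra.adjoin ℂ (Set.range (coprodMat (ι := ι) κ)) := by
  refine mem_adjoin_of_invariant _ fun τ I J => ?_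
  have h1 := congrFun (hg τ (Pi.single (J ∘ τ) 1)) I
  have h2 : permRep κ ι τ (Pi.single (J ∘ τ) 1) = Pi.single J 1 := by
    funext K
    rw [permRep_apply, Pi.single_apply, Pi.single_apply]
    congr 1
    simp only [eq_iff_iff]
    exact ⟨fun h => by simpa using τ.surjective.injective_comp_right h, fun h => by rw [h]⟩
  rw [h2, permRep_apply] at h1
  simp only [LinearMap.toMatrix'_apply]
  exact h1.symm

/-- An operator commuting with the action of the Lie algebra is a linear combination of
permutations. -/
theorem mem_span_permRep (T : Module.End ℂ ((κ → ι) → ℂ))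
    (hT : ∀ X : Matrix ι ι ℂ, Commute T (Matrix.toLin' (coprodMat κ X))) :
    T ∈ Submodule.span ℂ (Set.range (permRep κ ι)) := by
  let _ : Module (MonoidAlgebra ℂ (Equiv.Perm κ)) ((κ → ι) → ℂ) :=
    Module.compHom _ (permRep κ ι).asAlgebraHom.toRingHom
  have hsm : ∀ (r : MonoidAlgebra ℂ (Equiv.Perm κ)) (f : (κ → ι) → ℂ),
      r • f = (permRep κ ι).asAlgebraHom r f := fun _ _ => rfl
  have : IsScalarTower ℂ (MonoidAlgebra ℂ (Equiv.Perm κ)) ((κ → ι) → ℂ) :=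
    ⟨fun t r f => by rw [hsm, hsm, map_smul, LinearMap.smul_apply]⟩
  -- The tensor power is semisimple over the group algebra by Maschke's theorem. Its endomorphisms
  -- are generated by the Lie algebra, so `T` commutes with all of them and comes from the group
  -- algebra.
  obtain ⟨r, hr⟩ := exists_smul_of_commute (R := MonoidAlgebra ℂ (Equiv.Perm κ)) T (by
    intro g f
    have hg' : ∀ (t : ℂ) f, g (t • f) = t • g f := by
      intro t f
      rw [← algebraMap_smul (MonoidAlgebra ℂ (Equiv.Perm κ)) t f, map_smul, algebraMap_smul]
    let g' : Module.End ℂ ((κ → ι) → ℂ) := { g with map_smul' := hg' }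
    have hmem := mem_adjoin_of_commute_permRep g' (by
      intro τ f
      have := g.map_smul (MonoidAlgebra.of ℂ _ τ) f
      rw [hsm, hsm, Representation.asAlgebraHom_of] at this
      exact this)
    have hc : ∀ X ∈ Algebra.adjoin ℂ (Set.range (coprodMat (ι := ι) κ)),
        Commute T (Matrix.toLin' X) := by
      intro X hX
      induction hX using Algebra.adjoin_induction with
      | mem X hX => obtain ⟨Y, rfl⟩ := hX; exact hT Y
      | algebraMap t =>
        rw [Algebra.algebraMap_eq_smul_one, map_smul, Matrix.toLin'_one]
        exact (Commute.one_right T).smul_right t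
      | add X Y _ _ h1 h2 => rw [map_add]; exact h1.add_right h2
      | mul X Y _ _ h1 h2 => rw [Matrix.toLin'_mul]; exact h1.mul_right h2
    have h1 := hc _ hmem
    rw [Matrix.toLin'_toMatrix'] at h1
    exact LinearMap.congr_fun h1.eq f)
  have hTr : T = (permRep κ ι).asAlgebraHom r := LinearMap.ext hr
  rw [hTr]
  clear hr hTr
  induction r using MonoidAlgebra.induction_on with
  | of τ => rw [Representation.asAlgebraHom_of]; exact Submodule.subset_span ⟨τ, rfl⟩
  | add x y hx hy => rw [map_add]; exact add_mem hx hy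
  | smul t x hx => rw [map_smul]; exact Submodule.smul_mem _ _ hx

theorem coprodMat_comp (τ : Equiv.Perm κ) (X : Matrix ι ι ℂ) (I J : κ → ι) :
    coprodMat κ X (I ∘ τ) (J ∘ τ) = coprodMat κ X I J := by
  simp only [coprodMat, Matrix.sum_apply]
  refine Fintype.sum_equiv τ _ _ fun p => ?_
  simp only [tensorMat, Matrix.of_apply]
  refine Fintype.prod_equiv τ _ _ fun q => ?_
  by_cases h : q = p
  · subst h; simp
  · simp [h]

theorem coprodMat_permRep (τ : Equiv.Perm κ) (X : Matrix ι ι ℂ) (f : (κ → ι) → ℂ) :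
    Matrix.toLin' (coprodMat κ X) (permRep κ ι τ f)
      = permRep κ ι τ (Matrix.toLin' (coprodMat κ X) f) := by
  funext I
  rw [permRep_apply]
  simp only [Matrix.toLin'_apply, Matrix.mulVec, dotProduct, permRep_apply]
  refine Fintype.sum_equiv (Equiv.arrowCongr τ.symm (Equiv.refl ι)) _ _ fun J => ?_
  change _ = coprodMat κ X (I ∘ τ) (J ∘ τ) * f (J ∘ τ)
  rw [coprodMat_comp]

/-- The tensor power is a semisimple module over an algebra with the image generated by the action
of the Lie algebra. -/
theorem isSemisimpleModule_tensor {R : Type} [Ring R] [Algebra ℂ R] [Module R ((κ → ι) → ℂ)]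
    [IsScalarTower ℂ R ((κ → ι) → ℂ)] (x : Matrix ι ι ℂ → R)
    (hx : ∀ X f, x X • f = Matrix.toLin' (coprodMat κ X) f)
    (hadj : Algebra.adjoin ℂ (Set.range x) = ⊤) : IsSemisimpleModule R ((κ → ι) → ℂ) := by
  let _ : Module (MonoidAlgebra ℂ (Equiv.Perm κ)) ((κ → ι) → ℂ) :=
    Module.compHom _ (permRep κ ι).asAlgebraHom.toRingHom
  have hsm : ∀ (r : MonoidAlgebra ℂ (Equiv.Perm κ)) (f : (κ → ι) → ℂ),
      r • f = (permRep κ ι).asAlgebraHom r f := fun _ _ => rfl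
  have : IsScalarTower ℂ (MonoidAlgebra ℂ (Equiv.Perm κ)) ((κ → ι) → ℂ) :=
    ⟨fun t r f => by rw [hsm, hsm, map_smul, LinearMap.smul_apply]⟩
  -- Semisimplicity is transported from the symmetric group to its commutant, which is exactly the
  -- image of `R`.
  refine isSemisimpleModule_of_moduleEnd (R := MonoidAlgebra ℂ (Equiv.Perm κ)) (R' := R) ?_ ?_
  · intro r
    have hr : ∀ (t : ℂ) (f : (κ → ι) → ℂ), r • t • f = t • r • f := by
      intro t f
      rw [← algebraMap_smul R t f, ← mul_smul, ← Algebra.commutes, mul_smul, algebraMap_smul]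
    have hcomm : ∀ τ f, r • permRep κ ι τ f = permRep κ ι τ (r • f) := by
      have hmem : r ∈ Algebra.adjoin ℂ (Set.range x) := by rw [hadj]; trivial
      clear hr
      induction hmem using Algebra.adjoin_induction with
      | mem y hy =>
        obtain ⟨X, rfl⟩ := hy
        intro τ f
        rw [hx, hx, coprodMat_permRep]
      | algebraMap t => intro τ f; rw [algebraMap_smul, algebraMap_smul, map_smul]
      | add y z _ _ h1 h2 => intro τ f; rw [add_smul, add_smul, map_add, h1, h2]
      | mul y z _ _ h1 h2 => intro τ f; rw [mul_smul, mul_smul, h2, h1]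
    refine ⟨{ toFun := fun f => r • f, map_add' := smul_add r, map_smul' := ?_ }, fun _ => rfl⟩
    intro y f
    simp only [hsm, RingHom.id_apply]
    induction y using MonoidAlgebra.induction_on with
    | of τ => rw [Representation.asAlgebraHom_of, hcomm]
    | add y z h1 h2 =>
      rw [map_add, LinearMap.add_apply, smul_add, h1, h2, LinearMap.add_apply]
    | smul t y h1 => rw [map_smul, LinearMap.smul_apply, LinearMap.smul_apply, hr, h1]
  · intro g
    have hg' : ∀ (t : ℂ) f, g (t • f) = t • g f := by
      intro t f
      rw [← algebraMap_smul (MonoidAlgebra ℂ (Equiv.Perm κ)) t f, map_smul, algebraMap_smul]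
    let g' : Module.End ℂ ((κ → ι) → ℂ) := { g with map_smul' := hg' }
    have hmem := mem_adjoin_of_commute_permRep g' (by
      intro τ f
      have := g.map_smul (MonoidAlgebra.of ℂ _ τ) f
      rw [hsm, hsm, Representation.asAlgebraHom_of] at this
      exact this)
    have hlift : ∀ X ∈ Algebra.adjoin ℂ (Set.range (coprodMat (ι := ι) κ)),
        ∃ r : R, ∀ f : (κ → ι) → ℂ, r • f = Matrix.toLin' X f := by
      intro X hX
      induction hX using Algebra.adjoin_induction with
      | mem X hX => obtain ⟨Y, rfl⟩ := hX; exact ⟨x Y, hx Y⟩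
      | algebraMap t =>
        refine ⟨algebraMap ℂ R t, fun f => ?_⟩
        rw [algebraMap_smul, Algebra.algebraMap_eq_smul_one, map_smul, Matrix.toLin'_one]
        rfl
      | add X Y _ _ h1 h2 =>
        obtain ⟨r, hr⟩ := h1
        obtain ⟨s, hs⟩ := h2
        exact ⟨r + s, fun f => by rw [add_smul, hr, hs, map_add, LinearMap.add_apply]⟩
      | mul X Y _ _ h1 h2 =>
        obtain ⟨r, hr⟩ := h1
        obtain ⟨s, hs⟩ := h2
        exact ⟨r * s, fun f => by rw [mul_smul, hs, hr, Matrix.toLin'_mul_apply]⟩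
    obtain ⟨r, hr⟩ := hlift _ hmem
    refine ⟨r, fun f => ?_⟩
    rw [hr, Matrix.toLin'_toMatrix']
    rfl

end SchurWeyl

/-! ### The supersymmetric algebra as a Fock space -/

section Fock

variable {α β : Type} [Fintype α] [Fintype β] [DecidableEq α] [DecidableEq β]

theorem gen_der_gen (x y z : α ⊕ β) : gen x * der y * gen z
    = sgn (par x + par y) (par z) • (gen z * (gen x * der y)) + if y = z then gen x else 0 := by
  rw [mul_assoc, der_mul_gen, mul_add, mul_smul_comm, ← mul_assoc, gen_mul_gen x z, smul_mul_assoc,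
    smul_smul, sgn_add_left, mul_comm (sgn (par y) _), mul_assoc]
  congr 1
  split_ifs <;> simp

theorem der_gen_der (x y z : α ⊕ β) : der z * (gen x * der y)
    = sgn (par x + par y) (par z) • (gen x * der y * der z) + if z = x then der y else 0 := by
  rw [← mul_assoc, der_mul_gen, add_mul, smul_mul_assoc, mul_assoc, der_mul_der z y, mul_smul_comm,
    smul_smul, sgn_add_left, sgn_comm (par z) (par x), sgn_comm (par z) (par y), mul_assoc]
  congr 1
  split_ifs <;> simp

theorem der_gen_der_self (x z : α ⊕ β) : der z * (gen x * der x)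
    = gen x * der x * der z + if z = x then der x else 0 := by
  rw [der_gen_der, sgn_add_left, sgn_mul_self, one_smul]

variable (α β) in
/-- The unit of the supersymmetric algebra. -/
def vac : SuperSym α β := ofTensor α β (1 ⊗ₜ 1)

theorem vac_mem : vac α β ∈ superSymPow α β 0 :=
  tmul_mem_superSymPow (p := 0) (q := 0) rfl (MvPolynomial.isHomogeneous_one _ _) (by
    rw [ExteriorAlgebra.exteriorPower, pow_zero]; exact Submodule.one_le.1 le_rfl)

theorem vac_ne_zero : vac α β ≠ 0 := by
  intro h
  have h1 : (1 : MvPolynomial α ℂ) ⊗ₜ[ℂ] (1 : ExteriorAlgebra ℂ (β → ℂ)) = 0 :=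
    (ofTensor α β).map_eq_zero_iff.1 h
  have h2 := congrArg (TensorProduct.map (MvPolynomial.aeval (fun _ : α => (0 : ℂ))).toLinearMap
    (ExteriorAlgebra.algebraMapInv (R := ℂ) (M := β → ℂ)).toLinearMap) h1
  have h3 := congrArg (LinearMap.mul' ℂ ℂ) h2
  simp at h3

theorem superSymPow_zero : superSymPow α β 0 = ℂ ∙ vac α β := by
  refine le_antisymm ?_ ((Submodule.span_singleton_le_iff_mem _ _).2 vac_mem)
  refine iSup_le fun pq => Submodule.map_le_iff_le_comap.2 <|
    Submodule.map₂_le.2 fun f hf w hw => ?_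
  obtain ⟨⟨p, q⟩, hpq⟩ := pq
  obtain ⟨rfl, rfl⟩ : p = 0 ∧ q = 0 := by
    simp only at hpq
    omega
  simp only at hf hw
  rw [MvPolynomial.homogeneousSubmodule_zero] at hf
  rw [ExteriorAlgebra.exteriorPower, pow_zero] at hw
  obtain ⟨c, rfl⟩ := Submodule.mem_one.1 hf
  obtain ⟨t, rfl⟩ := Submodule.mem_one.1 hw
  rw [Submodule.mem_comap, Submodule.mem_span_singleton]
  refine ⟨c * t, ?_⟩
  rw [Algebra.algebraMap_eq_smul_one, Algebra.algebraMap_eq_smul_one, TensorProduct.mk_apply,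
    TensorProduct.smul_tmul_smul, LinearEquiv.coe_coe, map_smul]
  rfl

theorem iSup_superSymPow : ⨆ k, superSymPow α β k = ⊤ := by
  rw [eq_top_iff]
  intro v _
  obtain ⟨x, rfl⟩ := (ofTensor α β).surjective v
  induction x using TensorProduct.induction_on with
  | zero => simp
  | add x y hx hy => rw [map_add]; exact add_mem (hx trivial) (hy trivial)
  | tmul f w =>
    have hw : w ∈ ⨆ q, ⋀[ℂ]^q (β → ℂ) := by
      rw [(DirectSum.Decomposition.isInternal
        (fun q : ℕ => ⋀[ℂ]^q (β → ℂ))).submodule_iSup_eq_top]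
      trivial
    rw [← MvPolynomial.sum_homogeneousComponent f, TensorProduct.sum_tmul, map_sum]
    refine sum_mem fun p _ => ?_
    refine Submodule.iSup_induction (p := fun q => ⋀[ℂ]^q (β → ℂ)) (motive := fun w =>
      ofTensor α β (MvPolynomial.homogeneousComponent p f ⊗ₜ w) ∈ ⨆ k, superSymPow α β k) hw ?_
      (by simp) ?_
    · intro q w hw
      exact Submodule.mem_iSup_of_mem (p + q) (tmul_mem_superSymPow rfl
        (MvPolynomial.homogeneousComponent_mem p f) hw)
    · intro x y hx hy
      rw [TensorProduct.tmul_add, map_add]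
      exact add_mem hx hy

/-- The sign from contracting past `ι v` cancels the sign from moving `extMul b` past it. Each
further factor thus adds one to the eigenvalue. -/
theorem sum_extMul_extDer {q : ℕ} {w : ExteriorAlgebra ℂ (β → ℂ)} (hw : w ∈ ⋀[ℂ]^q (β → ℂ)) :
    ∑ b, extMul b (extDer b w) = (q : ℂ) • w := by
  induction q generalizing w with
  | zero => simp [extDer_zero _ hw]
  | succ q ih =>
    rw [ExteriorAlgebra.exteriorPower, pow_succ'] at hw
    refine Submodule.mul_induction_on hw ?_ ?_
    · rintro _ ⟨v, rfl⟩ x hx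
      have h : ∀ b, extMul b (extDer b (ExteriorAlgebra.ι ℂ v * x))
          = v b • extMul b x + ExteriorAlgebra.ι ℂ v * extMul b (extDer b x) := by
        intro b
        have h1 : extDer b (ExteriorAlgebra.ι ℂ v * x)
            = v b • x - ExteriorAlgebra.ι ℂ v * extDer b x :=
          CliffordAlgebra.contractLeft_ι_mul _ _ _
        have h2 := ExteriorAlgebra.ι_add_mul_swap (R := ℂ) (Pi.single b 1 : β → ℂ) v
        have h3 := eq_neg_of_add_eq_zero_left h2
        rw [h1, map_sub, map_smul]
        simp only [extMul, LinearMap.mulLeft_apply]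
        rw [← mul_assoc, ← mul_assoc, h3, neg_mul, sub_neg_eq_add]
      simp only [h, Finset.sum_add_distrib, ← Finset.mul_sum, ih hx]
      have h4 : ∑ b, v b • extMul b x = ExteriorAlgebra.ι ℂ v * x := by
        simp only [extMul, LinearMap.mulLeft_apply, ← smul_mul_assoc, ← Finset.sum_mul, ← map_smul,
          ← map_sum]
        congr 2
        funext c
        simp [Finset.sum_apply, Pi.single_apply]
      rw [h4, mul_smul_comm]
      push_cast
      rw [add_smul, one_smul, add_comm]
    · intro x y hx hy
      simp only [map_add, Finset.sum_add_distrib, hx, hy, smul_add]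

/-- Euler's identity. -/
theorem sum_gen_der {k : ℕ} {v : SuperSym α β} (hv : v ∈ superSymPow α β k) :
    ∑ x, gen x (der x v) = (k : ℂ) • v := by
  suffices superSymPow α β k ≤ LinearMap.ker
      ((∑ x : α ⊕ β, gen x * der x) - (k : ℂ) • (1 : Module.End ℂ (SuperSym α β))) by
    have h := this hv
    rw [LinearMap.mem_ker, LinearMap.sub_apply, sub_eq_zero] at h
    simpa using h
  refine iSup_le fun pq => Submodule.map_le_iff_le_comap.2 <|
    Submodule.map₂_le.2 fun f hf w hw => ?_
  clear hv
  obtain ⟨⟨p, q⟩, rfl⟩ := pq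
  simp only at hf hw
  rw [Submodule.mem_comap, LinearMap.mem_ker, LinearMap.sub_apply, sub_eq_zero,
    LinearMap.sum_apply, Fintype.sum_sum_type]
  simp only [Module.End.mul_apply, TensorProduct.mk_apply, LinearEquiv.coe_coe, der_inl, gen_inl,
    der_inr, gen_inr, ← map_sum, ← TensorProduct.sum_tmul, ← TensorProduct.tmul_sum,
    sum_extMul_extDer hw, LinearMap.smul_apply, Module.End.one_apply]
  have h1 := MvPolynomial.IsHomogeneous.sum_X_mul_pderiv hf
  rw [h1, ← map_add, ← map_smul]
  congr 1
  rw [TensorProduct.tmul_smul, ← Nat.cast_smul_eq_nsmul ℂ, ← TensorProduct.smul_tmul', ← add_smul]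
  push_cast
  rfl

variable (α β) in
/-- The vectors killed by all products of `k` derivations. -/
def lowDeg : ℕ → Submodule ℂ (SuperSym α β)
  | 0 => ⊥
  | k + 1 => ⨅ x, (lowDeg k).comap (der x)

theorem mem_lowDeg_succ {k : ℕ} {v : SuperSym α β} :
    v ∈ lowDeg α β (k + 1) ↔ ∀ x, der x v ∈ lowDeg α β k := by
  simp [lowDeg, Submodule.mem_iInf]

theorem lowDeg_mono : Monotone (lowDeg α β) := by
  refine monotone_nat_of_le_succ fun k => ?_
  induction k with
  | zero => exact bot_le
  | succ k ih =>
    intro v hv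
    rw [mem_lowDeg_succ] at hv ⊢
    exact fun x => ih (hv x)

theorem superSymPow_le_lowDeg (k : ℕ) : superSymPow α β k ≤ lowDeg α β (k + 1) := by
  induction k with
  | zero =>
    intro v hv
    rw [mem_lowDeg_succ]
    intro x
    rw [der_zero x hv]
    exact zero_mem _
  | succ k ih =>
    intro v hv
    rw [mem_lowDeg_succ]
    exact fun x => ih (der_mem x hv)

/-- This filtration provides an induction parameter for arbitrary, not necessarily homogeneous,
vectors: any derivation lowers it. -/
theorem exists_mem_lowDeg (v : SuperSym α β) : ∃ k, v ∈ lowDeg α β k := by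
  have hv : v ∈ ⨆ k, superSymPow α β k := by rw [iSup_superSymPow]; trivial
  refine Submodule.iSup_induction (p := superSymPow α β) (motive := fun v => ∃ k, v ∈ lowDeg α β k)
    hv (fun k v hv => ⟨k + 1, superSymPow_le_lowDeg k hv⟩) ⟨0, zero_mem _⟩ ?_
  rintro v w ⟨k, hk⟩ ⟨l, hl⟩
  exact ⟨max k l, add_mem (lowDeg_mono (le_max_left k l) hk) (lowDeg_mono (le_max_right k l) hl)⟩

/-- Local nilpotency is what makes a largest nonvanishing power of a derivation available in
`Peeled.step`. -/
theorem exists_der_pow_eq_zero (x : α ⊕ β) (v : SuperSym α β) : ∃ N, (der x ^ N) v = 0 := by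
  obtain ⟨k, hk⟩ := exists_mem_lowDeg v
  refine ⟨k, ?_⟩
  induction k generalizing v with
  | zero => exact hk
  | succ k ih =>
    rw [pow_succ, Module.End.mul_apply]
    exact ih _ (mem_lowDeg_succ.1 hk x)

/-- A derivation from `s` lowers the eigenvalues of the number operator of `s` by one. No sign
appears, because each `gen y * der y` is even. -/
theorem der_sum_gen_der (s : Finset (α ⊕ β)) {x : α ⊕ β} (hx : x ∈ s) (v : SuperSym α β) :
    der x (∑ y ∈ s, gen y (der y v)) = ∑ y ∈ s, gen y (der y (der x v)) + der x v := by
  have h : ∀ y, der x (gen y (der y v)) = gen y (der y (der x v)) + if x = y then der x v else 0 := by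
    intro y
    have := LinearMap.congr_fun (der_gen_der_self y x) v
    simp only [Module.End.mul_apply, LinearMap.add_apply] at this
    rw [this]
    split_ifs with hxy
    · rw [hxy]
    · rfl
  rw [map_sum, Finset.sum_congr rfl fun y _ => h y, Finset.sum_add_distrib]
  simp [hx]

/-- The eigenvalues of the number operators are natural numbers. -/
theorem exists_nat_of_number (s : Finset (α ⊕ β)) {c : ℂ} {v : SuperSym α β} (hv : v ≠ 0)
    (h : ∑ y ∈ s, gen y (der y v) = c • v) : ∃ r : ℕ, c = r := by
  obtain ⟨k, hk⟩ := exists_mem_lowDeg v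
  induction k generalizing v c with
  | zero => exact absurd hk hv
  | succ k ih =>
    by_cases hd : ∀ y ∈ s, der y v = 0
    · refine ⟨0, ?_⟩
      rw [Finset.sum_eq_zero fun y hy => by rw [hd y hy, map_zero]] at h
      simpa [hv] using h.symm
    · push Not at hd
      -- The vector `der x v` is a nonzero eigenvector for `c - 1`, lower in the filtration.
      obtain ⟨x, hx, hxv⟩ := hd
      have h1 := der_sum_gen_der s hx v
      rw [h, map_smul] at h1
      obtain ⟨r, hr⟩ := ih (c := c - 1) hxv (by rw [sub_smul, one_smul, h1]; abel)
        (mem_lowDeg_succ.1 hk x)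
      exact ⟨r + 1, by push_cast; linear_combination hr⟩

end Fock

/-! ### The generators of the two actions -/

section Operators

variable {d m n : ℕ}

/-- The index of a basis vector of `ℂ^d ⊗ ℂ^{m|n}`. -/
def cell (i : Fin d) (a : Fin m ⊕ Fin n) : (Fin d × Fin m) ⊕ (Fin d × Fin n) :=
  Equiv.prodSumDistrib _ _ _ (i, a)

theorem cell_inj {i j : Fin d} {a b : Fin m ⊕ Fin n} : cell i a = cell j b ↔ i = j ∧ a = b := by
  rw [cell, cell, (Equiv.prodSumDistrib _ _ _).injective.eq_iff, Prod.mk.injEq]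

theorem par_cell (i : Fin d) (a : Fin m ⊕ Fin n) : par (cell i a) = par a := by
  rcases a with a | a <;> rfl

theorem sum_cell {M : Type} [AddCommMonoid M] (f : (Fin d × Fin m) ⊕ (Fin d × Fin n) → M) :
    ∑ x, f x = ∑ i, ∑ a, f (cell i a) := by
  rw [← Fintype.sum_prod_type', ← (Equiv.prodSumDistrib (Fin d) (Fin m) (Fin n)).sum_comp]
  rfl

/-- The action of the matrix unit `E_{ij}` of `gl(d)`. -/
def rowOp (i j : Fin d) : Module.End ℂ (HoweSpace d m n) := ∑ a, gen (cell i a) * der (cell j a)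

/-- The action of the matrix unit `E_{ab}` of `gl(m|n)`. -/
def colOp (a b : Fin m ⊕ Fin n) : Module.End ℂ (HoweSpace d m n) :=
  ∑ i, gen (cell i a) * der (cell i b)

theorem symAct_onLeft (X : Matrix (Fin d) (Fin d) ℂ) :
    (symAct (onLeft X) : Module.End ℂ (HoweSpace d m n)) = ∑ i, ∑ j, X i j • rowOp i j := by
  have h : ∀ i j a b, (onLeft X : GlSuper (Fin d × Fin m) (Fin d × Fin n)) (cell i a) (cell j b)
      = X i j * if a = b then 1 else 0 := by
    intro i j a b
    simp only [onLeft, tensorIndex, cell, LinearMap.coe_mk, AddHom.coe_mk, Matrix.reindex_apply,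
      Matrix.submatrix_apply, Equiv.symm_apply_apply, Matrix.kroneckerMap_apply, Matrix.one_apply]
  rw [symAct_apply, sum_cell]
  simp only [sum_cell (d := d), h, rowOp, Finset.smul_sum]
  refine Finset.sum_congr rfl fun i _ => ?_
  rw [Finset.sum_comm]
  refine Finset.sum_congr rfl fun j _ => Finset.sum_congr rfl fun a _ => ?_
  simp [mul_smul]

theorem symAct_onRight (X : GlSuper (Fin m) (Fin n)) :
    (symAct (onRight X) : Module.End ℂ (HoweSpace d m n)) = ∑ a, ∑ b, X a b • colOp a b := by
  have h : ∀ i j a b, (onRight X : GlSuper (Fin d × Fin m) (Fin d × Fin n)) (cell i a) (cell j b)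
      = (if i = j then 1 else 0) * X a b := by
    intro i j a b
    simp only [onRight, tensorIndex, cell, LinearMap.coe_mk, AddHom.coe_mk, Matrix.reindex_apply,
      Matrix.submatrix_apply, Equiv.symm_apply_apply, Matrix.kroneckerMap_apply, Matrix.one_apply]
  rw [symAct_apply, sum_cell]
  simp only [sum_cell (d := d), h, colOp, Finset.smul_sum]
  rw [Finset.sum_comm]
  refine Finset.sum_congr rfl fun a _ => ?_
  rw [Finset.sum_comm (γ := Fin d)]
  conv_rhs => rw [Finset.sum_comm]
  rw [Finset.sum_comm]
  refine Finset.sum_congr rfl fun i _ => ?_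
  rw [Finset.sum_comm]
  refine Finset.sum_congr rfl fun b _ => ?_
  simp [mul_smul]

theorem glRep_ι (X : Matrix (Fin d) (Fin d) ℂ) :
    glRep d m n (UGl.ι d X) = ∑ i, ∑ j, X i j • rowOp i j := by
  rw [← symAct_onLeft]
  exact UniversalEnvelopingAlgebra.lift_ι_apply ℂ _ X

theorem glSuperRep_ι (X : GlSuper (Fin m) (Fin n)) :
    glSuperRep d m n (UGlSuper.ι _ _ X) = ∑ a, ∑ b, X a b • colOp a b := by
  rw [← symAct_onRight]
  exact UGlSuper.lift_ι (glSuperAct d m n) (glSuperAct_bracket d m n) X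

/-- The matrix units of `gl(d)` in the enveloping algebra. -/
abbrev rowE (d : ℕ) (i j : Fin d) : UGl d := UGl.ι d (Matrix.single i j 1)

/-- The matrix units of `gl(m|n)` in the enveloping superalgebra. -/
abbrev colE (m n : ℕ) (a b : Fin m ⊕ Fin n) : UGlSuper (Fin m) (Fin n) :=
  UGlSuper.ι (Fin m) (Fin n) (Matrix.single a b 1)

theorem sum_single_smul {ι M : Type} [Fintype ι] [DecidableEq ι] [AddCommGroup M] [Module ℂ M]
    (f : ι → ι → M) (i j : ι) : ∑ k, ∑ l, (Matrix.single i j (1 : ℂ)) k l • f k l = f i j := by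
  simp only [Matrix.single_apply, ite_smul, one_smul, zero_smul]
  rw [Finset.sum_eq_single i (fun k _ hk => Finset.sum_eq_zero fun l _ => if_neg fun h => hk h.1.symm)
    (by simp)]
  simp

theorem glRep_rowE (i j : Fin d) : glRep d m n (rowE d i j) = rowOp i j := by
  rw [glRep_ι, sum_single_smul]

theorem glSuperRep_colE (a b : Fin m ⊕ Fin n) : glSuperRep d m n (colE m n a b) = colOp a b := by
  rw [glSuperRep_ι, sum_single_smul]

theorem linear_mem_span {ι M : Type} [Fintype ι] [DecidableEq ι] [AddCommGroup M] [Module ℂ M]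
    (f : Matrix ι ι ℂ →ₗ[ℂ] M) (X : Matrix ι ι ℂ) :
    f X ∈ Submodule.span ℂ (Set.range fun p : ι × ι => f (Matrix.single p.1 p.2 1)) := by
  rw [Matrix.matrix_eq_sum_single X, map_sum]
  refine sum_mem fun i _ => ?_
  rw [map_sum]
  refine sum_mem fun j _ => ?_
  have : Matrix.single i j (X i j) = X i j • Matrix.single i j (1 : ℂ) := by
    rw [Matrix.smul_single, smul_eq_mul, mul_one]
  rw [this, map_smul]
  exact Submodule.smul_mem _ _ (Submodule.subset_span ⟨(i, j), rfl⟩)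

theorem single_cartan {ι : Type} [Fintype ι] [DecidableEq ι] (i k l : ι) :
    Matrix.single i i (1 : ℂ) * Matrix.single k l 1 - Matrix.single k l 1 * Matrix.single i i 1
      = ((if i = k then 1 else 0) - (if i = l then 1 else 0) : ℂ) • Matrix.single k l (1 : ℂ) := by
  by_cases h1 : i = k <;> by_cases h2 : i = l
  · subst h1; subst h2; simp
  · subst h1; simp [h2, Ne.symm h2]
  · subst h2; simp [h1, Ne.symm h1]
  · simp [h1, h2, Ne.symm h1, Ne.symm h2]

theorem UGl.ι_bracket (X Y : Matrix (Fin d) (Fin d) ℂ) :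
    UGl.ι d X * UGl.ι d Y - UGl.ι d Y * UGl.ι d X = UGl.ι d (X * Y - Y * X) :=
  ((UniversalEnvelopingAlgebra.ι ℂ : Matrix (Fin d) (Fin d) ℂ →ₗ⁅ℂ⁆ UGl d).map_lie X Y).symm

theorem UGlSuper.ι_bracket (a b : ZMod 2) {X Y : GlSuper (Fin m) (Fin n)} (hX : IsHomog a X)
    (hY : IsHomog b Y) :
    UGlSuper.ι _ _ X * UGlSuper.ι _ _ Y - sgn a b • (UGlSuper.ι _ _ Y * UGlSuper.ι _ _ X)
      = UGlSuper.ι (Fin m) (Fin n) (superBracket a b X Y) := by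
  have h := RingQuot.mkAlgHom_rel ℂ (UGlSuperRel.bracket a b X Y hX hY)
  rw [map_sub, map_smul, map_mul, map_mul] at h
  exact h

theorem UGl.adjoin_range_ι : Algebra.adjoin ℂ (Set.range (UGl.ι d)) = ⊤ := by
  rw [eq_top_iff]
  rintro u -
  obtain ⟨x, rfl⟩ := RingCon.mkₐ_surjective (α := ℂ)
    (UniversalEnvelopingAlgebra.ringCon ℂ (Matrix (Fin d) (Fin d) ℂ)) u
  change UniversalEnvelopingAlgebra.mkAlgHom ℂ _ x ∈ _
  induction x using TensorAlgebra.induction with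
  | algebraMap c => rw [AlgHom.commutes]; exact Subalgebra.algebraMap_mem _ c
  | ι X => exact Algebra.subset_adjoin ⟨X, rfl⟩
  | mul x y hx hy => rw [map_mul]; exact mul_mem hx hy
  | add x y hx hy => rw [map_add]; exact add_mem hx hy

theorem UGlSuper.adjoin_range_ι :
    Algebra.adjoin ℂ (Set.range (UGlSuper.ι (Fin m) (Fin n))) = ⊤ := by
  rw [eq_top_iff]
  rintro u -
  obtain ⟨x, rfl⟩ := RingQuot.mkAlgHom_surjective ℂ (UGlSuperRel (Fin m) (Fin n)) u
  let π : TensorAlgebra ℂ (GlSuper (Fin m) (Fin n)) →ₐ[ℂ] UGlSuper (Fin m) (Fin n) :=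
    RingQuot.mkAlgHom ℂ (UGlSuperRel (Fin m) (Fin n))
  change π x ∈ _
  induction x using TensorAlgebra.induction with
  | algebraMap c => rw [AlgHom.commutes]; exact Subalgebra.algebraMap_mem _ c
  | ι X => exact Algebra.subset_adjoin ⟨X, rfl⟩
  | mul x y hx hy => rw [map_mul]; exact mul_mem hx hy
  | add x y hx hy => rw [map_add]; exact add_mem hx hy

theorem adjoin_eq_top_of_span {U V : Type} [Ring U] [Algebra ℂ U] {s : Set U} {f : V → U}
    (hs : Algebra.adjoin ℂ (Set.range f) = ⊤) (h : ∀ X, f X ∈ Submodule.span ℂ s) :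
    Algebra.adjoin ℂ s = ⊤ := by
  rw [eq_top_iff, ← hs]
  refine Algebra.adjoin_le ?_
  rintro _ ⟨X, rfl⟩
  exact Algebra.span_le_adjoin ℂ s (h X)

theorem matrixUnits_rowE : MatrixUnits (rowE d) where
  adjoin_eq := adjoin_eq_top_of_span UGl.adjoin_range_ι (linear_mem_span (UGl.ι d))
  comm i j k l := ⟨1, by
    rw [one_smul, UGl.ι_bracket]
    exact linear_mem_span (UGl.ι d) _⟩
  cartan i k l := by
    rw [← sub_eq_iff_eq_add', UGl.ι_bracket, single_cartan, map_smul]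

theorem isHomog_single (a b : Fin m ⊕ Fin n) :
    IsHomog (par a + par b) (Matrix.single a b 1 : GlSuper (Fin m) (Fin n)) := by
  intro i j h
  rw [Matrix.single_apply] at h
  have : a = i ∧ b = j := by
    by_contra hne
    exact h (if_neg hne)
  rw [this.1, this.2]

theorem sgn_zero_left (b : ZMod 2) : sgn 0 b = 1 := by simp [sgn]

theorem zmod_two_add_self (a : ZMod 2) : a + a = 0 := CharTwo.add_self_eq_zero a

theorem matrixUnits_colE : MatrixUnits (colE m n) where
  adjoin_eq := adjoin_eq_top_of_span UGlSuper.adjoin_range_ι (linear_mem_span (UGlSuper.ι _ _))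
  comm i j k l := ⟨sgn (par i + par j) (par k + par l), by
    rw [UGlSuper.ι_bracket _ _ (isHomog_single i j) (isHomog_single k l)]
    exact linear_mem_span (UGlSuper.ι _ _) _⟩
  cartan i k l := by
    have h := UGlSuper.ι_bracket _ _ (isHomog_single i i) (isHomog_single k l)
    rw [zmod_two_add_self, sgn_zero_left, one_smul, superBracket, sgn_zero_left, one_smul,
      single_cartan, map_smul] at h
    rw [← sub_eq_iff_eq_add', h]

/-- For a fixed column the generators form a copy of ℂ^d, of parity given by the column. The
operator `rowOp` is even, so no sign occurs. -/
theorem rowOp_mul_gen (i j k : Fin d) (b : Fin m ⊕ Fin n) :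
    rowOp i j * gen (cell k b) = gen (cell k b) * rowOp i j + if j = k then gen (cell i b) else 0 := by
  simp only [rowOp, Finset.sum_mul, Finset.mul_sum, gen_der_gen, par_cell, zmod_two_add_self,
    sgn_zero_left, one_smul, Finset.sum_add_distrib, cell_inj]
  congr 1
  by_cases h : j = k <;> simp [h]

theorem der_mul_rowOp (i j k : Fin d) (b : Fin m ⊕ Fin n) :
    der (cell k b) * rowOp i j = rowOp i j * der (cell k b) + if k = i then der (cell j b) else 0 := by
  simp only [rowOp, Finset.sum_mul, Finset.mul_sum, der_gen_der, par_cell, zmod_two_add_self,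
    sgn_zero_left, one_smul, Finset.sum_add_distrib, cell_inj]
  congr 1
  by_cases h : k = i <;> simp [h]

/-- The sign involves only column indices and not the row `i`. `gen_mul_mem` relies on this
uniformity. -/
theorem colOp_mul_gen (a b c : Fin m ⊕ Fin n) (i : Fin d) :
    colOp a b * gen (cell i c) = sgn (par a + par b) (par c) • (gen (cell i c) * colOp a b)
      + if b = c then gen (cell i a) else 0 := by
  simp only [colOp, Finset.sum_mul, Finset.mul_sum, gen_der_gen, par_cell,
    Finset.smul_sum, Finset.sum_add_distrib, cell_inj]
  congr 1
  by_cases h : b = c <;> simp [h]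

theorem der_mul_colOp (a b c : Fin m ⊕ Fin n) (i : Fin d) :
    der (cell i c) * colOp a b = sgn (par a + par b) (par c) • (colOp a b * der (cell i c))
      + if c = a then der (cell i b) else 0 := by
  simp only [colOp, Finset.sum_mul, Finset.mul_sum, der_gen_der, par_cell,
    Finset.smul_sum, Finset.sum_add_distrib, cell_inj]
  congr 1
  by_cases h : c = a <;> simp [h]

/-- After summation over `k`, both correction terms become `gen (cell i a) * der (cell j b)` and
cancel. -/
theorem rowOp_comm_colOp (i j : Fin d) (a b : Fin m ⊕ Fin n) :
    Commute (rowOp i j : Module.End ℂ (HoweSpace d m n)) (colOp a b) := by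
  rw [commute_iff_eq]
  have h : ∀ k, rowOp i j * (gen (cell k a) * der (cell k b))
      = gen (cell k a) * der (cell k b) * rowOp i j
        + ((if j = k then gen (cell i a) * der (cell k b) else 0)
          - if k = i then gen (cell k a) * der (cell j b) else 0) := by
    intro k
    rw [← mul_assoc, rowOp_mul_gen, add_mul, mul_assoc, mul_assoc _ _ (rowOp i j), der_mul_rowOp,
      mul_add]
    split_ifs <;> simp
  simp only [colOp, Finset.mul_sum, Finset.sum_mul, h, Finset.sum_add_distrib,
    Finset.sum_sub_distrib]
  simp

theorem commute_glRep_glSuperRep (u : UGl d) (u' : UGlSuper (Fin m) (Fin n)) :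
    Commute (glRep d m n u) (glSuperRep d m n u') := by
  have hu : u ∈ Algebra.adjoin ℂ (Set.range fun p : Fin d × Fin d => rowE d p.1 p.2) := by
    rw [matrixUnits_rowE.adjoin_eq]; trivial
  have hu' : u' ∈ Algebra.adjoin ℂ
      (Set.range fun p : (Fin m ⊕ Fin n) × (Fin m ⊕ Fin n) => colE m n p.1 p.2) := by
    rw [matrixUnits_colE.adjoin_eq]; trivial
  induction hu using Algebra.adjoin_induction with
  | mem x hx =>
    obtain ⟨p, rfl⟩ := hx
    induction hu' using Algebra.adjoin_induction with
    | mem y hy => obtain ⟨q, rfl⟩ := hy; rw [glRep_rowE, glSuperRep_colE]; exact rowOp_comm_colOp ..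
    | algebraMap t => rw [AlgHom.commutes]; exact (Algebra.commutes t _).symm
    | add y z _ _ hy hz => rw [map_add]; exact hy.add_right hz
    | mul y z _ _ hy hz => rw [map_mul]; exact hy.mul_right hz
  | algebraMap t => rw [AlgHom.commutes]; exact Algebra.commutes t _
  | add y z _ _ hy hz => rw [map_add]; exact hy.add_left hz
  | mul y z _ _ hy hz => rw [map_mul]; exact hy.mul_left hz

/-- The identity matrix of either algebra acts as the Euler operator. Hence both images know the
degree. -/
theorem sum_rowOp_self : (∑ i, rowOp i i : Module.End ℂ (HoweSpace d m n)) = ∑ x, gen x * der x := by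
  rw [sum_cell]; rfl

theorem sum_colOp_self : (∑ a, colOp a a : Module.End ℂ (HoweSpace d m n)) = ∑ x, gen x * der x := by
  rw [sum_cell, Finset.sum_comm]; rfl

end Operators

/-! ### Words and the resolution of the identity -/

section Words

variable {α β : Type} [Fintype α] [Fintype β] [DecidableEq α] [DecidableEq β]

variable (α β) in
/-- The augmentation of the supersymmetric algebra. -/
def vacCoef : SuperSym α β →ₗ[ℂ] ℂ :=
  LinearMap.mul' ℂ ℂ ∘ₗ TensorProduct.map
    (MvPolynomial.aeval (fun _ : α => (0 : ℂ))).toLinearMap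
    (ExteriorAlgebra.algebraMapInv (R := ℂ) (M := β → ℂ)).toLinearMap
    ∘ₗ (ofTensor α β).symm.toLinearMap

theorem vacCoef_tmul (f : MvPolynomial α ℂ) (w : ExteriorAlgebra ℂ (β → ℂ)) :
    vacCoef α β (ofTensor α β (f ⊗ₜ w))
      = MvPolynomial.aeval (fun _ : α => (0 : ℂ)) f * ExteriorAlgebra.algebraMapInv w := by
  simp [vacCoef]

theorem vacCoef_vac : vacCoef α β (vac α β) = 1 := by
  rw [vac, vacCoef_tmul]; simp

theorem vacCoef_gen (x : α ⊕ β) (v : SuperSym α β) : vacCoef α β (gen x v) = 0 := by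
  obtain ⟨t, rfl⟩ := (ofTensor α β).surjective v
  induction t using TensorProduct.induction_on with
  | zero => simp
  | add s t hs ht => rw [map_add, map_add, map_add, hs, ht, add_zero]
  | tmul f w =>
    rcases x with a | b
    · rw [gen_inl, vacCoef_tmul]; simp
    · rw [gen_inr, vacCoef_tmul]
      simp [extMul, ExteriorAlgebra.algebraMapInv]

theorem eq_vacCoef_smul {v : SuperSym α β} (hv : v ∈ superSymPow α β 0) :
    v = vacCoef α β v • vac α β := by
  rw [superSymPow_zero] at hv
  obtain ⟨t, rfl⟩ := Submodule.mem_span_singleton.1 hv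
  rw [map_smul, vacCoef_vac, smul_eq_mul, mul_one]

/-- The product of the generators of a word. -/
def genWord {κ : Type} (w : κ → α ⊕ β) (l : List κ) : Module.End ℂ (SuperSym α β) :=
  (l.map fun p => gen (w p)).prod

/-- The product of the derivations of a word. -/
def derWord {κ : Type} (w : κ → α ⊕ β) (l : List κ) : Module.End ℂ (SuperSym α β) :=
  (l.map fun p => der (w p)).prod

theorem genWord_cons {κ : Type} (w : κ → α ⊕ β) (p : κ) (l : List κ) :
    genWord w (p :: l) = gen (w p) * genWord w l := by simp [genWord]

theorem derWord_cons {κ : Type} (w : κ → α ⊕ β) (p : κ) (l : List κ) :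
    derWord w (p :: l) = der (w p) * derWord w l := by simp [derWord]

theorem genWord_finRange_cons {k : ℕ} (x : α ⊕ β) (w : Fin k → α ⊕ β) :
    genWord (Fin.cons x w : Fin (k + 1) → α ⊕ β) (List.finRange (k + 1))
      = gen x * genWord w (List.finRange k) := by
  simp [genWord, List.finRange_succ, Function.comp_def]

/-- The reversed order makes the first letter's derivation act first while its generator acts last,
so that words nest and Euler's identity can be iterated. -/
theorem derWord_finRange_cons {k : ℕ} (x : α ⊕ β) (w : Fin k → α ⊕ β) :
    derWord (Fin.cons x w : Fin (k + 1) → α ⊕ β) (List.finRange (k + 1)).reverse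
      = derWord w (List.finRange k).reverse * der x := by
  simp [derWord, List.finRange_succ, Function.comp_def, List.map_reverse]

theorem derWord_mem {κ : Type} (w : κ → α ⊕ β) (l : List κ) {k : ℕ} {v : SuperSym α β}
    (hv : v ∈ superSymPow α β (k + l.length)) : derWord w l v ∈ superSymPow α β k := by
  induction l generalizing k with
  | nil => simpa [derWord] using hv
  | cons p l ih =>
    rw [derWord_cons, Module.End.mul_apply]
    refine der_mem _ (ih ?_)
    convert hv using 2
    simp; omega

theorem genWord_mem {κ : Type} (w : κ → α ⊕ β) (l : List κ) {k : ℕ} {v : SuperSym α β}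
    (hv : v ∈ superSymPow α β k) : genWord w l v ∈ superSymPow α β (k + l.length) := by
  induction l with
  | nil => simpa [genWord] using hv
  | cons p l ih =>
    rw [genWord_cons, Module.End.mul_apply]
    exact gen_mem _ ih

theorem sum_cons {X M : Type} [Fintype X] [AddCommMonoid M] {k : ℕ} (f : (Fin (k + 1) → X) → M) :
    ∑ w, f w = ∑ x, ∑ w : Fin k → X, f (Fin.cons x w) := by
  rw [← (Fin.consEquiv fun _ : Fin (k + 1) => X).sum_comp, Fintype.sum_prod_type]
  rfl

/-- The resolution of the identity of `S^k` by words. -/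
theorem sum_genWord_derWord (k : ℕ) {v : SuperSym α β} (hv : v ∈ superSymPow α β k) :
    ∑ w : Fin k → α ⊕ β, genWord w (List.finRange k) (derWord w (List.finRange k).reverse v)
      = (k.factorial : ℂ) • v := by
  induction k generalizing v with
  | zero => simp [genWord, derWord]
  | succ k ih =>
    rw [sum_cons]
    simp only [genWord_finRange_cons, derWord_finRange_cons, Module.End.mul_apply, ← map_sum,
      ih (der_mem _ hv), map_smul, ← Finset.smul_sum, sum_gen_der hv, smul_smul]
    rw [Nat.factorial_succ]
    push_cast
    rw [mul_comm]

end Words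

/-! ### The centralizer of `gl(d)` -/

section Centralizer

variable {d m n : ℕ}

theorem cell_word_sum {M : Type} [AddCommMonoid M] {k : ℕ}
    (f : (Fin k → (Fin d × Fin m) ⊕ (Fin d × Fin n)) → M) :
    ∑ w, f w = ∑ A : Fin k → Fin m ⊕ Fin n, ∑ I : Fin k → Fin d, f fun p => cell (I p) (A p) := by
  rw [Finset.sum_comm, ← Fintype.sum_prod_type',
    ← ((Equiv.arrowProdEquivProdArrow (Fin k) (fun _ => Fin d)
      (fun _ => Fin m ⊕ Fin n)).symm.trans
      (Equiv.arrowCongr (Equiv.refl (Fin k)) (Equiv.prodSumDistrib (Fin d) (Fin m) (Fin n)))).sum_comp]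
  rfl

/-- The action of a matrix of `gl(d)`. -/
def rowAct (X : Matrix (Fin d) (Fin d) ℂ) : Module.End ℂ (HoweSpace d m n) :=
  ∑ i, ∑ j, X i j • rowOp i j

theorem rowAct_mul_gen (X : Matrix (Fin d) (Fin d) ℂ) (k : Fin d) (b : Fin m ⊕ Fin n) :
    rowAct X * gen (cell k b) = gen (cell k b) * rowAct X + ∑ i, X i k • gen (cell i b) := by
  simp only [rowAct, Finset.sum_mul, Finset.mul_sum, smul_mul_assoc, mul_smul_comm, rowOp_mul_gen,
    smul_add, Finset.sum_add_distrib]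
  congr 1
  simp

theorem der_mul_rowAct (X : Matrix (Fin d) (Fin d) ℂ) (k : Fin d) (b : Fin m ⊕ Fin n) :
    der (cell k b) * rowAct X = rowAct X * der (cell k b) + ∑ j, X k j • der (cell j b) := by
  simp only [rowAct, Finset.sum_mul, Finset.mul_sum, smul_mul_assoc, mul_smul_comm, der_mul_rowOp,
    smul_add, Finset.sum_add_distrib]
  congr 1
  rw [Finset.sum_comm]
  simp

theorem vacCoef_rowAct (X : Matrix (Fin d) (Fin d) ℂ) (v : HoweSpace d m n) :
    vacCoef _ _ (rowAct X v) = 0 := by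
  simp [rowAct, rowOp, vacCoef_gen]

theorem rowAct_vac (X : Matrix (Fin d) (Fin d) ℂ) :
    rowAct X (vac _ _ : HoweSpace d m n) = 0 := by
  simp [rowAct, rowOp, der_zero _ vac_mem]

variable {κ : Type} [Fintype κ] [DecidableEq κ]

/-- The word of cells with rows `I` and columns `A`. -/
def cells (I : κ → Fin d) (A : κ → Fin m ⊕ Fin n) (p : κ) : (Fin d × Fin m) ⊕ (Fin d × Fin n) :=
  cell (I p) (A p)

theorem genWord_update_of_notMem (I : κ → Fin d) (A : κ → Fin m ⊕ Fin n) {l : List κ} {q : κ}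
    (hq : q ∉ l) (i : Fin d) : genWord (cells (Function.update I q i) A) l = genWord (cells I A) l := by
  refine congrArg List.prod (List.map_congr_left fun p hp => ?_)
  have hpq : p ≠ q := fun h => hq (h ▸ hp)
  rw [cells, cells, Function.update_of_ne hpq]

theorem derWord_update_of_notMem (I : κ → Fin d) (A : κ → Fin m ⊕ Fin n) {l : List κ} {q : κ}
    (hq : q ∉ l) (i : Fin d) : derWord (cells (Function.update I q i) A) l = derWord (cells I A) l := by
  refine congrArg List.prod (List.map_congr_left fun p hp => ?_)
  have hpq : p ≠ q := fun h => hq (h ▸ hp)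
  rw [cells, cells, Function.update_of_ne hpq]

theorem rowAct_mul_genWord (X : Matrix (Fin d) (Fin d) ℂ) (I : κ → Fin d)
    (A : κ → Fin m ⊕ Fin n) {l : List κ} (hl : l.Nodup) :
    rowAct X * genWord (cells I A) l = genWord (cells I A) l * rowAct X
      + ∑ p ∈ l.toFinset, ∑ i, X i (I p) • genWord (cells (Function.update I p i) A) l := by
  induction l with
  | nil => simp [genWord]
  | cons q l ih =>
    obtain ⟨hq, hl⟩ := List.nodup_cons.1 hl
    rw [genWord_cons, ← mul_assoc, cells, rowAct_mul_gen, add_mul, mul_assoc, ih hl, mul_add,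
      List.toFinset_cons, Finset.sum_insert (by simpa using hq), mul_assoc, add_assoc]
    congr 1
    rw [add_comm]
    congr 1
    · simp only [genWord_cons, genWord_update_of_notMem I A hq, Finset.sum_mul, smul_mul_assoc, cells,
        Function.update_self]
    · rw [Finset.mul_sum]
      refine Finset.sum_congr rfl fun p hp => ?_
      have hqp : q ≠ p := fun h => hq (by rw [h]; simpa using hp)
      simp only [Finset.mul_sum, mul_smul_comm, genWord_cons, cells, Function.update_of_ne hqp]

theorem derWord_mul_rowAct (X : Matrix (Fin d) (Fin d) ℂ) (I : κ → Fin d)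
    (A : κ → Fin m ⊕ Fin n) {l : List κ} (hl : l.Nodup) :
    derWord (cells I A) l * rowAct X = rowAct X * derWord (cells I A) l
      + ∑ p ∈ l.toFinset, ∑ j, X (I p) j • derWord (cells (Function.update I p j) A) l := by
  induction l with
  | nil => simp [derWord]
  | cons q l ih =>
    obtain ⟨hq, hl⟩ := List.nodup_cons.1 hl
    rw [derWord_cons, mul_assoc, ih hl, mul_add, ← mul_assoc, cells, der_mul_rowAct, add_mul,
      List.toFinset_cons, Finset.sum_insert (by simpa using hq), mul_assoc, add_assoc]
    congr 1
    congr 1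
    · simp only [derWord_cons, derWord_update_of_notMem I A hq, Finset.sum_mul, smul_mul_assoc, cells,
        Function.update_self]
    · rw [Finset.mul_sum]
      refine Finset.sum_congr rfl fun p hp => ?_
      have hqp : q ≠ p := fun h => hq (by rw [h]; simpa using hp)
      simp only [Finset.mul_sum, mul_smul_comm, derWord_cons, cells, Function.update_of_ne hqp]

theorem tensorMat_mulSingle_apply {ι : Type} [Fintype ι] [DecidableEq ι] (p : κ)
    (X : Matrix ι ι ℂ) (I J : κ → ι) : tensorMat (Pi.mulSingle p X) I J
      = X (I p) (J p) * ∏ q ∈ Finset.univ.erase p, (1 : Matrix ι ι ℂ) (I q) (J q) := by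
  rw [tensorMat, Matrix.of_apply, ← Finset.mul_prod_erase _ _ (Finset.mem_univ p)]
  congr 1
  · simp
  · exact Finset.prod_congr rfl fun q hq => by
      rw [Pi.mulSingle_eq_of_ne (Finset.ne_of_mem_erase hq)]

theorem sum_coprodMat_left {ι M : Type} [Fintype ι] [DecidableEq ι] [AddCommGroup M] [Module ℂ M]
    (X : Matrix ι ι ℂ) (J : κ → ι) (g : (κ → ι) → M) :
    ∑ I, coprodMat κ X I J • g I = ∑ p, ∑ i, X i (J p) • g (Function.update J p i) := by
  simp only [coprodMat, Matrix.sum_apply, Finset.sum_smul]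
  rw [Finset.sum_comm]
  refine Finset.sum_congr rfl fun p _ => Eq.symm ?_
  refine Finset.sum_of_injOn (fun i => Function.update J p i)
    ((Function.update_injective J p).injOn) (by simp) ?_ ?_
  · intro I _ hI
    have hex : ∃ q ∈ Finset.univ.erase p, I q ≠ J q := by
      by_contra hne
      push Not at hne
      refine hI ⟨I p, by simp, ?_⟩
      funext q
      by_cases hq : q = p
      · subst hq; simp
      · simp only [Function.update_of_ne hq]
        exact (hne q (by simp [hq])).symm
    obtain ⟨q, hq, hne⟩ := hex
    have h0 : ∏ q ∈ Finset.univ.erase p, (1 : Matrix ι ι ℂ) (I q) (J q) = 0 :=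
      Finset.prod_eq_zero hq (Matrix.one_apply_ne hne)
    rw [tensorMat_mulSingle_apply, h0, mul_zero, zero_smul]
  · intro i _
    rw [tensorMat_mulSingle_apply, Finset.prod_eq_one, mul_one, Function.update_self]
    intro q hq
    rw [Function.update_of_ne (Finset.ne_of_mem_erase hq), Matrix.one_apply_eq]

theorem coprodMat_transpose {ι : Type} [Fintype ι] [DecidableEq ι] (X : Matrix ι ι ℂ) (I J : κ → ι) :
    coprodMat κ X I J = coprodMat κ X.transpose J I := by
  simp only [coprodMat, Matrix.sum_apply, tensorMat_mulSingle_apply, Matrix.transpose_apply]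
  refine Finset.sum_congr rfl fun p _ => ?_
  congr 1
  refine Finset.prod_congr rfl fun q _ => ?_
  rw [Matrix.one_apply, Matrix.one_apply]
  simp only [eq_comm]

theorem sum_coprodMat_right {ι M : Type} [Fintype ι] [DecidableEq ι] [AddCommGroup M] [Module ℂ M]
    (X : Matrix ι ι ℂ) (I : κ → ι) (g : (κ → ι) → M) :
    ∑ J, coprodMat κ X I J • g J = ∑ p, ∑ j, X (I p) j • g (Function.update I p j) := by
  simp only [coprodMat_transpose X I, sum_coprodMat_left, Matrix.transpose_apply]

variable {k : ℕ}

/-- The map from the tensor power to `S^k` defined by a word of columns. -/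
def wordMap (A : Fin k → Fin m ⊕ Fin n) : ((Fin k → Fin d) → ℂ) →ₗ[ℂ] HoweSpace d m n where
  toFun f := ∑ I, f I • genWord (cells I A) (List.finRange k) (vac _ _)
  map_add' f g := by simp [add_smul, Finset.sum_add_distrib]
  map_smul' t f := by simp [mul_smul, Finset.smul_sum]

/-- The map from `S^k` to the tensor power defined by a word of columns. -/
def coordMap (A : Fin k → Fin m ⊕ Fin n) : HoweSpace d m n →ₗ[ℂ] ((Fin k → Fin d) → ℂ) :=
  LinearMap.pi fun I => vacCoef _ _ ∘ₗ derWord (cells I A) (List.finRange k).reverse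

theorem wordMap_apply (A : Fin k → Fin m ⊕ Fin n) (f : (Fin k → Fin d) → ℂ) :
    wordMap A f = ∑ I, f I • genWord (cells I A) (List.finRange k) (vac _ _) := rfl

theorem coordMap_apply (A : Fin k → Fin m ⊕ Fin n) (v : HoweSpace d m n) (I : Fin k → Fin d) :
    coordMap A v I = vacCoef _ _ (derWord (cells I A) (List.finRange k).reverse v) := rfl

theorem wordMap_mem (A : Fin k → Fin m ⊕ Fin n) (f : (Fin k → Fin d) → ℂ) :
    wordMap A f ∈ howePow d m n k := by
  rw [wordMap_apply]
  refine sum_mem fun I _ => Submodule.smul_mem _ _ ?_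
  have := genWord_mem (cells I A) (List.finRange k) (vac_mem (α := Fin d × Fin m) (β := Fin d × Fin n))
  simpa using this

/-- Moving `rowAct X` through a word changes one row letter at a time, as a derivation of the tensor
power does. What is left over acts on the unit and vanishes. -/
theorem wordMap_coprodMat (A : Fin k → Fin m ⊕ Fin n) (X : Matrix (Fin d) (Fin d) ℂ)
    (f : (Fin k → Fin d) → ℂ) :
    wordMap A (Matrix.toLin' (coprodMat (Fin k) X) f) = rowAct X (wordMap A f) := by
  have h : ∀ J : Fin k → Fin d, rowAct X (genWord (cells J A) (List.finRange k) (vac _ _))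
      = ∑ I, coprodMat (Fin k) X I J • genWord (cells I A) (List.finRange k) (vac _ _) := by
    intro J
    have h1 := LinearMap.congr_fun (rowAct_mul_genWord X J A (List.nodup_finRange k)) (vac _ _)
    rw [Module.End.mul_apply, LinearMap.add_apply, Module.End.mul_apply, rowAct_vac, map_zero,
      zero_add] at h1
    rw [h1, sum_coprodMat_left]
    simp
  rw [wordMap_apply, wordMap_apply, map_sum]
  simp only [map_smul, h, Finset.smul_sum, Matrix.toLin'_apply, Matrix.mulVec, dotProduct,
    Finset.sum_smul, smul_smul]
  rw [Finset.sum_comm]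
  simp only [mul_comm]

/-- Dual to `wordMap_coprodMat`: the leftover term has `rowAct X` acting last, and its values have
no constant term. -/
theorem coordMap_rowAct (A : Fin k → Fin m ⊕ Fin n) (X : Matrix (Fin d) (Fin d) ℂ)
    (v : HoweSpace d m n) :
    coordMap A (rowAct X v) = Matrix.toLin' (coprodMat (Fin k) X) (coordMap A v) := by
  funext I
  have h1 := LinearMap.congr_fun (derWord_mul_rowAct X I A
    (List.nodup_reverse.2 (List.nodup_finRange k))) v
  rw [Module.End.mul_apply, LinearMap.add_apply, Module.End.mul_apply] at h1
  rw [coordMap_apply, h1, map_add, vacCoef_rowAct, zero_add, Matrix.toLin'_apply]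
  have h2 := sum_coprodMat_right X I (coordMap A v)
  simp only [Matrix.mulVec, dotProduct, ← smul_eq_mul]
  rw [h2]
  simp [coordMap_apply]

/-- The operator `Σ_I G_{I,A} D_{I,B}`. -/
def wordOp (A B : Fin k → Fin m ⊕ Fin n) : Module.End ℂ (HoweSpace d m n) :=
  ∑ I, genWord (cells I A) (List.finRange k) * derWord (cells I B) (List.finRange k).reverse

/-- On S^k the k derivations end in degree 0, where a vector is its augmentation times the unit. So
reading the augmentation loses nothing. -/
theorem wordMap_coordMap (A B : Fin k → Fin m ⊕ Fin n) {v : HoweSpace d m n}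
    (hv : v ∈ howePow d m n k) : wordMap A (coordMap B v) = wordOp A B v := by
  rw [wordMap_apply, wordOp, LinearMap.sum_apply]
  refine Finset.sum_congr rfl fun I _ => ?_
  rw [Module.End.mul_apply, coordMap_apply, ← map_smul, ← eq_vacCoef_smul]
  exact derWord_mem _ _ (by simpa using hv)

theorem sum_wordMap_coordMap {v : HoweSpace d m n} (hv : v ∈ howePow d m n k) :
    ∑ A : Fin k → Fin m ⊕ Fin n, wordMap A (coordMap A v) = (k.factorial : ℂ) • v := by
  rw [← sum_genWord_derWord k hv, cell_word_sum]
  refine Finset.sum_congr rfl fun A _ => ?_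
  rw [wordMap_coordMap A A hv, wordOp, LinearMap.sum_apply]
  rfl

/-- Parities depend only on columns, so one sign serves for all row words `I`. This allows a
permutation of rows to be traded for one of columns. -/
theorem genWord_perm {l l' : List κ} (h : l.Perm l') (A : κ → Fin m ⊕ Fin n) :
    ∃ s : ℂ, ∀ I : κ → Fin d, genWord (cells I A) l = s • genWord (cells I A) l' := by
  induction h with
  | nil => exact ⟨1, fun I => by simp⟩
  | cons p _ ih =>
    obtain ⟨s, hs⟩ := ih
    exact ⟨s, fun I => by rw [genWord_cons, genWord_cons, hs, mul_smul_comm]⟩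
  | swap p q l =>
    refine ⟨sgn (par (A q)) (par (A p)), fun I => ?_⟩
    rw [genWord_cons, genWord_cons, genWord_cons, genWord_cons, ← mul_assoc, gen_mul_gen,
      smul_mul_assoc, mul_assoc]
    simp only [cells, par_cell]
  | trans _ _ ih1 ih2 =>
    obtain ⟨s, hs⟩ := ih1
    obtain ⟨t, ht⟩ := ih2
    exact ⟨s * t, fun I => by rw [hs, ht, smul_smul]⟩

theorem wordMap_permRep (A : Fin k → Fin m ⊕ Fin n) (τ : Equiv.Perm (Fin k)) :
    ∃ s : ℂ, ∀ f : (Fin k → Fin d) → ℂ,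
      wordMap A (permRep (Fin k) (Fin d) τ f) = s • wordMap (A ∘ τ) f := by
  obtain ⟨s, hs⟩ := genWord_perm (d := d) (Equiv.Perm.map_finRange_perm τ.symm) (A ∘ τ)
  refine ⟨s, fun f => ?_⟩
  rw [wordMap_apply, wordMap_apply, Finset.smul_sum]
  refine Fintype.sum_equiv (Equiv.arrowCongr τ.symm (Equiv.refl (Fin d))) _ _ fun I => ?_
  change f (I ∘ τ) • _ = s • f (I ∘ τ) • genWord (cells (I ∘ τ) (A ∘ τ)) _ _
  rw [smul_comm s, ← LinearMap.smul_apply s, ← hs (I ∘ τ)]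
  congr 2
  simp [genWord, cells, Function.comp_def]

/-- Moving a generator to the right past an element of U(gl(m|n)) changes its column but never its
row, and the coefficients `R` are the same for all rows. -/
theorem gen_mul_mem (u : UGlSuper (Fin m) (Fin n)) (a : Fin m ⊕ Fin n) :
    ∃ R : Fin m ⊕ Fin n → UGlSuper (Fin m) (Fin n), ∀ i : Fin d,
      gen (cell i a) * glSuperRep d m n u = ∑ c, glSuperRep d m n (R c) * gen (cell i c) := by
  have hu : u ∈ Algebra.adjoin ℂ
      (Set.range fun p : (Fin m ⊕ Fin n) × (Fin m ⊕ Fin n) => colE m n p.1 p.2) := by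
    rw [matrixUnits_colE.adjoin_eq]; trivial
  induction hu using Algebra.adjoin_induction generalizing a with
  | mem x hx =>
    obtain ⟨⟨p, q⟩, rfl⟩ := hx
    set s := sgn (par p + par q) (par a) with hs
    have hss : s * s = 1 := sgn_mul_self _ _
    refine ⟨fun c => (if c = a then s • colE m n p q else 0)
      - (if c = p then (if q = a then algebraMap ℂ _ s else 0) else 0), fun i => ?_⟩
    have h1 := colOp_mul_gen (d := d) p q a i
    have h2 : gen (cell i a) * colOp p q = s • (colOp p q * gen (cell i a))
        - s • (if q = a then gen (cell i p) else 0) := by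
      rw [h1, smul_add, smul_smul, hss, one_smul, add_sub_cancel_right]
    simp only [map_sub, apply_ite (glSuperRep d m n), map_zero, sub_mul, ite_mul, zero_mul,
      Finset.sum_sub_distrib, Finset.sum_ite_eq', Finset.mem_univ, if_true, map_smul,
      glSuperRep_colE, h2, AlgHom.commutes, smul_mul_assoc, smul_ite, smul_zero,
      ← Algebra.smul_def]
  | algebraMap t =>
    refine ⟨fun c => if c = a then algebraMap ℂ _ t else 0, fun i => ?_⟩
    simp only [apply_ite (glSuperRep d m n), map_zero, ite_mul, zero_mul, Finset.sum_ite_eq',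
      Finset.mem_univ, if_true, AlgHom.commutes]
    exact (Algebra.commutes t _).symm
  | add x y _ _ hx hy =>
    obtain ⟨R, hR⟩ := hx a
    obtain ⟨R', hR'⟩ := hy a
    refine ⟨R + R', fun i => ?_⟩
    simp only [map_add, mul_add, hR, hR', Pi.add_apply, add_mul, Finset.sum_add_distrib]
  | mul x y _ _ hx hy =>
    obtain ⟨R, hR⟩ := hx a
    choose R' hR' using hy
    refine ⟨fun c => ∑ b, R b * R' b c, fun i => ?_⟩
    rw [map_mul, ← mul_assoc, hR, Finset.sum_mul]
    simp only [mul_assoc, hR', Finset.mul_sum, map_sum, map_mul, Finset.sum_mul]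
    rw [Finset.sum_comm]

/-- After the generator is moved past `R`, the sum over rows of generator times derivation is a
`colOp`, again in the image. -/
theorem sum_gen_mul_der_mem {R : Module.End ℂ (HoweSpace d m n)} (hR : R ∈ (glSuperRep d m n).range)
    (a b : Fin m ⊕ Fin n) :
    ∑ i, gen (cell i a) * R * der (cell i b) ∈ (glSuperRep d m n).range := by
  obtain ⟨u, rfl⟩ := hR
  obtain ⟨R, hR⟩ := gen_mul_mem (d := d) u a
  refine ⟨∑ c, R c * colE m n c b, ?_⟩
  change glSuperRep d m n _ = ∑ i, gen (cell i a) * glSuperRep d m n u * der (cell i b)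
  simp only [hR, map_sum, map_mul, glSuperRep_colE, colOp, Finset.sum_mul, Finset.mul_sum, mul_assoc]
  rw [Finset.sum_comm]

/-- The first letters of the two words form the outermost generator and the innermost derivation.
They enclose the operator of the shorter words, and `sum_gen_mul_der_mem` applies. -/
theorem wordOp_mem (A B : Fin k → Fin m ⊕ Fin n) : wordOp A B ∈ (glSuperRep d m n).range := by
  induction k with
  | zero => simp [wordOp, genWord, derWord]
  | succ k ih =>
    have h : wordOp A B = ∑ i : Fin d, gen (cell i (A 0)) * wordOp (A ∘ Fin.succ) (B ∘ Fin.succ)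
        * der (cell i (B 0)) := by
      have hc : ∀ (i : Fin d) (I : Fin k → Fin d) (A : Fin (k + 1) → Fin m ⊕ Fin n),
          cells (Fin.cons i I : Fin (k + 1) → Fin d) A
            = Fin.cons (cell i (A 0)) (cells I (A ∘ Fin.succ)) := by
        intro i I A
        funext p
        refine Fin.cases ?_ (fun p => ?_) p <;> simp [cells]
      rw [wordOp, sum_cons]
      simp only [hc, genWord_finRange_cons, derWord_finRange_cons, wordOp, Finset.mul_sum,
        Finset.sum_mul, mul_assoc]
    rw [h]
    exact sum_gen_mul_der_mem (ih _ _) _ _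

/-- The operators on `S^k` commuting with `gl(d)` come from `U(gl(m|n))`. -/
theorem exists_glSuperRep_eq (T : Module.End ℂ (howePow d m n k))
    (hT : ∀ (X : Matrix (Fin d) (Fin d) ℂ) (v w : howePow d m n k),
      rowAct X (v : HoweSpace d m n) = w → rowAct X (T v : HoweSpace d m n) = T w) :
    ∃ u : UGlSuper (Fin m) (Fin n), ∀ v : howePow d m n k,
      (T v : HoweSpace d m n) = glSuperRep d m n u v := by
  let γ : (Fin k → Fin m ⊕ Fin n) → ((Fin k → Fin d) → ℂ) →ₗ[ℂ] howePow d m n k :=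
    fun A => (wordMap A).codRestrict _ (wordMap_mem A)
  -- The matrix blocks of `T` with respect to column words, each a gl(d)-endomorphism of the tensor
  -- power.
  let c : (Fin k → Fin m ⊕ Fin n) → (Fin k → Fin m ⊕ Fin n) → Module.End ℂ ((Fin k → Fin d) → ℂ) :=
    fun A B => coordMap A ∘ₗ (howePow d m n k).subtype ∘ₗ T ∘ₗ γ B
  have hc : ∀ A B, c A B ∈ Submodule.span ℂ (Set.range (permRep (Fin k) (Fin d))) := by
    intro A B
    refine mem_span_permRep _ fun X => ?_
    refine LinearMap.ext fun f => ?_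
    simp only [Module.End.mul_apply]
    change coordMap A (T (γ B (Matrix.toLin' (coprodMat (Fin k) X) f)) : HoweSpace d m n)
      = Matrix.toLin' (coprodMat (Fin k) X) (coordMap A (T (γ B f) : HoweSpace d m n))
    rw [← coordMap_rowAct]
    congr 1
    exact (hT X (γ B f) (γ B (Matrix.toLin' (coprodMat (Fin k) X) f))
      (wordMap_coprodMat B X f).symm).symm
  have hspan : ∀ (A B : Fin k → Fin m ⊕ Fin n),
      ∀ S ∈ Submodule.span ℂ (Set.range (permRep (Fin k) (Fin d))),
      ∃ u : UGlSuper (Fin m) (Fin n), ∀ v ∈ howePow d m n k,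
        wordMap A (S (coordMap B v)) = glSuperRep d m n u v := by
    intro A B S hS
    induction hS using Submodule.span_induction with
    | mem S hS =>
      obtain ⟨τ, rfl⟩ := hS
      obtain ⟨s, hs⟩ := wordMap_permRep (d := d) A τ
      obtain ⟨u, hu⟩ := wordOp_mem (d := d) (A ∘ τ) B
      refine ⟨s • u, fun v hv => ?_⟩
      rw [hs, wordMap_coordMap _ _ hv, map_smul, LinearMap.smul_apply, ← hu]
      rfl
    | zero => exact ⟨0, fun v _ => by simp⟩
    | add x y _ _ hx hy =>
      obtain ⟨u, hu⟩ := hx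
      obtain ⟨u', hu'⟩ := hy
      exact ⟨u + u', fun v hv => by
        rw [LinearMap.add_apply, map_add, hu v hv, hu' v hv, map_add, LinearMap.add_apply]⟩
    | smul t x _ hx =>
      obtain ⟨u, hu⟩ := hx
      exact ⟨t • u, fun v hv => by
        rw [LinearMap.smul_apply, map_smul, hu v hv, map_smul, LinearMap.smul_apply]⟩
  choose u hu using fun A B => hspan A B _ (hc A B)
  have hk : (k.factorial : ℂ) ≠ 0 := by exact_mod_cast k.factorial_ne_zero
  -- The resolution of the identity is inserted on both sides of `T`, and each insertion costs a
  -- factor k!.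
  refine ⟨((k.factorial : ℂ)⁻¹ * (k.factorial : ℂ)⁻¹) • ∑ A, ∑ B, u A B, fun v => ?_⟩
  have h1 : (k.factorial : ℂ) • v = ∑ B, γ B (coordMap B (v : HoweSpace d m n)) := by
    apply Subtype.ext
    rw [Submodule.coe_smul, ← sum_wordMap_coordMap v.2]
    simp [γ]
  have h2 : (k.factorial : ℂ) • (k.factorial : ℂ) • (T v : HoweSpace d m n)
      = ∑ A, ∑ B, glSuperRep d m n (u A B) v := by
    rw [← Submodule.coe_smul, ← map_smul, h1, ← sum_wordMap_coordMap (T _).2]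
    refine Finset.sum_congr rfl fun A _ => ?_
    simp only [map_sum, Submodule.coe_sum]
    refine Finset.sum_congr rfl fun B _ => ?_
    exact hu A B v v.2
  rw [map_smul, LinearMap.smul_apply, map_sum, LinearMap.sum_apply]
  simp only [map_sum, LinearMap.sum_apply]
  rw [← h2, smul_smul, smul_smul, mul_assoc, mul_assoc, inv_mul_cancel_left₀ hk,
    inv_mul_cancel₀ hk, one_smul]

end Centralizer

/-! ### Semisimplicity -/

section Semisimple

variable {d m n : ℕ}

instance : Module (UGl d) (HoweSpace d m n) := Module.compHom _ (glRep d m n).toRingHom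

instance : Module (UGlSuper (Fin m) (Fin n)) (HoweSpace d m n) :=
  Module.compHom _ (glSuperRep d m n).toRingHom

theorem row_smul (u : UGl d) (v : HoweSpace d m n) : u • v = glRep d m n u v := rfl

theorem col_smul (u : UGlSuper (Fin m) (Fin n)) (v : HoweSpace d m n) :
    u • v = glSuperRep d m n u v := rfl

instance : IsScalarTower ℂ (UGl d) (HoweSpace d m n) :=
  ⟨fun t u v => by rw [row_smul, row_smul, map_smul, LinearMap.smul_apply]⟩

instance : IsScalarTower ℂ (UGlSuper (Fin m) (Fin n)) (HoweSpace d m n) :=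
  ⟨fun t u v => by rw [col_smul, col_smul, map_smul, LinearMap.smul_apply]⟩

instance : SMulCommClass (UGl d) (UGlSuper (Fin m) (Fin n)) (HoweSpace d m n) :=
  ⟨fun u u' v => LinearMap.congr_fun (commute_glRep_glSuperRep u u').eq v⟩

theorem rowE_smul (i j : Fin d) (v : HoweSpace d m n) : rowE d i j • v = rowOp i j v := by
  rw [row_smul, glRep_rowE]

theorem colE_smul (a b : Fin m ⊕ Fin n) (v : HoweSpace d m n) : colE m n a b • v = colOp a b v := by
  rw [col_smul, glSuperRep_colE]

variable {κ ι : Type} [Fintype κ] [DecidableEq κ] [Fintype ι] [DecidableEq ι]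

theorem tensorMat_mulSingle_sub (p : κ) (X Y : Matrix ι ι ℂ) :
    tensorMat (Pi.mulSingle p (X - Y)) = tensorMat (Pi.mulSingle p X) - tensorMat (Pi.mulSingle p Y) := by
  ext I J
  rw [Matrix.sub_apply]
  simp only [tensorMat_mulSingle_apply, Matrix.sub_apply, sub_mul]

theorem coprodMat_bracket (X Y : Matrix ι ι ℂ) :
    coprodMat κ (X * Y - Y * X) = coprodMat κ X * coprodMat κ Y - coprodMat κ Y * coprodMat κ X := by
  have h : ∀ p : κ, ∑ q, (tensorMat (Pi.mulSingle p X) * tensorMat (Pi.mulSingle q Y)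
      - tensorMat (Pi.mulSingle q Y) * tensorMat (Pi.mulSingle p X))
      = tensorMat (Pi.mulSingle p (X * Y - Y * X)) := by
    intro p
    rw [Finset.sum_eq_single p]
    · rw [tensorMat_mulSingle_sub, tensorMat_mul, tensorMat_mul, ← Pi.mulSingle_mul,
        ← Pi.mulSingle_mul]
    · intro q _ hq
      rw [tensorMat_mul, tensorMat_mul, sub_eq_zero]
      congr 1
      exact Pi.mulSingle_commute (f := fun _ : κ => Matrix ι ι ℂ) (Ne.symm hq) X Y
    · simp
  have h1 : coprodMat κ X * coprodMat κ Y
      = ∑ p, ∑ q, tensorMat (Pi.mulSingle p X) * tensorMat (Pi.mulSingle q Y) := by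
    simp only [coprodMat, Finset.sum_mul, Finset.mul_sum]
    exact Finset.sum_comm
  have h2 : coprodMat κ Y * coprodMat κ X
      = ∑ p, ∑ q, tensorMat (Pi.mulSingle q Y) * tensorMat (Pi.mulSingle p X) := by
    simp only [coprodMat, Finset.sum_mul, Finset.mul_sum]
  rw [h1, h2, ← Finset.sum_sub_distrib]
  simp only [← Finset.sum_sub_distrib, h, coprodMat]

variable (κ) in
/-- The action of `U(gl(d))` on the tensor power. -/
def tensorRep (d : ℕ) : UGl d →ₐ[ℂ] Module.End ℂ ((κ → Fin d) → ℂ) :=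
  UniversalEnvelopingAlgebra.lift ℂ
    { toFun := fun X => Matrix.toLin' (coprodMat κ X)
      map_add' := fun X Y => by
        rw [← map_add]
        congr 1
        ext I J
        simp only [coprodMat, Matrix.add_apply, Matrix.sum_apply, tensorMat_mulSingle_apply, add_mul,
          Finset.sum_add_distrib]
      map_smul' := fun t X => by
        rw [RingHom.id_apply, ← map_smul]
        congr 1
        ext I J
        simp only [coprodMat, Matrix.smul_apply, Matrix.sum_apply, tensorMat_mulSingle_apply,
          smul_eq_mul, mul_assoc, Finset.mul_sum]
      map_lie' := fun {X Y} => by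
        change Matrix.toLin' (coprodMat κ (X * Y - Y * X)) = Matrix.toLin' (coprodMat κ X)
          * Matrix.toLin' (coprodMat κ Y) - Matrix.toLin' (coprodMat κ Y)
          * Matrix.toLin' (coprodMat κ X)
        rw [coprodMat_bracket, map_sub, Matrix.toLin'_mul, Matrix.toLin'_mul]
        rfl }

theorem tensorRep_ι (X : Matrix (Fin d) (Fin d) ℂ) :
    tensorRep κ d (UGl.ι d X) = Matrix.toLin' (coprodMat κ X) :=
  UniversalEnvelopingAlgebra.lift_ι_apply ℂ _ X

theorem wordMap_tensorRep {k : ℕ} (A : Fin k → Fin m ⊕ Fin n) (u : UGl d)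
    (f : (Fin k → Fin d) → ℂ) : wordMap A (tensorRep (Fin k) d u f) = u • wordMap A f := by
  have hu : u ∈ Algebra.adjoin ℂ (Set.range (UGl.ι d)) := by
    rw [UGl.adjoin_range_ι]; trivial
  induction hu using Algebra.adjoin_induction generalizing f with
  | mem x hx =>
    obtain ⟨X, rfl⟩ := hx
    rw [tensorRep_ι, wordMap_coprodMat, row_smul, glRep_ι]
    rfl
  | algebraMap t => rw [AlgHom.commutes, algebraMap_smul, Module.algebraMap_end_apply, map_smul]
  | add x y _ _ hx hy => rw [map_add, LinearMap.add_apply, map_add, hx, hy, add_smul]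
  | mul x y _ _ hx hy => rw [map_mul, Module.End.mul_apply, hx, hy, mul_smul]

/-- By the resolution of the identity, S^k is contained in the image of a direct sum of tensor
powers, one for each column word. The tensor powers are semisimple over gl(d), and so are their sums
and images. -/
theorem exists_semisimple_ge_howePow (k : ℕ) : ∃ p : Submodule (UGl d) (HoweSpace d m n),
    IsSemisimpleModule (UGl d) p ∧ ∀ v ∈ howePow d m n k, v ∈ p := by
  let _ : Module (UGl d) ((Fin k → Fin d) → ℂ) := Module.compHom _ (tensorRep (Fin k) d).toRingHom
  have hsm : ∀ (u : UGl d) (f : (Fin k → Fin d) → ℂ), u • f = tensorRep (Fin k) d u f :=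
    fun _ _ => rfl
  have : IsScalarTower ℂ (UGl d) ((Fin k → Fin d) → ℂ) :=
    ⟨fun t u f => by rw [hsm, hsm, map_smul, LinearMap.smul_apply]⟩
  have : IsSemisimpleModule (UGl d) ((Fin k → Fin d) → ℂ) :=
    isSemisimpleModule_tensor (UGl.ι d) (fun X f => by rw [hsm, tensorRep_ι]) UGl.adjoin_range_ι
  let F : ((Fin k → Fin m ⊕ Fin n) → (Fin k → Fin d) → ℂ) →ₗ[UGl d] HoweSpace d m n :=
    { toFun := fun f => ∑ A, wordMap A (f A)
      map_add' := fun f g => by simp [Finset.sum_add_distrib]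
      map_smul' := fun u f => by
        simp only [Pi.smul_apply, RingHom.id_apply, Finset.smul_sum]
        exact Finset.sum_congr rfl fun A _ => wordMap_tensorRep A u (f A) }
  refine ⟨LinearMap.range F, IsSemisimpleModule.range F, fun v hv => ?_⟩
  refine ⟨fun A => (k.factorial : ℂ)⁻¹ • coordMap A v, ?_⟩
  change ∑ A, wordMap A ((k.factorial : ℂ)⁻¹ • coordMap A v) = v
  have hk : (k.factorial : ℂ) ≠ 0 := by exact_mod_cast k.factorial_ne_zero
  simp only [map_smul, ← Finset.smul_sum, sum_wordMap_coordMap hv, smul_smul, inv_mul_cancel₀ hk,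
    one_smul]

/-- The supersymmetric algebra is a semisimple `gl(d)`-module. -/
instance isSemisimpleModule_howeSpace : IsSemisimpleModule (UGl d) (HoweSpace d m n) := by
  choose p hp hp' using exists_semisimple_ge_howePow (d := d) (m := m) (n := n)
  refine isSemisimpleModule_of_isSemisimpleModule_submodule' (p := p) hp ?_
  rw [eq_top_iff]
  intro v _
  have hv : v ∈ ⨆ k, howePow d m n k := by rw [iSup_superSymPow]; trivial
  refine Submodule.iSup_induction (p := howePow d m n) (motive := fun v => v ∈ ⨆ k, p k) hv
    (fun k v hv => Submodule.mem_iSup_of_mem k (hp' k v hv)) (zero_mem _)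
    (fun v w hv hw => add_mem hv hw)

instance finiteDimensional_howePow (k : ℕ) : FiniteDimensional ℂ (howePow d m n k) := by
  let F : ((Fin k → Fin m ⊕ Fin n) → (Fin k → Fin d) → ℂ) →ₗ[ℂ] HoweSpace d m n :=
    ∑ A, wordMap A ∘ₗ LinearMap.proj A
  refine Submodule.finiteDimensional_of_le (S₂ := LinearMap.range F) fun v hv => ?_
  refine ⟨fun A => (k.factorial : ℂ)⁻¹ • coordMap A v, ?_⟩
  have hk : (k.factorial : ℂ) ≠ 0 := by exact_mod_cast k.factorial_ne_zero
  simp only [F, LinearMap.sum_apply, LinearMap.comp_apply, LinearMap.proj_apply, map_smul,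
    ← Finset.smul_sum, sum_wordMap_coordMap hv, smul_smul, inv_mul_cancel₀ hk, one_smul]

instance (k : ℕ) : Module (UGl d) (howePow d m n k) :=
  Module.compHom _ (glRepPow d m n k).toRingHom

theorem coe_row_smul {k : ℕ} (u : UGl d) (v : howePow d m n k) :
    ((u • v : howePow d m n k) : HoweSpace d m n) = u • (v : HoweSpace d m n) := rfl

instance (k : ℕ) : IsScalarTower ℂ (UGl d) (howePow d m n k) :=
  ⟨fun t u v => Subtype.ext (by
    rw [coe_row_smul, Submodule.coe_smul, coe_row_smul, smul_assoc])⟩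

instance (k : ℕ) : IsSemisimpleModule (UGl d) (howePow d m n k) :=
  IsSemisimpleModule.of_injective
    ({ toFun := Subtype.val
       map_add' := fun _ _ => rfl
       map_smul' := fun _ _ => rfl } : howePow d m n k →ₗ[UGl d] HoweSpace d m n)
    Subtype.val_injective

theorem rowAct_eq_smul (X : Matrix (Fin d) (Fin d) ℂ) (v : HoweSpace d m n) :
    rowAct X v = UGl.ι d X • v := by
  rw [row_smul, glRep_ι]; rfl

/-- An endomorphism of the `gl(d)`-module `S^k` is given by an element of `U(gl(m|n))`. -/
theorem exists_smul_of_linear {k : ℕ} (T : howePow d m n k →ₗ[UGl d] howePow d m n k) :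
    ∃ u : UGlSuper (Fin m) (Fin n), ∀ v : howePow d m n k,
      (T v : HoweSpace d m n) = u • (v : HoweSpace d m n) := by
  refine exists_glSuperRep_eq (T.restrictScalars ℂ) fun X v w h => ?_
  rw [rowAct_eq_smul] at h ⊢
  have : w = UGl.ι d X • v := Subtype.ext h.symm
  rw [this]
  change _ = ((T (UGl.ι d X • v) : howePow d m n k) : HoweSpace d m n)
  rw [map_smul]
  rfl

end Semisimple

/-! ### The double centralizer property -/

section DoubleCentralizer

variable {d m n : ℕ}

theorem glRepPow_commute (k : ℕ) (u : UGl d) (u' : UGlSuper (Fin m) (Fin n)) :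
    Commute (glRepPow d m n k u) (glSuperRepPow d m n k u') :=
  LinearMap.ext fun v => Subtype.ext
    (LinearMap.congr_fun (commute_glRep_glSuperRep u u').eq (v : HoweSpace d m n))

theorem centralizer_glRepPow (k : ℕ) :
    Subalgebra.centralizer ℂ ((glRepPow d m n k).range : Set _) = (glSuperRepPow d m n k).range := by
  apply le_antisymm
  · intro T hT
    rw [Subalgebra.mem_centralizer_iff] at hT
    have hlin : ∀ (u : UGl d) (v : howePow d m n k), T (u • v) = u • T v := fun u v =>
      (LinearMap.congr_fun (hT _ ⟨u, rfl⟩) v).symm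
    obtain ⟨u, hu⟩ := exists_smul_of_linear
      ({ T with map_smul' := hlin } : howePow d m n k →ₗ[UGl d] howePow d m n k)
    exact ⟨u, LinearMap.ext fun v => Subtype.ext (hu v).symm⟩
  · rintro _ ⟨u', rfl⟩
    rw [Subalgebra.mem_centralizer_iff]
    rintro _ ⟨u, rfl⟩
    exact (glRepPow_commute k u u').eq

/-- Since U(gl(m|n)) gives all gl(d)-endomorphisms, an operator commuting with it lies in the
bicommutant of gl(d). Density needs semisimplicity on the gl(d) side only. -/
theorem centralizer_glSuperRepPow (k : ℕ) :
    Subalgebra.centralizer ℂ ((glSuperRepPow d m n k).range : Set _) = (glRepPow d m n k).range := by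
  apply le_antisymm
  · intro T hT
    rw [Subalgebra.mem_centralizer_iff] at hT
    obtain ⟨r, hr⟩ := exists_smul_of_commute (R := UGl d) T fun g v => by
      obtain ⟨u, hu⟩ := exists_smul_of_linear g
      have hg : ∀ v, g v = glSuperRepPow d m n k u v := fun v => Subtype.ext (hu v)
      rw [hg, hg]
      exact (LinearMap.congr_fun (hT _ ⟨u, rfl⟩) v).symm
    exact ⟨r, LinearMap.ext fun v => (hr v).symm⟩
  · rintro _ ⟨u, rfl⟩
    rw [Subalgebra.mem_centralizer_iff]
    rintro _ ⟨u', rfl⟩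
    exact (glRepPow_commute k u u').eq.symm

variable (d m n) in
/-- The Euler operator. -/
def euler : Module.End ℂ (HoweSpace d m n) := ∑ x, gen x * der x

theorem euler_apply {k : ℕ} {v : HoweSpace d m n} (hv : v ∈ howePow d m n k) :
    euler d m n v = (k : ℂ) • v := by
  rw [← sum_gen_der hv, euler, LinearMap.sum_apply]
  rfl

/-- The S^k span S and lie in eigenspaces for distinct eigenvalues, so each of them is the full
eigenspace. -/
theorem mem_howePow_iff {k : ℕ} {v : HoweSpace d m n} :
    v ∈ howePow d m n k ↔ euler d m n v = (k : ℂ) • v := by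
  refine ⟨euler_apply, fun h => ?_⟩
  have hle : ∀ j, howePow d m n j ≤ (euler d m n).eigenspace (j : ℂ) := fun j w hw =>
    Module.End.mem_eigenspace_iff.2 (euler_apply hw)
  have hv : v ∈ howePow d m n k ⊔ ⨆ (j) (_ : j ≠ k), howePow d m n j := by
    have : v ∈ ⨆ j, howePow d m n j := by rw [iSup_superSymPow]; trivial
    suffices hle : ⨆ j, howePow d m n j
        ≤ howePow d m n k ⊔ ⨆ (j) (_ : j ≠ k), howePow d m n j from hle this
    refine iSup_le fun j => ?_
    by_cases hj : j = k
    · rw [hj]; exact le_sup_left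
    · exact le_sup_of_le_right (le_iSup₂_of_le j hj le_rfl)
  obtain ⟨a, ha, b, hb, rfl⟩ := Submodule.mem_sup.1 hv
  have hb' : b ∈ ⨆ (j : ℂ) (_ : j ≠ (k : ℂ)), (euler d m n).eigenspace j := by
    suffices hle' : ⨆ (j) (_ : j ≠ k), howePow d m n j
        ≤ ⨆ (j : ℂ) (_ : j ≠ (k : ℂ)), (euler d m n).eigenspace j from hle' hb
    refine iSup₂_le fun j hj => ?_
    exact (hle j).trans (le_iSup₂_of_le (j : ℂ) (by exact_mod_cast hj) le_rfl)
  have hbk : b ∈ (euler d m n).eigenspace (k : ℂ) := by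
    have := sub_mem (Module.End.mem_eigenspace_iff.2 h) (hle k ha)
    rwa [add_sub_cancel_left] at this
  have hb0 : b = 0 := (Submodule.mem_bot ℂ).1
    ((Module.End.eigenspaces_iSupIndep (euler d m n) (k : ℂ)).le_bot ⟨hbk, hb'⟩)
  rw [hb0, add_zero]
  exact ha

/-- An operator which in each degree agrees with an element of the image agrees with such an
element on every finite set. -/
theorem exists_agree {U : Type} [Ring U] [Algebra ℂ U] (ρ : U →ₐ[ℂ] Module.End ℂ (HoweSpace d m n))
    {z : U} (hz : ρ z = euler d m n) {T : Module.End ℂ (HoweSpace d m n)} {u : ℕ → U}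
    (hu : ∀ k, ∀ v ∈ howePow d m n k, T v = ρ (u k) v) (s : Finset (HoweSpace d m n)) :
    ∃ x : U, ∀ v ∈ s, T v = ρ x v := by
  let Fil : ℕ → Submodule ℂ (HoweSpace d m n) := fun K => ⨆ k : Fin K, howePow d m n k
  have hmono : Monotone Fil := fun K L hKL => iSup_le fun k =>
    le_iSup_of_le (⟨k, k.2.trans_le hKL⟩ : Fin L) le_rfl
  have hex : ∀ v : HoweSpace d m n, ∃ K, v ∈ Fil K := by
    intro v
    have hv : v ∈ ⨆ j, howePow d m n j := by rw [iSup_superSymPow]; trivial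
    refine Submodule.iSup_induction (p := howePow d m n) (motive := fun v => ∃ K, v ∈ Fil K) hv
      (fun k v hv => ⟨k + 1, Submodule.mem_iSup_of_mem (⟨k, k.lt_succ_self⟩ : Fin (k + 1)) hv⟩)
      ⟨0, zero_mem _⟩ ?_
    rintro v w ⟨K, hK⟩ ⟨L, hL⟩
    exact ⟨max K L, add_mem (hmono (le_max_left K L) hK) (hmono (le_max_right K L) hL)⟩
  choose Kf hKf using hex
  let K := s.sup Kf
  have hK : ∀ v ∈ s, v ∈ Fil K := fun v hv => hmono (Finset.le_sup hv) (hKf v)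
  -- The Lagrange basis polynomials at 0, …, K-1, evaluated at the Euler element, act on degrees
  -- below K as the projections to single degrees.
  let p : ℕ → Polynomial ℂ := fun k => Lagrange.basis (Finset.range K) (fun j : ℕ => (j : ℂ)) k
  have hinj : Set.InjOn (fun j : ℕ => (j : ℂ)) (Finset.range K) := Nat.cast_injective.injOn
  refine ⟨∑ k ∈ Finset.range K, u k * Polynomial.aeval z (p k), fun v hv => ?_⟩
  refine Submodule.iSup_induction (p := fun k : Fin K => howePow d m n k) (motive := fun v =>
    T v = ρ (∑ k ∈ Finset.range K, u k * Polynomial.aeval z (p k)) v) (hK v hv) ?_ (by simp)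
    (fun v w hv hw => by rw [map_add, map_add, hv, hw])
  intro j v hv
  have hp : ∀ k ∈ Finset.range K, ρ (u k * Polynomial.aeval z (p k)) v
      = if k = (j : ℕ) then T v else 0 := by
    intro k hk
    rw [map_mul, Module.End.mul_apply, ← Polynomial.aeval_algHom_apply, hz,
      Module.End.aeval_apply_of_mem_apply_eq_smul (euler_apply hv)]
    have hjK : (j : ℕ) ∈ Finset.range K := Finset.mem_range.2 j.2
    split_ifs with hkj
    · subst hkj
      rw [Lagrange.eval_basis_self hinj hk, one_smul, hu _ v hv]
    · rw [Lagrange.eval_basis_of_ne hkj hjK, zero_smul, map_zero]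
  rw [map_sum, LinearMap.sum_apply, Finset.sum_congr rfl hp]
  simp [j.2]

theorem euler_eq_glRep : glRep d m n (∑ i, rowE d i i) = euler d m n := by
  rw [map_sum, euler, ← sum_rowOp_self]
  simp only [glRep_rowE]

theorem euler_eq_glSuperRep : glSuperRep d m n (∑ a, colE m n a a) = euler d m n := by
  rw [map_sum, euler, ← sum_colOp_self]
  simp only [glSuperRep_colE]

theorem mem_howePow_of_commute {T : Module.End ℂ (HoweSpace d m n)} (hT : Commute (euler d m n) T)
    {k : ℕ} {v : HoweSpace d m n} (hv : v ∈ howePow d m n k) : T v ∈ howePow d m n k := by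
  rw [mem_howePow_iff] at hv ⊢
  have := LinearMap.congr_fun hT.eq v
  rw [Module.End.mul_apply, Module.End.mul_apply, hv, map_smul] at this
  exact this

theorem finiteClosure_subset_centralizer {M : Type} [AddCommGroup M] [Module ℂ M]
    {A B : Subalgebra ℂ (Module.End ℂ M)} (h : ∀ a ∈ A, ∀ b ∈ B, Commute a b) :
    finiteClosure A ⊆ Set.centralizer (B : Set (Module.End ℂ M)) := by
  classical
  intro T hT
  rw [Set.mem_centralizer_iff]
  intro b hb
  refine LinearMap.ext fun v => ?_
  obtain ⟨a, ha, hav⟩ := hT {v, b v}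
  rw [Module.End.mul_apply, Module.End.mul_apply, hav v (by simp), hav (b v) (by simp)]
  exact (LinearMap.congr_fun (h a ha b hb).eq v).symm

/-- Commuting with the Euler operator forces `T` to preserve degrees. Each restriction comes from
U(gl(d)), and finitely many of these elements are merged by `exists_agree`. -/
theorem centralizer_glSuperRep :
    Set.centralizer ((glSuperRep d m n).range : Set _) = finiteClosure (glRep d m n).range := by
  apply Set.Subset.antisymm
  · intro T hT s
    rw [Set.mem_centralizer_iff] at hT
    have hdeg : ∀ k, ∀ v ∈ howePow d m n k, T v ∈ howePow d m n k := fun k v hv =>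
      mem_howePow_of_commute (hT _ ⟨_, euler_eq_glSuperRep⟩) hv
    have hex : ∀ k, ∃ u : UGl d, ∀ v ∈ howePow d m n k, T v = glRep d m n u v := by
      intro k
      have hmem : T.restrict (hdeg k) ∈ (glRepPow d m n k).range := by
        rw [← centralizer_glSuperRepPow, Subalgebra.mem_centralizer_iff]
        rintro _ ⟨u, rfl⟩
        exact LinearMap.ext fun v => Subtype.ext (LinearMap.congr_fun (hT _ ⟨u, rfl⟩) v)
      obtain ⟨u, hu⟩ := hmem
      exact ⟨u, fun v hv => (congrArg Subtype.val (LinearMap.congr_fun hu ⟨v, hv⟩)).symm⟩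
    choose u hu using hex
    obtain ⟨x, hx⟩ := exists_agree (glRep d m n) euler_eq_glRep hu s
    exact ⟨_, ⟨x, rfl⟩, hx⟩
  · refine finiteClosure_subset_centralizer ?_
    rintro _ ⟨u, rfl⟩ _ ⟨u', rfl⟩
    exact commute_glRep_glSuperRep u u'

theorem centralizer_glRep :
    Set.centralizer ((glRep d m n).range : Set _) = finiteClosure (glSuperRep d m n).range := by
  apply Set.Subset.antisymm
  · intro T hT s
    rw [Set.mem_centralizer_iff] at hT
    have hdeg : ∀ k, ∀ v ∈ howePow d m n k, T v ∈ howePow d m n k := fun k v hv =>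
      mem_howePow_of_commute (hT _ ⟨_, euler_eq_glRep⟩) hv
    have hex : ∀ k, ∃ u : UGlSuper (Fin m) (Fin n), ∀ v ∈ howePow d m n k,
        T v = glSuperRep d m n u v := by
      intro k
      have hmem : T.restrict (hdeg k) ∈ (glSuperRepPow d m n k).range := by
        rw [← centralizer_glRepPow, Subalgebra.mem_centralizer_iff]
        rintro _ ⟨u, rfl⟩
        exact LinearMap.ext fun v => Subtype.ext (LinearMap.congr_fun (hT _ ⟨u, rfl⟩) v)
      obtain ⟨u, hu⟩ := hmem
      exact ⟨u, fun v hv => (congrArg Subtype.val (LinearMap.congr_fun hu ⟨v, hv⟩)).symm⟩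
    choose u hu using hex
    obtain ⟨x, hx⟩ := exists_agree (glSuperRep d m n) euler_eq_glSuperRep hu s
    exact ⟨_, ⟨x, rfl⟩, hx⟩
  · refine finiteClosure_subset_centralizer ?_
    rintro _ ⟨u, rfl⟩ _ ⟨u', rfl⟩
    exact (commute_glRep_glSuperRep u' u).symm

end DoubleCentralizer

/-! ### Weights of singular vectors -/

section Weights

/-- Singular vectors of the same weight in a semisimple module are related by an endomorphism. -/
theorem MatrixUnits.exists_linear {I U M : Type} [Fintype I] [DecidableEq I] [Ring U] [Algebra ℂ U]
    [AddCommGroup M] [Module ℂ M] [Module U M] [IsScalarTower ℂ U M] {e : I → I → U} {c : I → ℕ}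
    {wt : I → ℂ} {v w : M} (h : MatrixUnits e) (hc : Function.Injective c)
    [IsSemisimpleModule U M] (hv : IsSingular e c wt v) (hw : IsSingular e c wt w) (hv0 : v ≠ 0)
    (hw0 : w ≠ 0) : ∃ T : M →ₗ[U] M, T v = w := by
  let _ : LT I := ⟨fun i j => c i < c j⟩
  obtain ⟨_, φ, hφ, hφv⟩ := h.exists_simpleHW hc (fun i j => Iff.rfl) hv hv0
  obtain ⟨_, ψ, -, hψw⟩ := h.exists_simpleHW hc (fun i j => Iff.rfl) hw hw0
  -- Both vectors generate copies of the same simple module. The map between the copies extends to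
  -- the whole module by semisimplicity.
  obtain ⟨T, hT⟩ := IsSemisimpleModule.extension_property φ hφ ψ
  exact ⟨T, by rw [← hφv, ← hψw, ← hT]; rfl⟩

variable {d m n : ℕ}

theorem rowOp_mul_rowOp (i j k l : Fin d) :
    (rowOp i j * rowOp k l : Module.End ℂ (HoweSpace d m n))
      = rowOp k l * rowOp i j + ((if j = k then rowOp i l else 0) - if l = i then rowOp k j else 0) := by
  have h : ∀ a, rowOp i j * (gen (cell k a) * der (cell l a))
      = gen (cell k a) * der (cell l a) * rowOp i j
        + ((if j = k then gen (cell i a) * der (cell l a) else 0)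
          - if l = i then gen (cell k a) * der (cell j a) else 0 :
            Module.End ℂ (HoweSpace d m n)) := by
    intro a
    rw [← mul_assoc, rowOp_mul_gen, add_mul, mul_assoc, mul_assoc _ _ (rowOp i j), der_mul_rowOp,
      mul_add]
    split_ifs <;> simp
  conv_lhs => rw [rowOp.eq_def k l, Finset.mul_sum]
  simp only [h, Finset.sum_add_distrib, Finset.sum_sub_distrib, ← Finset.sum_mul]
  congr 1
  congr 1
  · split_ifs <;> simp [rowOp]
  · split_ifs <;> simp [rowOp]

theorem rowOp_self_apply (i : Fin d) (v : HoweSpace d m n) :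
    rowOp i i v = ∑ x ∈ Finset.univ.image (cell i), gen x (der x v) := by
  rw [rowOp, LinearMap.sum_apply, Finset.sum_image fun a _ b _ h => (cell_inj.1 h).2]
  rfl

theorem exists_nat_row {i : Fin d} {t : ℂ} {v : HoweSpace d m n} (hv : v ≠ 0)
    (h : rowOp i i v = t • v) : ∃ r : ℕ, t = r :=
  exists_nat_of_number _ hv (rowOp_self_apply i v ▸ h)

/-- Singular vectors of `gl(d)` have dominant weights. -/
theorem row_weight_le {i j : Fin d} (hij : i ≠ j) {s t : ℕ} {v : HoweSpace d m n} (hv : v ≠ 0)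
    (hi : rowOp i i v = (s : ℂ) • v) (hj : rowOp j j v = (t : ℂ) • v) (he : rowOp i j v = 0) :
    t ≤ s := by
  by_contra hlt
  push Not at hlt
  -- The lowering string of an sl(2)-triple. If `s < t`, the coefficients in `hef` never vanish and
  -- the string is infinite.
  have hf : ∀ r : ℕ, rowOp i i ((rowOp j i ^ r) v) = ((s : ℂ) - r) • (rowOp j i ^ r) v ∧
      rowOp j j ((rowOp j i ^ r) v) = ((t : ℂ) + r) • (rowOp j i ^ r) v := by
    intro r
    induction r with
    | zero => simpa using ⟨hi, hj⟩
    | succ r ih =>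
      have h1 := LinearMap.congr_fun (rowOp_mul_rowOp (m := m) (n := n) i i j i) ((rowOp j i ^ r) v)
      have h2 := LinearMap.congr_fun (rowOp_mul_rowOp (m := m) (n := n) j j j i) ((rowOp j i ^ r) v)
      simp only [hij, Ne.symm hij, if_true, if_false, Module.End.mul_apply, LinearMap.add_apply,
        LinearMap.sub_apply, LinearMap.zero_apply, ih.1, ih.2, map_smul] at h1 h2
      rw [pow_succ', Module.End.mul_apply]
      refine ⟨?_, ?_⟩
      · rw [h1]; push_cast; module
      · rw [h2]; push_cast; module
  have hef : ∀ r : ℕ, rowOp i j ((rowOp j i ^ (r + 1)) v)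
      = ((r + 1 : ℂ) * ((s : ℂ) - t - r)) • (rowOp j i ^ r) v := by
    intro r
    induction r with
    | zero =>
      have h1 := LinearMap.congr_fun (rowOp_mul_rowOp (m := m) (n := n) i j j i) v
      simp only [if_true, Module.End.mul_apply, LinearMap.add_apply, LinearMap.sub_apply, he,
        map_zero, hi, hj] at h1
      simp only [zero_add, pow_one, pow_zero, Module.End.one_apply, h1]
      push_cast; module
    | succ r ih =>
      have h1 := LinearMap.congr_fun (rowOp_mul_rowOp (m := m) (n := n) i j j i)
        ((rowOp j i ^ (r + 1)) v)
      simp only [if_true, Module.End.mul_apply, LinearMap.add_apply, LinearMap.sub_apply, ih,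
        map_smul, hf] at h1
      rw [pow_succ', Module.End.mul_apply, h1, ← Module.End.mul_apply, ← pow_succ']
      push_cast; module
  have hne : ∀ r : ℕ, (rowOp j i ^ r) v ≠ 0 := by
    intro r
    induction r with
    | zero => simpa using hv
    | succ r ih =>
      intro h0
      have h1 := hef r
      rw [h0, map_zero] at h1
      have h2 := (smul_eq_zero.1 h1.symm).resolve_right ih
      rcases mul_eq_zero.1 h2 with h3 | h3
      · exact absurd h3 (by exact_mod_cast Nat.succ_ne_zero r)
      · have : (s : ℂ) = ((t + r : ℕ) : ℂ) := by push_cast; linear_combination h3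
        have := Nat.cast_injective this
        omega
  -- At step `s + 1` the number operator of row `i` would have the eigenvalue -1.
  obtain ⟨r, hr⟩ := exists_nat_row (hne (s + 1)) (hf (s + 1)).1
  have h3 : ((r + 1 : ℕ) : ℂ) = 0 := by push_cast at hr ⊢; linear_combination -hr
  exact absurd (Nat.cast_eq_zero.1 h3) (Nat.succ_ne_zero r)

/-- Vectors of a weight with natural entries are homogeneous. -/
theorem mem_howePow_of_row {l : Fin d → ℕ} {v : HoweSpace d m n}
    (h : ∀ i, rowOp i i v = (l i : ℂ) • v) : v ∈ howePow d m n (∑ i, l i) := by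
  rw [mem_howePow_iff, euler, ← sum_rowOp_self, LinearMap.sum_apply]
  simp only [h, ← Finset.sum_smul]
  push_cast
  rfl

theorem isSingular_rowE {c : Fin d → ℕ} {wt : Fin d → ℂ} {v : HoweSpace d m n} :
    IsSingular (rowE d) c wt v ↔ (∀ i j, c i < c j → rowOp i j v = 0) ∧
      ∀ i, rowOp i i v = wt i • v := by
  simp only [IsSingular, rowE_smul]

theorem isSingular_colE {c : Fin m ⊕ Fin n → ℕ} {wt : Fin m ⊕ Fin n → ℂ} {v : HoweSpace d m n} :
    IsSingular (colE m n) c wt v ↔ (∀ i j, c i < c j → colOp i j v = 0) ∧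
      ∀ i, colOp i i v = wt i • v := by
  simp only [IsSingular, colE_smul]

/-- Singular vectors for `gl(d)` of the same weight are related by `U(gl(m|n))`. -/
theorem exists_col_smul_eq {c : Fin d → ℕ} (hc : Function.Injective c) {l : Fin d → ℕ}
    {v w : HoweSpace d m n} (hv : IsSingular (rowE d) c (fun i => (l i : ℂ)) v)
    (hw : IsSingular (rowE d) c (fun i => (l i : ℂ)) w) (hv0 : v ≠ 0) (hw0 : w ≠ 0) :
    ∃ u : UGlSuper (Fin m) (Fin n), u • v = w := by
  have hvk := mem_howePow_of_row (isSingular_rowE.1 hv).2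
  have hwk := mem_howePow_of_row (isSingular_rowE.1 hw).2
  have lift : ∀ {x : HoweSpace d m n} (hx : x ∈ howePow d m n (∑ i, l i)),
      IsSingular (rowE d) c (fun i => (l i : ℂ)) x →
      IsSingular (rowE d) c (fun i => (l i : ℂ)) (⟨x, hx⟩ : howePow d m n (∑ i, l i)) :=
    fun hx h => ⟨fun i j hij => Subtype.ext (h.1 i j hij), fun i => Subtype.ext (h.2 i)⟩
  obtain ⟨T, hT⟩ := matrixUnits_rowE.exists_linear hc (lift hvk hv) (lift hwk hw)
    (fun h0 => hv0 (congrArg Subtype.val h0)) (fun h0 => hw0 (congrArg Subtype.val h0))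
  obtain ⟨u, hu⟩ := exists_smul_of_linear T
  refine ⟨u, ?_⟩
  rw [← hu ⟨v, hvk⟩, hT]

end Weights

/-! ### Peeling off the first row and column of a joint singular vector -/

section Peel

variable {d m n : ℕ}

variable (m n) in
/-- The position of a column in the standard order. -/
def colHt : Fin m ⊕ Fin n → ℕ := Sum.elim (fun a => a) (fun b => m + b)

theorem colHt_injective : Function.Injective (colHt m n) := by
  rintro (a | a) (b | b) h <;> simp only [colHt, Sum.elim_inl, Sum.elim_inr] at h
  · rw [Fin.ext h]
  · have := a.2; omega
  · have := b.2; omega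
  · rw [Fin.ext (Nat.add_left_cancel h)]

theorem pow_succ_mul_of_commutator {A : Type} [Ring A] {D X Y : A} (hXY : D * X = X * D + Y)
    (hDY : Commute D Y) (N : ℕ) : D ^ (N + 1) * X = X * D ^ (N + 1) + (N + 1) • (D ^ N * Y) := by
  induction N with
  | zero => simp [hXY]
  | succ N ih =>
    rw [pow_succ' D (N + 1), mul_assoc, ih, mul_add, ← mul_assoc, hXY, add_mul, mul_assoc, ← pow_succ',
      mul_smul_comm, ← mul_assoc, ← pow_succ', hDY.pow_left (N + 1) |>.symm.eq, succ_nsmul _ (N + 1)]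
    abel

/-- After peeling off `t` rows and columns: `w` involves only the other rows and columns, and is a
joint singular vector with respect to them. -/
structure Peeled (l : Fin d → ℕ) (x : Fin m ⊕ Fin n → ℂ) (t : ℕ) (w : HoweSpace d m n) : Prop where
  ne_zero : w ≠ 0
  der_row : ∀ (i : Fin d) a, (i : ℕ) < t → der (cell i a) w = 0
  der_col : ∀ (i : Fin d) a, colHt m n a < t → der (cell i a) w = 0
  row : ∀ i j : Fin d, t ≤ (i : ℕ) → i < j → rowOp i j w = 0
  row_self : ∀ i : Fin d, t ≤ (i : ℕ) → rowOp i i w = (l i : ℂ) • w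
  col : ∀ a b, t ≤ colHt m n a → colHt m n a < colHt m n b → colOp a b w = 0
  col_self : ∀ a, t ≤ colHt m n a → colOp a a w = x a • w
  weight : ∀ (i : Fin d) (a : Fin m), (i : ℕ) < t → (a : ℕ) = i → x (.inl a) = l i

/-- The new vector is the last nonzero D^N w, where D is the even derivation at the corner cell.
Maximality of N kills the rest of the corner row and column, and N is the weight of both. -/
theorem Peeled.step {l : Fin d → ℕ} {x : Fin m ⊕ Fin n → ℂ} {t : ℕ} {w : HoweSpace d m n}
    (h : Peeled l x t w) (htd : t < d) (htm : t < m) : ∃ w', Peeled l x (t + 1) w' := by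
  classical
  set r : Fin d := ⟨t, htd⟩ with hr
  set a₀ : Fin m ⊕ Fin n := .inl ⟨t, htm⟩ with ha₀
  have hta₀ : colHt m n a₀ = t := rfl
  have hpar : par a₀ = 0 := rfl
  set D : Module.End ℂ (HoweSpace d m n) := der (cell r a₀) with hD
  have hDder : ∀ i a, Commute D (der (cell i a)) := by
    intro i a
    have := der_mul_der (cell r a₀) (cell i a)
    rwa [par_cell, hpar, sgn_zero_left, one_smul] at this
  have hex : ∃ N, (D ^ N) w = 0 := exists_der_pow_eq_zero _ w
  obtain ⟨N, hN⟩ : ∃ N, Nat.find hex = N + 1 := by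
    refine Nat.exists_eq_succ_of_ne_zero fun h0 => h.ne_zero ?_
    have := Nat.find_spec hex
    rwa [h0, pow_zero, Module.End.one_apply] at this
  have hN1 : (D ^ (N + 1)) w = 0 := hN ▸ Nat.find_spec hex
  have hN0 : (D ^ N) w ≠ 0 := Nat.find_min hex (by omega)
  set w' := (D ^ N) w with hw'
  have hcN : ∀ {X : Module.End ℂ (HoweSpace d m n)}, Commute D X → X w' = (D ^ N) (X w) := by
    intro X hX
    exact (LinearMap.congr_fun (hX.pow_left N).eq w).symm
  -- Apply D^(N+1) X to `w`. Both this and X D^(N+1) w vanish, and the remaining commutator term is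
  -- (N+1) Y w'.
  have hkill : ∀ {X Y : Module.End ℂ (HoweSpace d m n)}, D * X = X * D + Y → Commute D Y → X w = 0 →
      Y w' = 0 := by
    intro X Y hXY hDY hX
    have h1 := LinearMap.congr_fun (pow_succ_mul_of_commutator hXY hDY N) w
    rw [Module.End.mul_apply, hX, map_zero, LinearMap.add_apply, Module.End.mul_apply, hN1, map_zero,
      zero_add, LinearMap.smul_apply, Module.End.mul_apply, ← hcN hDY,
      ← Nat.cast_smul_eq_nsmul ℂ] at h1
    exact (smul_eq_zero.1 h1.symm).resolve_left (by exact_mod_cast Nat.succ_ne_zero N)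
  have hDrow : ∀ i j, D * rowOp i j = rowOp i j * D + if r = i then der (cell j a₀) else 0 :=
    fun i j => der_mul_rowOp i j r a₀
  have hDcol : ∀ a b, D * colOp a b = colOp a b * D + if a₀ = a then der (cell r b) else 0 := by
    intro a b
    have := der_mul_colOp a b a₀ r
    rwa [hpar, sgn_comm, sgn_zero_left, one_smul] at this
  have hderD : D w' = 0 := by
    rw [hw', ← Module.End.mul_apply, ← pow_succ', hN1]
  have hderCol : ∀ i, der (cell i a₀) w' = 0 := by
    intro i
    rcases lt_trichotomy (i : ℕ) t with hi | hi | hi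
    · rw [hcN (hDder i a₀), h.der_row i a₀ hi, map_zero]
    · have : i = r := Fin.ext hi
      rw [this]; exact hderD
    -- The commutator of D with a raising operator of row `r` is the derivation at another cell of
    -- the corner column; the row below is treated likewise with `colOp`.
    · refine hkill (X := rowOp r i) ?_ (hDder i a₀) (h.row r i le_rfl hi)
      rw [hDrow, if_pos rfl]
  have hderRow : ∀ a, der (cell r a) w' = 0 := by
    intro a
    rcases lt_trichotomy (colHt m n a) t with ha | ha | ha
    · rw [hcN (hDder r a), h.der_col r a ha, map_zero]
    · have : a = a₀ := colHt_injective (ha.trans hta₀.symm)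
      rw [this]; exact hderD
    · refine hkill (X := colOp a₀ a) ?_ (hDder r a) (h.col a₀ a le_rfl (hta₀ ▸ ha))
      rw [hDcol, if_pos rfl]
  -- For a number operator X containing the corner, each D lowers the eigenvalue by one. As X kills
  -- `w'`, the eigenvalue on `w` was N.
  have hval : ∀ {X : Module.End ℂ (HoweSpace d m n)} {s : ℂ}, D * X = X * D + D → X w = s • w →
      X w' = 0 → s = N := by
    intro X s hX hs h0
    have h2 : (D ^ N) (X w) = (N : ℂ) • w' := by
      rcases N with _ | N
      · rw [hw', pow_zero, Module.End.one_apply] at h0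
        simp [h0]
      · have h1 := LinearMap.congr_fun (pow_succ_mul_of_commutator hX (Commute.refl D) N) w
        rw [Module.End.mul_apply, LinearMap.add_apply, Module.End.mul_apply, ← hw', h0, zero_add,
          LinearMap.smul_apply, ← pow_succ, ← hw', ← Nat.cast_smul_eq_nsmul ℂ] at h1
        exact h1
    rw [hs, map_smul, ← hw'] at h2
    exact smul_left_injective ℂ hN0 h2
  have hcomm_row : ∀ i j, r ≠ i → Commute D (rowOp i j) := by
    intro i j hi
    have := hDrow i j
    rwa [if_neg hi, add_zero] at this
  have hcomm_col : ∀ a b, a₀ ≠ a → Commute D (colOp a b) := by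
    intro a b ha
    have := hDcol a b
    rwa [if_neg ha, add_zero] at this
  have hrow_ne : ∀ i : Fin d, t + 1 ≤ (i : ℕ) → r ≠ i := by
    rintro i hi rfl
    exact absurd hi (by simp [hr])
  have hcol_ne : ∀ a, t + 1 ≤ colHt m n a → a₀ ≠ a := by
    rintro a hi rfl
    omega
  refine ⟨w', hN0, ?_, ?_, ?_, ?_, ?_, ?_, ?_⟩
  · intro i a hi
    rcases Nat.lt_succ_iff_lt_or_eq.1 hi with hi | hi
    · rw [hcN (hDder i a), h.der_row i a hi, map_zero]
    · have : i = r := Fin.ext hi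
      rw [this]; exact hderRow a
  · intro i a ha
    rcases Nat.lt_succ_iff_lt_or_eq.1 ha with ha | ha
    · rw [hcN (hDder i a), h.der_col i a ha, map_zero]
    · have : a = a₀ := colHt_injective (ha.trans hta₀.symm)
      rw [this]; exact hderCol i
  · intro i j hi hij
    rw [hcN (hcomm_row i j (hrow_ne i hi)), h.row i j (by omega) hij, map_zero]
  · intro i hi
    rw [hcN (hcomm_row i i (hrow_ne i hi)), h.row_self i (by omega), map_smul]
  · intro a b ha hab
    rw [hcN (hcomm_col a b (hcol_ne a ha)), h.col a b (by omega) hab, map_zero]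
  · intro a ha
    rw [hcN (hcomm_col a a (hcol_ne a ha)), h.col_self a (by omega), map_smul]
  · intro i a hi hai
    rcases Nat.lt_succ_iff_lt_or_eq.1 hi with hi | hi
    · exact h.weight i a hi hai
    · have hir : i = r := Fin.ext hi
      have haa : (.inl a : Fin m ⊕ Fin n) = a₀ := by rw [ha₀]; congr 1; exact Fin.ext (hai.trans hi)
      have h1 : (l r : ℂ) = N := by
        refine hval (X := rowOp r r) (by rw [hDrow, if_pos rfl]) (h.row_self r le_rfl) ?_
        rw [rowOp, LinearMap.sum_apply]
        exact Finset.sum_eq_zero fun a _ => by rw [Module.End.mul_apply, hderRow, map_zero]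
      have h2 : x a₀ = N := by
        refine hval (X := colOp a₀ a₀) (by rw [hDcol, if_pos rfl]) (h.col_self a₀ le_rfl) ?_
        rw [colOp, LinearMap.sum_apply]
        exact Finset.sum_eq_zero fun i _ => by rw [Module.End.mul_apply, hderCol, map_zero]
      rw [hir, haa, h1, h2]

theorem exists_peeled {l : Fin d → ℕ} {x : Fin m ⊕ Fin n → ℂ} {v : HoweSpace d m n} (hv0 : v ≠ 0)
    (hrow : IsSingular (rowE d) (fun i => i) (fun i => (l i : ℂ)) v)
    (hcol : IsSingular (colE m n) (colHt m n) x v) (t : ℕ) (htd : t ≤ d) (htm : t ≤ m) :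
    ∃ w, Peeled l x t w := by
  rw [isSingular_rowE] at hrow
  rw [isSingular_colE] at hcol
  induction t with
  | zero =>
    exact ⟨v, hv0, by simp, by simp, fun i j _ hij => hrow.1 i j hij, fun i _ => hrow.2 i,
      fun a b _ hab => hcol.1 a b hab, fun a _ => hcol.2 a, by simp⟩
  | succ t ih =>
    obtain ⟨w, hw⟩ := ih (by omega) (by omega)
    exact hw.step (by omega) (by omega)

end Peel

/-! ### Monomials in the odd generators -/

section Monomial

variable {α β : Type} [Fintype α] [Fintype β] [DecidableEq α] [DecidableEq β]

theorem eq_zero_of_eq_neg {M : Type} [AddCommGroup M] [Module ℂ M] {x : M} (h : x = -x) : x = 0 := by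
  have h2 : (2 : ℂ) • x = 0 := by
    rw [two_smul]
    exact add_eq_zero_iff_eq_neg.2 h
  exact (smul_eq_zero.1 h2).resolve_left two_ne_zero

theorem sgn_one_one : sgn 1 1 = -1 := by simp [sgn, ZMod.val_one]

/-- `u` is the product of the odd generators in `Y`. -/
structure IsOddMonomial (Y : Finset (α ⊕ β)) (u : SuperSym α β) : Prop where
  odd : ∀ x ∈ Y, par x = 1
  ne_zero : u ≠ 0
  gen_eq : ∀ x ∈ Y, gen x u = 0
  der_eq : ∀ x, x ∉ Y → der x u = 0

theorem exists_isOddMonomial (Y : Finset (α ⊕ β)) (hY : ∀ x ∈ Y, par x = 1) :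
    ∃ u, IsOddMonomial Y u := by
  induction Y using Finset.induction_on with
  | empty => exact ⟨vac α β, by simp, vac_ne_zero, by simp, fun x _ => der_zero x vac_mem⟩
  | insert x Y hx ih =>
    obtain ⟨u, hu⟩ := ih fun y hy => hY y (Finset.mem_insert_of_mem hy)
    have hpx : par x = 1 := hY x (Finset.mem_insert_self x Y)
    have hdx : der x (gen x u) = u := by
      have := LinearMap.congr_fun (der_mul_gen x x) u
      simpa [hu.der_eq x hx] using this
    refine ⟨gen x u, hY, fun h0 => hu.ne_zero ?_, fun y hy => ?_, fun y hy => ?_⟩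
    · rw [← hdx, h0, map_zero]
    · have h1 := LinearMap.congr_fun (gen_mul_gen y x) u
      simp only [Module.End.mul_apply, LinearMap.smul_apply] at h1
      rcases Finset.mem_insert.1 hy with rfl | hy
      · rw [hpx, sgn_one_one, neg_smul, one_smul] at h1
        exact eq_zero_of_eq_neg h1
      · rw [h1, hu.gen_eq y hy, map_zero, smul_zero]
    · rw [Finset.mem_insert, not_or] at hy
      have h1 := LinearMap.congr_fun (der_mul_gen y x) u
      simpa [hy.1, hu.der_eq y hy.2] using h1

variable {Y : Finset (α ⊕ β)} {u : SuperSym α β}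

/-- The operator replaces the factor `y` by `x`. If `x` is already a factor, an odd generator would
be squared. -/
theorem IsOddMonomial.gen_der (hu : IsOddMonomial Y u) {x y : α ⊕ β} (hxy : x ≠ y)
    (h : y ∈ Y → x ∈ Y) : gen x (der y u) = 0 := by
  by_cases hy : y ∈ Y
  · have h1 := LinearMap.congr_fun (der_mul_gen y x) u
    simp only [Module.End.mul_apply, LinearMap.add_apply, LinearMap.smul_apply, if_neg hxy.symm,
      hu.gen_eq x (h hy), map_zero, LinearMap.zero_apply, add_zero] at h1
    have h2 := congrArg (fun z => sgn (par y) (par x) • z) h1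
    simpa [smul_smul, sgn_mul_self] using h2.symm
  · rw [hu.der_eq y hy, map_zero]

theorem IsOddMonomial.gen_der_self (hu : IsOddMonomial Y u) (x : α ⊕ β) :
    gen x (der x u) = if x ∈ Y then u else 0 := by
  split_ifs with hx
  · have h1 := LinearMap.congr_fun (der_mul_gen x x) u
    simp only [Module.End.mul_apply, LinearMap.add_apply, LinearMap.smul_apply, if_true,
      hu.gen_eq x hx, map_zero, hu.odd x hx, sgn_one_one, Module.End.one_apply, neg_smul,
      one_smul] at h1
    rw [LinearMap.neg_apply, Module.End.mul_apply, eq_comm, neg_add_eq_zero] at h1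
    exact h1
  · rw [hu.der_eq x hx, map_zero]

/-- The eigenvalues of a number operator of odd generators are at most the number of generators. -/
theorem exists_le_of_odd_number (s : Finset (α ⊕ β)) (hs : ∀ x ∈ s, par x = 1) {c : ℂ}
    {v : SuperSym α β} (hv : v ≠ 0) (h : ∑ y ∈ s, gen y (der y v) = c • v) :
    ∃ r : ℕ, r ≤ s.card ∧ c = r := by
  induction hk : s.card generalizing s c v with
  | zero =>
    rw [Finset.card_eq_zero] at hk
    subst hk
    refine ⟨0, le_rfl, ?_⟩
    simpa [hv] using h.symm
  | succ k ih =>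
    by_cases hd : ∀ y ∈ s, der y v = 0
    · refine ⟨0, Nat.zero_le _, ?_⟩
      rw [Finset.sum_eq_zero fun y hy => by rw [hd y hy, map_zero]] at h
      simpa [hv] using h.symm
    · push Not at hd
      obtain ⟨x, hx, hxv⟩ := hd
      have h1 := der_sum_gen_der s hx v
      rw [h, map_smul, ← Finset.add_sum_erase s _ hx] at h1
      -- An odd derivation squares to zero, so `x` can be removed from `s` for the vector `der x v`.
      -- This is what bounds the eigenvalue by the number of generators.
      have h2 : der x (der x v) = 0 := by
        have h3 := LinearMap.congr_fun (der_mul_der x x) v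
        simp only [Module.End.mul_apply, LinearMap.smul_apply, hs x hx, sgn_one_one, neg_smul,
          one_smul] at h3
        exact eq_zero_of_eq_neg h3
      rw [h2, map_zero, zero_add] at h1
      obtain ⟨r, hr, hrc⟩ := ih (s.erase x) (fun y hy => hs y (Finset.mem_of_mem_erase hy))
        (c := c - 1) hxv (by rw [sub_smul, one_smul, h1]; abel)
        (by rw [Finset.card_erase_of_mem hx, hk, Nat.add_sub_cancel])
      exact ⟨r + 1, by omega, by push_cast; linear_combination hrc⟩

end Monomial

/-! ### The weight of a joint singular vector -/

section JointWeight

variable {d m n : ℕ}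

/-- The odd cells satisfying a predicate. -/
def oddCells (P : Fin d → Fin n → Prop) [∀ i b, Decidable (P i b)] :
    Finset ((Fin d × Fin m) ⊕ (Fin d × Fin n)) :=
  (Finset.univ.filter fun p : Fin d × Fin n => P p.1 p.2).map Function.Embedding.inr

theorem mem_oddCells_inr {P : Fin d → Fin n → Prop} [∀ i b, Decidable (P i b)] {i : Fin d}
    {b : Fin n} : cell i (.inr b : Fin m ⊕ Fin n) ∈ oddCells (m := m) P ↔ P i b := by
  change (Sum.inr (i, b) : (Fin d × Fin m) ⊕ (Fin d × Fin n)) ∈ _ ↔ _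
  simp [oddCells]

theorem mem_oddCells_inl {P : Fin d → Fin n → Prop} [∀ i b, Decidable (P i b)] {i : Fin d}
    {a : Fin m} : cell i (.inl a : Fin m ⊕ Fin n) ∉ oddCells (m := m) P := by
  change (Sum.inl (i, a) : (Fin d × Fin m) ⊕ (Fin d × Fin n)) ∉ _
  simp [oddCells]

theorem par_of_mem_oddCells {P : Fin d → Fin n → Prop} [∀ i b, Decidable (P i b)]
    {x : (Fin d × Fin m) ⊕ (Fin d × Fin n)} (hx : x ∈ oddCells P) : par x = 1 := by
  simp only [oddCells, Finset.mem_map, Function.Embedding.inr_apply] at hx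
  obtain ⟨p, -, rfl⟩ := hx
  rfl

variable {P : Fin d → Fin n → Prop} [∀ i b, Decidable (P i b)] {u : HoweSpace d m n}

/-- The operator moves a cell from row `j` to the same column of row `i`, and by hypothesis the
target is occupied. -/
theorem rowOp_oddMonomial (hu : IsOddMonomial (oddCells P) u) {i j : Fin d} (hij : i ≠ j)
    (h : ∀ b, P j b → P i b) : rowOp i j u = 0 := by
  rw [rowOp, LinearMap.sum_apply]
  refine Finset.sum_eq_zero fun a _ => hu.gen_der (fun h0 => hij (cell_inj.1 h0).1) ?_
  rcases a with a | b
  · exact fun h0 => absurd h0 mem_oddCells_inl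
  · exact fun h0 => mem_oddCells_inr.2 (h b (mem_oddCells_inr.1 h0))

theorem colOp_oddMonomial (hu : IsOddMonomial (oddCells P) u) {a b : Fin n} (hab : a ≠ b)
    (h : ∀ i, P i b → P i a) : colOp (.inr a) (.inr b) u = 0 := by
  rw [colOp, LinearMap.sum_apply]
  refine Finset.sum_eq_zero fun i _ => hu.gen_der
    (fun h0 => hab (Sum.inr_injective (cell_inj.1 h0).2)) ?_
  exact fun h0 => mem_oddCells_inr.2 (h i (mem_oddCells_inr.1 h0))

theorem rowOp_self_oddMonomial (hu : IsOddMonomial (oddCells P) u) (i : Fin d) :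
    rowOp i i u = ((Finset.univ.filter (P i)).card : ℂ) • u := by
  rw [rowOp, LinearMap.sum_apply]
  simp only [Module.End.mul_apply, hu.gen_der_self, Fintype.sum_sum_type, mem_oddCells_inl,
    mem_oddCells_inr, if_false, Finset.sum_const_zero, zero_add]
  rw [← Finset.sum_filter, Finset.sum_const, Nat.cast_smul_eq_nsmul]

theorem colOp_self_oddMonomial (hu : IsOddMonomial (oddCells P) u) (b : Fin n) :
    colOp (.inr b) (.inr b) u = ((Finset.univ.filter fun i => P i b).card : ℂ) • u := by
  rw [colOp, LinearMap.sum_apply]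
  simp only [Module.End.mul_apply, hu.gen_der_self, mem_oddCells_inr]
  rw [← Finset.sum_filter, Finset.sum_const, Nat.cast_smul_eq_nsmul]

theorem rowOp_eq_zero_of_der {w : HoweSpace d m n} {i j : Fin d}
    (h : ∀ a, der (cell j a) w = 0) : rowOp i j w = 0 := by
  rw [rowOp, LinearMap.sum_apply]
  exact Finset.sum_eq_zero fun a _ => by rw [Module.End.mul_apply, h, map_zero]

theorem colOp_eq_zero_of_der {w : HoweSpace d m n} {a b : Fin m ⊕ Fin n}
    (h : ∀ i, der (cell i b) w = 0) : colOp a b w = 0 := by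
  rw [colOp, LinearMap.sum_apply]
  exact Finset.sum_eq_zero fun a _ => by rw [Module.End.mul_apply, h, map_zero]

theorem card_filter_lt_min (r : ℕ) :
    (Finset.univ.filter fun b : Fin n => (b : ℕ) < r).card = min r n := by
  rw [Fin.card_filter_val_lt, min_comm]

/-- The weights of a joint singular vector. -/
theorem joint_weight {l : Fin d → ℕ} (hl : ∀ i j, i ≤ j → l j ≤ l i) {x : Fin m ⊕ Fin n → ℂ}
    {v : HoweSpace d m n} (hv0 : v ≠ 0)
    (hrow : IsSingular (rowE d) (fun i => i) (fun i => (l i : ℂ)) v)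
    (hcol : IsSingular (colE m n) (colHt m n) x v) :
    (∀ i : Fin d, m ≤ (i : ℕ) → l i ≤ n) ∧
      (∀ a : Fin m, x (.inl a) = if h : (a : ℕ) < d then (l ⟨a, h⟩ : ℂ) else 0) ∧
      ∀ b : Fin n, x (.inr b)
        = ((Finset.univ.filter fun i : Fin d => m ≤ (i : ℕ) ∧ (b : ℕ) < l i).card : ℂ) := by
  rcases le_or_gt d m with hdm | hmd
  -- With all rows peeled off, every derivation kills `w`, and the remaining column weights vanish.
  · obtain ⟨w, hw⟩ := exists_peeled hv0 hrow hcol d le_rfl hdm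
    have hx : ∀ a, d ≤ colHt m n a → x a = 0 := by
      intro a ha
      have h1 := hw.col_self a ha
      rw [colOp_eq_zero_of_der fun i => hw.der_row i a i.2] at h1
      exact (smul_eq_zero.1 h1.symm).resolve_right hw.ne_zero
    refine ⟨fun i hi => absurd i.2 (by omega), fun a => ?_, fun b => ?_⟩
    · split_ifs with h
      · exact hw.weight ⟨a, h⟩ a h rfl
      · exact hx _ (by simpa [colHt] using h)
    · rw [hx _ (by simp [colHt]; omega), Finset.filter_false_of_mem]
      · simp
      · intro i _
        have := i.2
        omega
  -- With all even columns peeled off, only odd variables in the rows from `m` on remain. Each row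
  -- has `n` of them, which forces the hook condition.
  · obtain ⟨w, hw⟩ := exists_peeled hv0 hrow hcol m hmd.le le_rfl
    have hdl : ∀ (i : Fin d) (a : Fin m), der (cell i (.inl a)) w = 0 := fun i a =>
      hw.der_col i (.inl a) a.2
    have hn : ∀ i : Fin d, m ≤ (i : ℕ) → l i ≤ n := by
      intro i hi
      have h1 := hw.row_self i hi
      rw [rowOp, LinearMap.sum_apply, Fintype.sum_sum_type,
        Finset.sum_eq_zero (fun a _ => by rw [Module.End.mul_apply, hdl, map_zero]), zero_add] at h1
      let s : Finset ((Fin d × Fin m) ⊕ (Fin d × Fin n)) :=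
        Finset.univ.image fun b : Fin n => cell i (.inr b)
      have hinj : ∀ b b' : Fin n, cell i (.inr b : Fin m ⊕ Fin n) = cell i (.inr b') → b = b' :=
        fun b b' h => Sum.inr_injective (cell_inj.1 h).2
      obtain ⟨r, hr, hrl⟩ := exists_le_of_odd_number s (c := (l i : ℂ)) (by
        intro y hy
        obtain ⟨b, -, rfl⟩ := Finset.mem_image.1 hy
        rw [par_cell]; rfl) hw.ne_zero (by
        rw [← h1, Finset.sum_image fun b _ b' _ h => hinj b b' h]
        rfl)
      have : l i = r := by exact_mod_cast hrl
      rw [this]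
      exact hr.trans (Finset.card_image_le.trans (by simp))
    refine ⟨hn, fun a => ?_, ?_⟩
    · rw [dif_pos (a.2.trans hmd)]
      exact hw.weight ⟨a, a.2.trans hmd⟩ a a.2 rfl
    -- Compare with the monomial of the shape formed by the remaining rows.
    let P : Fin d → Fin n → Prop := fun i b => m ≤ (i : ℕ) ∧ (b : ℕ) < l i
    obtain ⟨u, hu⟩ := exists_isOddMonomial (oddCells (m := m) P) fun x => par_of_mem_oddCells
    -- The peeled rows are moved to the end of the order, and by `c'` the even columns too.
    -- Derivations in them kill both `w` and `u`, so both vectors are singular for these reordered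
    -- Borel subalgebras.
    let c : Fin d → ℕ := fun i => if (i : ℕ) < m then d + i else i
    have hc : Function.Injective c := by
      intro i j hij
      have := i.2
      have := j.2
      apply Fin.ext
      simp only [c] at hij
      split_ifs at hij <;> omega
    let c' : Fin m ⊕ Fin n → ℕ := Sum.elim (fun a => n + a) (fun b => b)
    have hc' : Function.Injective c' := by
      rintro (a | a) (b | b) h <;> simp only [c', Sum.elim_inl, Sum.elim_inr] at h
      · rw [Fin.ext (Nat.add_left_cancel h)]
      · have := b.2; omega
      · have := a.2; omega
      · rw [Fin.ext h]
    let l' : Fin d → ℕ := fun i => if (i : ℕ) < m then 0 else l i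
    have hwrow : IsSingular (rowE d) c (fun i => (l' i : ℂ)) w := by
      rw [isSingular_rowE]
      refine ⟨fun i j hij => ?_, fun i => ?_⟩
      · by_cases hj : (j : ℕ) < m
        · exact rowOp_eq_zero_of_der fun a => hw.der_row j a hj
        · have hi : ¬ (i : ℕ) < m := by
            intro hi
            simp only [c, hi, hj, if_true, if_false] at hij
            have := j.2
            omega
          simp only [c, hi, hj, if_false] at hij
          exact hw.row i j (by omega) hij
      · by_cases hi : (i : ℕ) < m
        · simp only [l', hi, if_true]
          rw [rowOp_eq_zero_of_der fun a => hw.der_row i a hi]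
          simp
        · simp only [l', hi, if_false]
          exact hw.row_self i (by omega)
    have hurow : IsSingular (rowE d) c (fun i => (l' i : ℂ)) u := by
      rw [isSingular_rowE]
      refine ⟨fun i j hij => ?_, fun i => ?_⟩
      · refine rowOp_oddMonomial hu (fun h0 => absurd hij (by rw [h0]; exact lt_irrefl _)) ?_
        rintro b ⟨hj, hb⟩
        have hi : ¬ (i : ℕ) < m := by
          intro hi
          simp only [c, hi, show ¬ (j : ℕ) < m by omega, if_true, if_false] at hij
          have := j.2
          omega
        simp only [c, hi, show ¬ (j : ℕ) < m by omega, if_false] at hij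
        exact ⟨by omega, hb.trans_le (hl i j (le_of_lt hij))⟩
      · rw [rowOp_self_oddMonomial hu]
        congr 2
        by_cases hi : (i : ℕ) < m
        · simp only [l', hi, if_true, P, show ¬ m ≤ (i : ℕ) by omega, false_and]
          simp
        · simp only [l', hi, if_false, P, show m ≤ (i : ℕ) by omega, true_and]
          rw [card_filter_lt_min, min_eq_left (hn i (by omega))]
    have hwcol : IsSingular (colE m n) c' (Sum.elim (fun _ => 0) fun b => x (.inr b)) w := by
      rw [isSingular_colE]
      refine ⟨?_, ?_⟩
      · rintro a (b | b) hab
        · exact colOp_eq_zero_of_der fun i => hdl i b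
        · rcases a with a | a
          · simp only [c', Sum.elim_inl, Sum.elim_inr] at hab
            have := b.2
            omega
          · refine hw.col _ _ (by simp [colHt]) ?_
            simpa [c', colHt] using hab
      · rintro (a | a)
        · rw [colOp_eq_zero_of_der fun i => hdl i a]; simp
        · exact hw.col_self _ (by simp [colHt])
    have hucol : IsSingular (colE m n) c' (Sum.elim (fun _ => 0) fun b : Fin n =>
        ((Finset.univ.filter fun i => P i b).card : ℂ)) u := by
      rw [isSingular_colE]
      refine ⟨?_, ?_⟩
      · rintro a (b | b) hab
        · exact colOp_eq_zero_of_der fun i => hu.der_eq _ mem_oddCells_inl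
        · rcases a with a | a
          · simp only [c', Sum.elim_inl, Sum.elim_inr] at hab
            have := b.2
            omega
          · simp only [c', Sum.elim_inr] at hab
            refine colOp_oddMonomial hu (fun h0 => absurd hab (by rw [h0]; exact lt_irrefl _)) ?_
            rintro i ⟨hi, hb⟩
            exact ⟨hi, hab.trans hb⟩
      · rintro (a | a)
        · rw [colOp_eq_zero_of_der fun i => hu.der_eq _ mem_oddCells_inl]; simp
        · exact colOp_self_oddMonomial hu a
    -- Equal gl(d)-weights make the two vectors generate each other over gl(m|n). Singular for the
    -- same order `c'`, they then have equal gl(m|n)-weights, and that of `u` is explicit.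
    obtain ⟨z, hz⟩ := exists_col_smul_eq hc hwrow hurow hw.ne_zero hu.ne_zero
    obtain ⟨z', hz'⟩ := exists_col_smul_eq hc hurow hwrow hu.ne_zero hw.ne_zero
    have h := matrixUnits_colE.weight_eq hc' hwcol hucol hw.ne_zero hu.ne_zero hz hz'
    exact fun b => congrFun h (.inr b)

end JointWeight

/-! ### Multiplication by minors -/

section Minor

variable {α β : Type} [Fintype α] [Fintype β] [DecidableEq α] [DecidableEq β]

/-- Multiplication by a polynomial in the even generators. -/
def mulPoly (p : MvPolynomial α ℂ) : Module.End ℂ (SuperSym α β) :=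
  (ofTensor α β).conj ((LinearMap.mulLeft ℂ p).rTensor _)

theorem mulPoly_ofTensor (p f : MvPolynomial α ℂ) (w : ExteriorAlgebra ℂ (β → ℂ)) :
    mulPoly p (ofTensor α β (f ⊗ₜ w)) = ofTensor α β ((p * f) ⊗ₜ w) := by
  simp [mulPoly, LinearEquiv.conj_apply]

theorem mulPoly_zero : mulPoly 0 = (0 : Module.End ℂ (SuperSym α β)) :=
  superSym_ext fun f w => by simp [mulPoly_ofTensor]

theorem mulPoly_sum {ι : Type} (s : Finset ι) (p : ι → MvPolynomial α ℂ) :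
    mulPoly (∑ i ∈ s, p i) = (∑ i ∈ s, mulPoly (p i) : Module.End ℂ (SuperSym α β)) :=
  superSym_ext fun f w => by
    simp only [mulPoly_ofTensor, LinearMap.sum_apply, Finset.sum_mul, TensorProduct.sum_tmul, map_sum]

theorem mulPoly_injective {p : MvPolynomial α ℂ} (hp : p ≠ 0) :
    Function.Injective (mulPoly p : Module.End ℂ (SuperSym α β)) := by
  have h : Function.Injective ((LinearMap.mulLeft ℂ p).rTensor (ExteriorAlgebra ℂ (β → ℂ))) :=
    Module.Flat.rTensor_preserves_injective_linearMap _ (mul_right_injective₀ hp)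
  rw [mulPoly, LinearEquiv.conj_apply]
  exact (ofTensor α β).injective.comp (h.comp (ofTensor α β).symm.injective)

theorem gen_mul_mulPoly (x : α ⊕ β) (p : MvPolynomial α ℂ) :
    gen x * mulPoly p = mulPoly p * gen x := by
  rcases x with a | b <;> refine superSym_ext fun f w => ?_
  · simp [mulPoly_ofTensor, gen_inl, mul_left_comm]
  · simp [mulPoly_ofTensor, gen_inr]

theorem gen_inl_mul_mulPoly (a : α) (p : MvPolynomial α ℂ) :
    gen (.inl a) * mulPoly p = (mulPoly (MvPolynomial.X a * p) : Module.End ℂ (SuperSym α β)) :=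
  superSym_ext fun f w => by simp [mulPoly_ofTensor, gen_inl, mul_assoc]

theorem der_inl_mul_mulPoly (a : α) (p : MvPolynomial α ℂ) :
    der (.inl a) * mulPoly p = (mulPoly p * der (.inl a) + mulPoly (MvPolynomial.pderiv a p) :
      Module.End ℂ (SuperSym α β)) :=
  superSym_ext fun f w => by
    simp [mulPoly_ofTensor, der_inl, TensorProduct.add_tmul, mul_comm (MvPolynomial.pderiv a p)]

theorem der_inr_mul_mulPoly (b : β) (p : MvPolynomial α ℂ) :
    der (.inr b) * mulPoly p = (mulPoly p * der (.inr b) : Module.End ℂ (SuperSym α β)) :=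
  superSym_ext fun f w => by simp [mulPoly_ofTensor, der_inr]

variable {d m n : ℕ}

/-- The polarization derivation of the even polynomials. -/
def polar (i j : Fin d) :
    Derivation ℂ (MvPolynomial (Fin d × Fin m) ℂ) (MvPolynomial (Fin d × Fin m) ℂ) :=
  ∑ a, (MvPolynomial.X (i, a) : MvPolynomial (Fin d × Fin m) ℂ) • MvPolynomial.pderiv (j, a)

theorem polar_apply (i j : Fin d) (p : MvPolynomial (Fin d × Fin m) ℂ) :
    polar i j p = ∑ a, MvPolynomial.X (i, a) * MvPolynomial.pderiv (j, a) p := by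
  rw [polar, ← Derivation.coeFnAddMonoidHom_apply, map_sum, Finset.sum_apply]
  rfl

theorem polar_X (i j k : Fin d) (a : Fin m) :
    polar i j (MvPolynomial.X (k, a)) = if k = j then MvPolynomial.X (i, a) else 0 := by
  rw [polar_apply]
  simp only [MvPolynomial.pderiv_X, Pi.single_apply, Prod.mk.injEq, mul_ite, mul_one, mul_zero]
  by_cases h : k = j <;> simp [h]

/-- Multiplying a singular vector by a polynomial that is singular for the polarizations gives a
singular vector or zero, and weights add. -/
theorem rowOp_mulPoly (i j : Fin d) (p : MvPolynomial (Fin d × Fin m) ℂ) (v : HoweSpace d m n) :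
    rowOp i j (mulPoly p v) = mulPoly p (rowOp i j v) + mulPoly (polar i j p) v := by
  have h : (rowOp i j * mulPoly p : Module.End ℂ (HoweSpace d m n))
      = mulPoly p * rowOp i j + mulPoly (polar i j p) := by
    have hl : ∀ a : Fin m, (gen (cell i (.inl a)) * der (cell j (.inl a)) * mulPoly p :
        Module.End ℂ (HoweSpace d m n))
        = mulPoly p * (gen (cell i (.inl a)) * der (cell j (.inl a)))
          + mulPoly (MvPolynomial.X (i, a) * MvPolynomial.pderiv (j, a) p) := by
      intro a
      change gen (.inl (i, a)) * der (.inl (j, a)) * mulPoly p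
        = mulPoly p * (gen (.inl (i, a)) * der (.inl (j, a))) + _
      rw [mul_assoc, der_inl_mul_mulPoly, mul_add, gen_inl_mul_mulPoly, ← mul_assoc, gen_mul_mulPoly,
        mul_assoc]
    have hr : ∀ b : Fin n, (gen (cell i (.inr b)) * der (cell j (.inr b)) * mulPoly p :
        Module.End ℂ (HoweSpace d m n))
        = mulPoly p * (gen (cell i (.inr b)) * der (cell j (.inr b))) := by
      intro b
      change gen (.inr (i, b)) * der (.inr (j, b)) * mulPoly p
        = mulPoly p * (gen (.inr (i, b)) * der (.inr (j, b)))
      rw [mul_assoc, der_inr_mul_mulPoly, ← mul_assoc, gen_mul_mulPoly, mul_assoc]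
    rw [rowOp, Finset.sum_mul, Finset.mul_sum, Fintype.sum_sum_type, Fintype.sum_sum_type]
    simp only [hl, hr, Finset.sum_add_distrib]
    rw [polar_apply, mulPoly_sum]
    abel
  exact LinearMap.congr_fun h v

/-- The graph of the polarization derivation, an algebra homomorphism to the dual numbers. -/
def polarHom (i j : Fin d) : MvPolynomial (Fin d × Fin m) ℂ →ₐ[ℂ]
    TrivSqZeroExt (MvPolynomial (Fin d × Fin m) ℂ) (MvPolynomial (Fin d × Fin m) ℂ) :=
  MvPolynomial.aeval fun x =>
    TrivSqZeroExt.inl (MvPolynomial.X x) + TrivSqZeroExt.inr (polar i j (MvPolynomial.X x))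

/-- The Leibniz rule says that p ↦ p + ε·polar p is multiplicative. A polarized determinant thus
becomes the determinant of a matrix modified by a row operation over the dual numbers. -/
theorem polarHom_apply (i j : Fin d) (p : MvPolynomial (Fin d × Fin m) ℂ) :
    polarHom i j p = TrivSqZeroExt.inl p + TrivSqZeroExt.inr (polar i j p) := by
  induction p using MvPolynomial.induction_on with
  | C c =>
    have : MvPolynomial.C c = algebraMap ℂ (MvPolynomial (Fin d × Fin m) ℂ) c := rfl
    rw [this, AlgHom.commutes, Derivation.map_algebraMap, TrivSqZeroExt.inr_zero, add_zero]
    rfl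
  | add p q hp hq =>
    rw [map_add, hp, hq, map_add]
    ext <;> simp
  | mul_X p x hp =>
    rw [map_mul, hp, Derivation.leibniz]
    have : polarHom i j (MvPolynomial.X x)
        = TrivSqZeroExt.inl (MvPolynomial.X x) + TrivSqZeroExt.inr (polar i j (MvPolynomial.X x)) :=
      MvPolynomial.aeval_X _ _
    rw [this]
    ext <;> simp [TrivSqZeroExt.fst_mul, TrivSqZeroExt.snd_mul, mul_comm]

variable {r : ℕ}

/-- The upper left block of the generic matrix. -/
def genericBlock (hd : r ≤ d) (hm : r ≤ m) :
    Matrix (Fin r) (Fin r) (MvPolynomial (Fin d × Fin m) ℂ) :=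
  Matrix.of fun s t => MvPolynomial.X (Fin.castLE hd s, Fin.castLE hm t)

theorem det_genericBlock_ne_zero (hd : r ≤ d) (hm : r ≤ m) : (genericBlock hd hm).det ≠ 0 := by
  intro h
  have h1 := congrArg (MvPolynomial.aeval (R := ℂ) (S₁ := ℂ) fun x : Fin d × Fin m =>
    if (x.1 : ℕ) = x.2 then (1 : ℂ) else 0) h
  rw [AlgHom.map_det, map_zero] at h1
  have h2 : (MvPolynomial.aeval (R := ℂ) (S₁ := ℂ) fun x : Fin d × Fin m =>
      if (x.1 : ℕ) = x.2 then (1 : ℂ) else 0).mapMatrix (genericBlock hd hm) = 1 := by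
    ext s t
    simp [genericBlock, Matrix.one_apply, Fin.ext_iff]
  rw [h2, Matrix.det_one] at h1
  exact one_ne_zero h1

theorem polarHom_genericBlock (i j : Fin d) (hd : r ≤ d) (hm : r ≤ m) (s t : Fin r) :
    (polarHom i j).mapMatrix (genericBlock hd hm) s t
      = TrivSqZeroExt.inl (MvPolynomial.X (Fin.castLE hd s, Fin.castLE hm t))
        + if Fin.castLE hd s = j then TrivSqZeroExt.inr (MvPolynomial.X (i, Fin.castLE hm t))
          else 0 := by
  rw [AlgHom.mapMatrix_apply, Matrix.map_apply, genericBlock, Matrix.of_apply, polarHom_apply, polar_X]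
  split_ifs <;> simp

theorem det_map_inl (M : Matrix (Fin r) (Fin r) (MvPolynomial (Fin d × Fin m) ℂ)) :
    (M.map TrivSqZeroExt.inl).det = (TrivSqZeroExt.inl M.det :
      TrivSqZeroExt (MvPolynomial (Fin d × Fin m) ℂ) (MvPolynomial (Fin d × Fin m) ℂ)) :=
  (RingHom.map_det (TrivSqZeroExt.inlHom (MvPolynomial (Fin d × Fin m) ℂ)
    (MvPolynomial (Fin d × Fin m) ℂ)) M).symm

/-- Row `j` does not meet the block, so the matrix over the dual numbers is unchanged. -/
theorem polar_det_of_le (i j : Fin d) (hd : r ≤ d) (hm : r ≤ m) (hj : r ≤ (j : ℕ)) :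
    polar i j (genericBlock hd hm).det = 0 := by
  have h : (polarHom i j).mapMatrix (genericBlock hd hm)
      = (genericBlock hd hm).map TrivSqZeroExt.inl := by
    ext1 s t
    rw [polarHom_genericBlock, if_neg, add_zero]
    · rfl
    · rintro rfl
      have := s.2
      simp at hj
      omega
  have h1 := polarHom_apply i j (genericBlock hd hm).det
  rw [AlgHom.map_det, h, det_map_inl] at h1
  simpa using congrArg TrivSqZeroExt.snd h1.symm

/-- When row `j` meets the block, so does the earlier row `i`. The polarization adds ε times row `i`
to row `j`, which preserves the determinant. -/
theorem polar_det_of_lt {i j : Fin d} (hd : r ≤ d) (hm : r ≤ m) (hij : i < j) :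
    polar i j (genericBlock hd hm).det = 0 := by
  rcases le_or_gt r (j : ℕ) with hj | hj
  · exact polar_det_of_le i j hd hm hj
  set s : Fin r := ⟨j, hj⟩
  set t : Fin r := ⟨i, lt_trans hij hj⟩
  have hst : s ≠ t := fun h0 => absurd hij (by
    have := congrArg Fin.val h0
    simp only [s, t] at this
    exact not_lt_of_ge (by rw [Fin.le_def]; omega))
  set M := (genericBlock hd hm).map (TrivSqZeroExt.inl : _ →
    TrivSqZeroExt (MvPolynomial (Fin d × Fin m) ℂ) (MvPolynomial (Fin d × Fin m) ℂ)) with hM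
  have h : (polarHom i j).mapMatrix (genericBlock hd hm)
      = M.updateRow s (M s + (TrivSqZeroExt.inr 1 : TrivSqZeroExt (MvPolynomial (Fin d × Fin m) ℂ)
        (MvPolynomial (Fin d × Fin m) ℂ)) • M t) := by
    ext1 s' t'
    rw [polarHom_genericBlock, Matrix.updateRow_apply]
    by_cases hs : s' = s
    · rw [if_pos hs, if_pos (by rw [hs]; rfl), hs]
      simp only [Pi.add_apply, Pi.smul_apply, hM, Matrix.map_apply, genericBlock, Matrix.of_apply]
      congr 1
      have : Fin.castLE hd t = i := rfl
      rw [this, smul_eq_mul]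
      ext <;> simp
    · rw [if_neg hs, if_neg, add_zero]
      · rfl
      · intro h0
        rw [Fin.ext_iff] at h0
        exact hs (Fin.ext h0)
  have h1 := polarHom_apply i j (genericBlock hd hm).det
  rw [AlgHom.map_det, h, Matrix.det_updateRow_add_smul_self _ hst, hM, det_map_inl] at h1
  simpa using congrArg TrivSqZeroExt.snd h1.symm

/-- A row in the block is multiplied by 1 + ε, and so is the determinant. -/
theorem polar_det_self (i : Fin d) (hd : r ≤ d) (hm : r ≤ m) :
    polar i i (genericBlock hd hm).det = if (i : ℕ) < r then (genericBlock hd hm).det else 0 := by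
  split_ifs with hi
  swap
  · exact polar_det_of_le i i hd hm (not_lt.1 hi)
  set s : Fin r := ⟨i, hi⟩
  set M := (genericBlock hd hm).map (TrivSqZeroExt.inl : _ →
    TrivSqZeroExt (MvPolynomial (Fin d × Fin m) ℂ) (MvPolynomial (Fin d × Fin m) ℂ)) with hM
  have h : (polarHom i i).mapMatrix (genericBlock hd hm)
      = M.updateRow s ((1 + TrivSqZeroExt.inr 1 : TrivSqZeroExt (MvPolynomial (Fin d × Fin m) ℂ)
        (MvPolynomial (Fin d × Fin m) ℂ)) • M s) := by
    ext1 s' t'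
    rw [polarHom_genericBlock, Matrix.updateRow_apply]
    by_cases hs : s' = s
    · rw [if_pos hs, if_pos (by rw [hs]; rfl), hs]
      simp only [Pi.smul_apply, hM, Matrix.map_apply, genericBlock, Matrix.of_apply]
      have : Fin.castLE hd s = i := rfl
      rw [this, smul_eq_mul]
      ext <;> simp
    · rw [if_neg hs, if_neg, add_zero]
      · rfl
      · intro h0
        rw [Fin.ext_iff] at h0
        exact hs (Fin.ext h0)
  have h1 := polarHom_apply i i (genericBlock hd hm).det
  rw [AlgHom.map_det, h, Matrix.det_updateRow_smul, Matrix.updateRow_eq_self, hM, det_map_inl] at h1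
  simpa using congrArg TrivSqZeroExt.snd h1.symm

end Minor

/-! ### Singular vectors of hook shapes -/

section Hook

variable {d m n : ℕ}

theorem lt_colLen_iff (μ : YoungDiagram) (i j : ℕ) : i < μ.colLen j ↔ j < μ.rowLen i := by
  rw [← YoungDiagram.mem_iff_lt_colLen, ← YoungDiagram.mem_iff_lt_rowLen]

/-- The diagram is built by columns: an odd monomial gives the first `n`, and multiplication by the
leading minor of size `colLen (n + q)` adds one more column. -/
theorem exists_singular_truncated (μ : HookPartition d m n) (q : ℕ) :
    ∃ v : HoweSpace d m n, v ≠ 0 ∧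
      IsSingular (rowE d) (fun i => i) (fun i => ((min (μ.1.rowLen i) (n + q) : ℕ) : ℂ)) v := by
  induction q with
  | zero =>
    obtain ⟨u, hu⟩ := exists_isOddMonomial
      (oddCells (d := d) (m := m) fun i (b : Fin n) => (b : ℕ) < μ.1.rowLen i)
      fun x => par_of_mem_oddCells
    refine ⟨u, hu.ne_zero, isSingular_rowE.2 ⟨fun i j hij => ?_, fun i => ?_⟩⟩
    · exact rowOp_oddMonomial hu (fun h => absurd hij (by rw [h]; exact lt_irrefl _))
        fun b hb => hb.trans_le (μ.1.rowLen_anti _ _ (le_of_lt hij))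
    · rw [rowOp_self_oddMonomial hu, card_filter_lt_min]
      rfl
  | succ q ih =>
    obtain ⟨v, hv0, hv⟩ := ih
    rw [isSingular_rowE] at hv
    have hd : μ.1.colLen (n + q) ≤ d := (μ.1.colLen_anti _ _ (Nat.zero_le _)).trans μ.2.2
    have hm : μ.1.colLen (n + q) ≤ m := by
      -- The minor fits into the `m` even columns: a longer column at `n + q` would make row `m`
      -- longer than `n`.
      by_contra h
      rw [not_le, lt_colLen_iff] at h
      have := μ.2.1
      omega
    refine ⟨mulPoly (genericBlock hd hm).det v, ?_, isSingular_rowE.2 ⟨fun i j hij => ?_, fun i => ?_⟩⟩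
    · intro h0
      exact hv0 (mulPoly_injective (det_genericBlock_ne_zero hd hm) (h0.trans (map_zero _).symm))
    · rw [rowOp_mulPoly, hv.1 i j hij, polar_det_of_lt hd hm hij, mulPoly_zero]
      simp
    · rw [rowOp_mulPoly, hv.2 i, polar_det_self, map_smul]
      simp only [lt_colLen_iff]
      split_ifs with h
      · have : min (μ.1.rowLen i) (n + (q + 1)) = min (μ.1.rowLen i) (n + q) + 1 := by omega
        rw [this]
        push_cast
        module
      · have : min (μ.1.rowLen i) (n + (q + 1)) = min (μ.1.rowLen i) (n + q) := by omega
        rw [this, mulPoly_zero]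
        simp

/-- Every hook partition is the weight of a singular vector of `gl(d)`. -/
theorem exists_singular_glWeight (μ : HookPartition d m n) :
    ∃ v : HoweSpace d m n, v ≠ 0 ∧ IsSingular (rowE d) (fun i => i) (glWeight d μ.1) v := by
  obtain ⟨v, hv0, hv⟩ := exists_singular_truncated μ (μ.1.rowLen 0)
  refine ⟨v, hv0, ?_⟩
  convert hv using 1
  ext i
  rw [glWeight, min_eq_left]
  exact (μ.1.rowLen_anti 0 i (Nat.zero_le _)).trans (Nat.le_add_left _ _)

end Hook

/-! ### Spaces of singular vectors -/

section General

variable {I U M N : Type} [Fintype I] [DecidableEq I] [Ring U] [Algebra ℂ U]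
  [AddCommGroup M] [Module ℂ M] [Module U M] [IsScalarTower ℂ U M]
  [AddCommGroup N] [Module ℂ N] [Module U N] [IsScalarTower ℂ U N]
  {e : I → I → U} {c : I → ℕ} {wt : I → ℂ} {v : M}

theorem IsSingular.map (hv : IsSingular e c wt v) (f : M →ₗ[U] N) : IsSingular e c wt (f v) := by
  refine ⟨fun i j hij => by rw [← map_smul, hv.1 i j hij, map_zero], fun i => ?_⟩
  rw [← map_smul, hv.2 i, ← algebraMap_smul U, map_smul, algebraMap_smul]

theorem SimpleHW.isSingular_hw [LT I] (hlt : ∀ i j, c i < c j → i < j) :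
    IsSingular e c wt (SimpleHW.hw e wt) :=
  (Verma.isSingular_hw hlt).map (vermaRadical e wt).mkQ

theorem SimpleHW.span_hw [LT I] : Submodule.span U {SimpleHW.hw e wt} = ⊤ := by
  have h := congrArg (Submodule.map (vermaRadical e wt).mkQ) (Verma.span_hw (e := e) (wt := wt))
  rw [Submodule.map_span, Set.image_singleton, Submodule.map_top, Submodule.range_mkQ] at h
  exact h

theorem SimpleHW.hom_ext [LT I] {f g : SimpleHW e wt →ₗ[U] M}
    (h : f (SimpleHW.hw e wt) = g (SimpleHW.hw e wt)) : f = g :=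
  LinearMap.ext_on SimpleHW.span_hw (by rintro _ rfl; exact h)

/-- Isomorphic simple highest weight modules have the same weight. -/
theorem MatrixUnits.weight_eq_of_equiv [LT I] (h : MatrixUnits e) (hc : Function.Injective c)
    (hlt : ∀ i j, c i < c j → i < j) {wt' : I → ℂ} [IsSimpleModule U (SimpleHW e wt)]
    (f : SimpleHW e wt ≃ₗ[U] SimpleHW e wt') : wt = wt' := by
  have hne : ∀ {v : SimpleHW e wt}, Submodule.span U {v} = ⊤ → v ≠ 0 := by
    rintro v hv rfl
    have := IsSimpleModule.nontrivial U (SimpleHW e wt)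
    rw [Submodule.span_zero_singleton] at hv
    exact bot_ne_top hv
  have h' : Submodule.span U {f.symm (SimpleHW.hw e wt')} = ⊤ := by
    have h1 := congrArg (Submodule.map f.symm.toLinearMap) (SimpleHW.span_hw (e := e) (wt := wt'))
    rw [Submodule.map_span, Set.image_singleton, Submodule.map_top, LinearEquiv.range] at h1
    exact h1
  obtain ⟨b, hb⟩ := Submodule.mem_span_singleton.1 (show f.symm (SimpleHW.hw e wt')
    ∈ Submodule.span U {SimpleHW.hw e wt} by rw [SimpleHW.span_hw]; trivial)
  obtain ⟨b', hb'⟩ := Submodule.mem_span_singleton.1 (show SimpleHW.hw e wt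
    ∈ Submodule.span U {f.symm (SimpleHW.hw e wt')} by rw [h']; trivial)
  exact h.weight_eq hc (SimpleHW.isSingular_hw hlt)
    ((SimpleHW.isSingular_hw hlt).map f.symm.toLinearMap) (hne SimpleHW.span_hw) (hne h') hb hb'

/-- Burnside's theorem. -/
theorem exists_smul_of_end [FiniteDimensional ℂ M] [IsSimpleModule U M] (T : Module.End ℂ M) :
    ∃ u : U, ∀ x, T x = u • x := by
  refine exists_smul_of_commute T fun g x => ?_
  -- By Schur's lemma the commutant consists of scalars.
  obtain ⟨t, rfl⟩ := (IsSimpleModule.algebraMap_end_bijective_of_isAlgClosed (A := U) (V := M) ℂ).2 g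
  rw [Module.algebraMap_end_apply, Module.algebraMap_end_apply, map_smul]

end General

/-! ### Multiplicity spaces over gl(d) and their highest weights -/

section RowSing

variable {d m n : ℕ}

variable (d m n) in
/-- The space of singular vectors of `gl(d)` of a given weight, a `gl(m|n)`-module. -/
def rowSing (wt : Fin d → ℂ) : Submodule (UGlSuper (Fin m) (Fin n)) (HoweSpace d m n) where
  carrier := {v | IsSingular (rowE d) (fun i => i) wt v}
  zero_mem' := ⟨fun i j _ => smul_zero _, fun i => by rw [smul_zero, smul_zero]⟩
  add_mem' hv hw := ⟨fun i j hij => by rw [smul_add, hv.1 i j hij, hw.1 i j hij, add_zero],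
    fun i => by rw [smul_add, hv.2, hw.2, smul_add]⟩
  smul_mem' u v hv := ⟨fun i j hij => by rw [smul_comm, hv.1 i j hij, smul_zero],
    fun i => by
      rw [smul_comm, hv.2, ← algebraMap_smul (UGlSuper (Fin m) (Fin n)), ← mul_smul,
        ← Algebra.commutes, mul_smul, algebraMap_smul]⟩

theorem mem_rowSing {wt : Fin d → ℂ} {v : HoweSpace d m n} :
    v ∈ rowSing d m n wt ↔ IsSingular (rowE d) (fun i => i) wt v := Iff.rfl

theorem isSimpleModule_rowSing {l : Fin d → ℕ} {v : HoweSpace d m n} (hv0 : v ≠ 0)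
    (hv : v ∈ rowSing d m n fun i => l i) :
    IsSimpleModule (UGlSuper (Fin m) (Fin n)) (rowSing d m n fun i => l i) := by
  rw [isSimpleModule_iff_toSpanSingleton_surjective]
  refine ⟨⟨⟨v, hv⟩, 0, fun h => hv0 (congrArg Subtype.val h)⟩, fun x hx y => ?_⟩
  by_cases hy : y = 0
  · exact ⟨0, by simp [hy]⟩
  · obtain ⟨u, hu⟩ := exists_col_smul_eq Fin.val_injective x.2 y.2
      (fun h => hx (Subtype.ext h)) (fun h => hy (Subtype.ext h))
    exact ⟨u, Subtype.ext hu⟩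

instance finiteDimensional_rowSing (l : Fin d → ℕ) :
    FiniteDimensional ℂ (rowSing d m n fun i => l i) := by
  let F : (rowSing d m n fun i => l i) →ₗ[ℂ] howePow d m n (∑ i, l i) :=
    { toFun := fun v => ⟨v, mem_howePow_of_row (isSingular_rowE.1 v.2).2⟩
      map_add' := fun _ _ => rfl
      map_smul' := fun _ _ => rfl }
  exact FiniteDimensional.of_injective F fun v w h =>
    Subtype.ext (congrArg (fun z : howePow d m n (∑ i, l i) => (z : HoweSpace d m n)) h)

theorem exists_joint_singular {l : Fin d → ℕ} {v : HoweSpace d m n} (hv0 : v ≠ 0)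
    (hv : v ∈ rowSing d m n fun i => l i) :
    ∃ (w : rowSing d m n fun i => l i) (x : Fin m ⊕ Fin n → ℂ), w ≠ 0 ∧
      IsSingular (colE m n) (colHt m n) x w := by
  have : Nontrivial (rowSing d m n fun i => l i) :=
    ⟨⟨v, hv⟩, 0, fun h => hv0 (congrArg Subtype.val h)⟩
  exact matrixUnits_colE.exists_singular _

theorem rowLen_eq_zero {μ : YoungDiagram} (h : μ.colLen 0 ≤ d) {i : ℕ} (hi : d ≤ i) :
    μ.rowLen i = 0 := by
  by_contra h0
  have := (lt_colLen_iff μ i 0).2 (Nat.pos_of_ne_zero h0)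
  omega

/-- The weights of the singular vectors of `gl(d)` are the hook partitions. -/
theorem exists_hook {wt : Fin d → ℂ} {v : HoweSpace d m n} (hv0 : v ≠ 0)
    (hv : IsSingular (rowE d) (fun i => i) wt v) : ∃ μ : HookPartition d m n, wt = glWeight d μ.1 := by
  have hv' := isSingular_rowE.1 hv
  choose l hl using fun i => exists_nat_row hv0 (hv'.2 i)
  obtain rfl : wt = fun i => (l i : ℂ) := funext hl
  have hanti : ∀ i j, i ≤ j → l j ≤ l i := by
    intro i j hij
    rcases hij.eq_or_lt with rfl | hij
    · exact le_rfl
    · exact row_weight_le hij.ne hv0 (hv'.2 i) (hv'.2 j) (hv'.1 i j hij)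
  obtain ⟨w, x, hw0, hw⟩ := exists_joint_singular hv0 hv
  have hhook := (joint_weight hanti (fun h => hw0 (Subtype.ext h)) w.2
    (hw.map (rowSing d m n fun i => l i).subtype)).1
  have hsorted : (List.ofFn l).SortedGE := by
    rw [List.sortedGE_ofFn_iff]
    exact fun i j hij => hanti i j hij
  -- The list keeps all `d` entries; zero rows contribute no cells.
  set μ := YoungDiagram.ofRowLens (List.ofFn l) hsorted with hμ
  have hmem : ∀ i j : ℕ, j < μ.rowLen i ↔ ∃ h : i < d, j < l ⟨i, h⟩ := by
    intro i j
    rw [← YoungDiagram.mem_iff_lt_rowLen, hμ, YoungDiagram.mem_ofRowLens]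
    simp
  have hrow : ∀ i : Fin d, μ.rowLen i = l i := by
    intro i
    refine eq_of_forall_lt_iff fun j => ?_
    rw [hmem]
    simp
  refine ⟨⟨μ, ?_, ?_⟩, ?_⟩
  · by_contra h
    rw [not_le, hmem] at h
    obtain ⟨h, h'⟩ := h
    exact absurd (hhook ⟨m, h⟩ le_rfl) (not_le.2 h')
  · by_contra h
    rw [not_le, lt_colLen_iff, hmem] at h
    exact absurd h.1 (lt_irrefl d)
  · ext i
    rw [glWeight, hrow]

/-- The rows from `m` on which meet column `b` form the interval from `m` to the length of that
column. It is empty for a shorter column, in agreement with the truncated subtraction. -/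
theorem natural_eq_card (μ : YoungDiagram) (h : μ.colLen 0 ≤ d) (b : ℕ) :
    μ.colLen b - m
      = (Finset.univ.filter fun i : Fin d => m ≤ (i : ℕ) ∧ b < μ.rowLen i).card := by
  rw [← Finset.card_map Fin.valEmbedding, ← Nat.card_Ico]
  congr 1
  ext i
  simp only [Finset.mem_Ico, Finset.mem_map, Finset.mem_filter, Finset.mem_univ, true_and,
    Fin.valEmbedding_apply, lt_colLen_iff]
  constructor
  · rintro ⟨h1, h2⟩
    refine ⟨⟨i, ?_⟩, ⟨h1, h2⟩, rfl⟩
    rw [← lt_colLen_iff] at h2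
    exact h2.trans_le ((μ.colLen_anti 0 b (Nat.zero_le _)).trans h)
  · rintro ⟨i, h1, rfl⟩
    exact h1

/-- There are joint singular vectors of weight `(μ, μ^♮)`. -/
theorem exists_joint_singular_hook (μ : HookPartition d m n) :
    ∃ w : rowSing d m n (glWeight d μ.1), w ≠ 0 ∧
      IsSingular (colE m n) (colHt m n) (fun a => naturalWeight m n μ.1 (toLex a)) w := by
  obtain ⟨v, hv0, hv⟩ := exists_singular_glWeight μ
  obtain ⟨w, x, hw0, hw⟩ := exists_joint_singular hv0 hv
  have h := joint_weight (fun i j hij => μ.1.rowLen_anti i j hij) (fun h => hw0 (Subtype.ext h)) w.2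
    (hw.map (rowSing d m n (glWeight d μ.1)).subtype)
  refine ⟨w, hw0, ?_⟩
  suffices hx : (fun a => naturalWeight m n μ.1 (toLex a)) = x by rwa [hx]
  ext (a | b)
  · rw [h.2.1 a]
    simp only [naturalWeight, ofLex_toLex, Sum.elim_inl]
    split_ifs with ha
    · rfl
    · rw [rowLen_eq_zero μ.2.2 (not_lt.1 ha), Nat.cast_zero]
  · rw [h.2.2 b, ← natural_eq_card μ.1 μ.2.2]
    simp [naturalWeight]

theorem glWeight_injective {μ ν : HookPartition d m n} (h : glWeight d μ.1 = glWeight d ν.1) :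
    μ = ν := by
  have hrow : ∀ i, μ.1.rowLen i = ν.1.rowLen i := by
    intro i
    rcases lt_or_ge i d with hi | hi
    · exact Nat.cast_injective (R := ℂ) (congrFun h ⟨i, hi⟩)
    · rw [rowLen_eq_zero μ.2.2 hi, rowLen_eq_zero ν.2.2 hi]
  refine Subtype.ext (YoungDiagram.ext (Finset.ext ?_))
  rintro ⟨i, j⟩
  rw [YoungDiagram.mem_cells, YoungDiagram.mem_cells, YoungDiagram.mem_iff_lt_rowLen,
    YoungDiagram.mem_iff_lt_rowLen, hrow]

end RowSing

/-! ### The simple modules in the decomposition -/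

section Simple

variable {d m n : ℕ}

theorem matrixUnits_colE_lex :
    MatrixUnits fun i j : Fin m ⊕ₗ Fin n => colE m n (ofLex i) (ofLex j) := by
  have hr : (Set.range fun p : (Fin m ⊕ₗ Fin n) × (Fin m ⊕ₗ Fin n) => colE m n (ofLex p.1) (ofLex p.2))
      = Set.range fun p : (Fin m ⊕ Fin n) × (Fin m ⊕ Fin n) => colE m n p.1 p.2 := by
    ext x
    constructor
    · rintro ⟨p, rfl⟩
      exact ⟨(ofLex p.1, ofLex p.2), rfl⟩
    · rintro ⟨p, rfl⟩
      exact ⟨(toLex p.1, toLex p.2), rfl⟩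
  refine ⟨?_, fun i j k l => ?_, fun i k l => ?_⟩
  · rw [hr]
    exact matrixUnits_colE.adjoin_eq
  · rw [hr]
    exact matrixUnits_colE.comm _ _ _ _
  · rw [matrixUnits_colE.cartan]
    simp only [ofLex_inj]

theorem lex_lt_iff (i j : Fin m ⊕ₗ Fin n) : i < j ↔ colHt m n (ofLex i) < colHt m n (ofLex j) := by
  induction i using Lex.rec with | _ i => ?_
  induction j using Lex.rec with | _ j => ?_
  rcases i with a | a <;> rcases j with b | b
  · simp [colHt, Sum.Lex.toLex_lt_toLex]
  · have := a.2
    simp [colHt, Sum.Lex.toLex_lt_toLex]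
    omega
  · have := b.2
    simp [colHt, Sum.Lex.toLex_lt_toLex]
    omega
  · simp [colHt, Sum.Lex.toLex_lt_toLex]

/-- Both properties are read off from a copy of the module inside some S^k, which is semisimple and
finite-dimensional. -/
theorem LGl_simple (μ : HookPartition d m n) :
    IsSimpleModule (UGl d) (LGl d (glWeight d μ.1)) ∧
      FiniteDimensional ℂ (LGl d (glWeight d μ.1)) := by
  obtain ⟨v, hv0, hv⟩ := exists_singular_glWeight μ
  have hvk := mem_howePow_of_row (isSingular_rowE.1 hv).2
  obtain ⟨hs, φ, hφ, -⟩ := matrixUnits_rowE.exists_simpleHW Fin.val_injective (fun i j => Iff.rfl)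
    (v := (⟨v, hvk⟩ : howePow d m n (∑ i : Fin d, μ.1.rowLen i))) (wt := glWeight d μ.1)
    ⟨fun i j hij => Subtype.ext (hv.1 i j hij), fun i => Subtype.ext (hv.2 i)⟩
    (fun h => hv0 (congrArg Subtype.val h))
  exact ⟨hs, FiniteDimensional.of_injective (φ.restrictScalars ℂ) hφ⟩

instance (μ : HookPartition d m n) : IsSimpleModule (UGl d) (LGl d (glWeight d μ.1)) :=
  (LGl_simple μ).1

instance (μ : HookPartition d m n) : FiniteDimensional ℂ (LGl d (glWeight d μ.1)) :=
  (LGl_simple μ).2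

/-- The space `rowSing` is already known to be simple, so `MatrixUnits.exists_simpleHW` applies to
its singular vector although gl(m|n)-modules need not be semisimple. -/
theorem LGlSuper_simple (μ : HookPartition d m n) :
    IsSimpleModule (UGlSuper (Fin m) (Fin n)) (LGlSuper m n (naturalWeight m n μ.1)) ∧
      Nonempty (LGlSuper m n (naturalWeight m n μ.1) ≃ₗ[UGlSuper (Fin m) (Fin n)]
        rowSing d m n (glWeight d μ.1)) := by
  obtain ⟨w, hw0, hw⟩ := exists_joint_singular_hook μ
  have hsimple : IsSimpleModule (UGlSuper (Fin m) (Fin n)) (rowSing d m n (glWeight d μ.1)) :=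
    isSimpleModule_rowSing (l := fun i => μ.1.rowLen i) (fun h => hw0 (Subtype.ext h)) w.2
  obtain ⟨hs, φ, hφ, hφw⟩ := matrixUnits_colE_lex.exists_simpleHW
    (c := fun i => colHt m n (ofLex i)) (colHt_injective.comp ofLex.injective) lex_lt_iff
    (v := w) (wt := naturalWeight m n μ.1)
    ⟨fun i j hij => hw.1 _ _ hij, fun i => hw.2 (ofLex i)⟩ hw0
  refine ⟨hs, ⟨LinearEquiv.ofBijective φ ⟨hφ, ?_⟩⟩⟩
  refine LinearMap.surjective_of_ne_zero fun h => hw0 ?_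
  rw [← hφw, h, LinearMap.zero_apply]

end Simple

/-! ### The decomposition -/

/-- An equivariant map from `L ⊗ V`, `L` simple, is injective if it is so on `x ⊗ V` for some
`x`. -/
theorem injective_of_equivariant {U L V M : Type} [Ring U] [Algebra ℂ U] [AddCommGroup L] [Module ℂ L]
    [Module U L] [IsScalarTower ℂ U L] [FiniteDimensional ℂ L] [IsSimpleModule U L] [AddCommGroup V]
    [Module ℂ V] [AddCommGroup M] [Module ℂ M] [Module U M] (F : L ⊗[ℂ] V →ₗ[ℂ] M)
    (hF : ∀ (u : U) t, F ((Algebra.lsmul ℂ ℂ L u).rTensor V t) = u • F t) (x : L)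
    (hx : ∀ y, F (x ⊗ₜ y) = 0 → y = 0) : Function.Injective F := by
  rw [← LinearMap.ker_eq_bot, LinearMap.ker_eq_bot']
  intro t ht
  let b := Module.finBasis ℂ L
  -- By Burnside's theorem some `u` acts on `L` as z ↦ b_i^*(z) x. It sends `t` to `x` tensored with
  -- the i-th component of `t`, so every component vanishes.
  have hb : ∀ i, (b.coord i).rTensor V t = 0 := by
    intro i
    obtain ⟨u, hu⟩ := exists_smul_of_end (U := U) ((b.coord i).smulRight x)
    have h1 : ∀ s : L ⊗[ℂ] V, (Algebra.lsmul ℂ ℂ L u).rTensor V s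
          = x ⊗ₜ TensorProduct.lid ℂ V ((b.coord i).rTensor V s) := by
      intro s
      induction s with
      | zero => simp
      | add s s' hs hs' => rw [map_add, hs, hs', map_add, map_add, TensorProduct.tmul_add]
      | tmul z y =>
        have h2 : Algebra.lsmul ℂ ℂ L u z = b.coord i z • x := (hu z).symm
        rw [LinearMap.rTensor_tmul, h2, LinearMap.rTensor_tmul, TensorProduct.lid_tmul,
          TensorProduct.smul_tmul]
    have h2 := hF u t
    rw [ht, smul_zero, h1] at h2
    exact (LinearEquiv.map_eq_zero_iff _).1 (hx _ h2)
  have hid : (LinearMap.id : L →ₗ[ℂ] L) = ∑ i, (LinearMap.toSpanSingleton ℂ L (b i)) ∘ₗ b.coord i := by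
    ext x
    simp [b.sum_repr]
  rw [← LinearMap.rTensor_id_apply V L t, hid, ← LinearMap.coe_rTensorHom, map_sum,
    LinearMap.sum_apply]
  refine Finset.sum_eq_zero fun i _ => ?_
  rw [LinearMap.coe_rTensorHom, LinearMap.rTensor_comp_apply, hb, map_zero]

/-! ### Equivariance and injectivity of maps out of a direct sum -/

section DirectSum

variable {ι M : Type} [DecidableEq ι] {A : ι → Type} [∀ i, AddCommMonoid (A i)]
  [∀ i, Module ℂ (A i)]
  [AddCommGroup M] [Module ℂ M]

theorem toModule_lmap (F : ∀ i, A i →ₗ[ℂ] M) (T : ∀ i, A i →ₗ[ℂ] A i) (T' : M →ₗ[ℂ] M)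
    (h : ∀ i a, F i (T i a) = T' (F i a)) (t : ⨁ i, A i) :
    DirectSum.toModule ℂ ι M F (DirectSum.lmap T t) = T' (DirectSum.toModule ℂ ι M F t) := by
  have h1 : DirectSum.toModule ℂ ι M F ∘ₗ DirectSum.lmap T = T' ∘ₗ DirectSum.toModule ℂ ι M F := by
    refine DirectSum.linearMap_ext _ fun i => LinearMap.ext fun a => ?_
    simp only [LinearMap.comp_apply, DirectSum.lmap_lof, DirectSum.toModule_lof, h]
  exact LinearMap.congr_fun h1 t

theorem toModule_injective {R : Type} [Ring R] [Module R M] (F : ∀ i, A i →ₗ[ℂ] M)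
    (hF : ∀ i, Function.Injective (F i)) {p : ι → Submodule R M} (hp : ∀ i a, F i a ∈ p i)
    (h : iSupIndep p) : Function.Injective (DirectSum.toModule ℂ ι M F) := by
  let G : ∀ i, A i →+ p i := fun i => (F i).toAddMonoidHom.codRestrict (p i) (hp i)
  have hG : Function.Injective (DirectSum.map G) := by
    refine (DirectSum.map_injective G).2 fun i a b hab => hF i ?_
    exact congrArg Subtype.val hab
  have hsum : ∀ t, DirectSum.toModule ℂ ι M F t
      = DFinsupp.lsum ℕ (fun i => (p i).subtype) (DirectSum.map G t) := by
    intro t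
    induction t using DirectSum.induction_on with
    | zero => simp
    | add s t hs ht => rw [map_add, hs, ht, map_add, map_add]
    | of i a =>
      rw [DirectSum.map_of]
      refine (DirectSum.toModule_lof ℂ i a).trans ?_
      exact (DFinsupp.lsum_single (S := ℕ) (F := fun i => (p i).subtype) i (G i a)).symm
  intro s t hst
  rw [hsum, hsum] at hst
  exact hG (h.dfinsupp_lsum_injective hst)

end DirectSum

section Decomposition

variable {d m n : ℕ}

/-- The highest weight vector of `L_d(μ)`. -/
abbrev hwGl (μ : HookPartition d m n) : LGl d (glWeight d μ.1) := SimpleHW.hw (rowE d) (glWeight d μ.1)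

theorem exists_singHom (μ : HookPartition d m n) (w : rowSing d m n (glWeight d μ.1)) :
    ∃ φ : LGl d (glWeight d μ.1) →ₗ[UGl d] HoweSpace d m n, φ (hwGl μ) = w := by
  by_cases hw : (w : HoweSpace d m n) = 0
  · exact ⟨0, by rw [hw, LinearMap.zero_apply]⟩
  · obtain ⟨-, φ, -, hφ⟩ := matrixUnits_rowE.exists_simpleHW Fin.val_injective
      (fun i j => Iff.rfl) (mem_rowSing.1 w.2) hw
    exact ⟨φ, hφ⟩

/-- The homomorphism from `L_d(μ)` defined by a singular vector. -/
def singHom (μ : HookPartition d m n) (w : rowSing d m n (glWeight d μ.1)) :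
    LGl d (glWeight d μ.1) →ₗ[UGl d] HoweSpace d m n := (exists_singHom μ w).choose

theorem singHom_hw (μ : HookPartition d m n) (w : rowSing d m n (glWeight d μ.1)) :
    singHom μ w (hwGl μ) = w := (exists_singHom μ w).choose_spec

/-- The highest weight vector generates, so a homomorphism is determined by its value there. This
makes the chosen `singHom` linear and gl(m|n)-equivariant in `w`. -/
theorem eq_singHom {μ : HookPartition d m n} {w : rowSing d m n (glWeight d μ.1)}
    {φ : LGl d (glWeight d μ.1) →ₗ[UGl d] HoweSpace d m n} (h : φ (hwGl μ) = w) :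
    singHom μ w = φ :=
  SimpleHW.hom_ext ((singHom_hw μ w).trans h.symm)

theorem singHom_add (μ : HookPartition d m n) (w w' : rowSing d m n (glWeight d μ.1)) :
    singHom μ (w + w') = singHom μ w + singHom μ w' :=
  eq_singHom (by rw [LinearMap.add_apply, singHom_hw, singHom_hw]; rfl)

theorem singHom_smul (μ : HookPartition d m n) (t : ℂ) (w : rowSing d m n (glWeight d μ.1)) :
    singHom μ (t • w) = t • singHom μ w :=
  eq_singHom (by rw [LinearMap.smul_apply, singHom_hw]; rfl)

theorem singHom_col_smul (μ : HookPartition d m n) (u : UGlSuper (Fin m) (Fin n))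
    (w : rowSing d m n (glWeight d μ.1)) : singHom μ (u • w) = u • singHom μ w :=
  eq_singHom (by rw [LinearMap.smul_apply, singHom_hw]; rfl)

/-- The multiplicity space of `L_d(μ)`. -/
def multEquiv (μ : HookPartition d m n) :
    LGlSuper m n (naturalWeight m n μ.1) ≃ₗ[UGlSuper (Fin m) (Fin n)]
      rowSing d m n (glWeight d μ.1) := (LGlSuper_simple μ).2.some

theorem multEquiv_smul (μ : HookPartition d m n) (t : ℂ)
    (y : LGlSuper m n (naturalWeight m n μ.1)) : multEquiv μ (t • y) = t • multEquiv μ y := by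
  rw [← algebraMap_smul (UGlSuper (Fin m) (Fin n)) t y, map_smul, algebraMap_smul]

/-- The summand of the decomposition of a hook partition. -/
def summand (μ : HookPartition d m n) :
    LGl d (glWeight d μ.1) ⊗[ℂ] LGlSuper m n (naturalWeight m n μ.1) →ₗ[ℂ] HoweSpace d m n :=
  TensorProduct.lift (LinearMap.mk₂ ℂ (fun x y => singHom μ (multEquiv μ y) x)
    (fun x x' y => map_add _ x x')
    (fun t x y => by rw [← algebraMap_smul (UGl d) t x, map_smul, algebraMap_smul])
    (fun x y y' => by rw [map_add, singHom_add, LinearMap.add_apply])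
    (fun t x y => by rw [multEquiv_smul, singHom_smul, LinearMap.smul_apply]))

theorem summand_tmul (μ : HookPartition d m n) (x : LGl d (glWeight d μ.1))
    (y : LGlSuper m n (naturalWeight m n μ.1)) :
    summand μ (x ⊗ₜ y) = singHom μ (multEquiv μ y) x := rfl

theorem summand_row (μ : HookPartition d m n) (u : UGl d)
    (t : LGl d (glWeight d μ.1) ⊗[ℂ] LGlSuper m n (naturalWeight m n μ.1)) :
    summand μ ((Algebra.lsmul ℂ ℂ _ u).rTensor _ t) = u • summand μ t := by
  induction t with
  | zero => simp
  | add s t hs ht => rw [map_add, map_add, hs, ht, map_add, smul_add]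
  | tmul x y => rw [LinearMap.rTensor_tmul, summand_tmul, summand_tmul, Algebra.lsmul_coe, map_smul]

theorem summand_col (μ : HookPartition d m n) (u : UGlSuper (Fin m) (Fin n))
    (t : LGl d (glWeight d μ.1) ⊗[ℂ] LGlSuper m n (naturalWeight m n μ.1)) :
    summand μ ((Algebra.lsmul ℂ ℂ _ u).lTensor _ t) = u • summand μ t := by
  induction t with
  | zero => simp
  | add s t hs ht => rw [map_add, map_add, hs, ht, map_add, smul_add]
  | tmul x y =>
    rw [LinearMap.lTensor_tmul, summand_tmul, summand_tmul, Algebra.lsmul_coe, map_smul,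
      singHom_col_smul, LinearMap.smul_apply]

theorem summand_injective (μ : HookPartition d m n) : Function.Injective (summand μ) :=
  injective_of_equivariant (U := UGl d) (summand μ) (summand_row μ) (hwGl μ) fun y hy => by
    rw [summand_tmul, singHom_hw] at hy
    exact (LinearEquiv.map_eq_zero_iff _).1 (Subtype.ext hy)

theorem singHom_injective {μ : HookPartition d m n} {w : rowSing d m n (glWeight d μ.1)}
    (hw : w ≠ 0) : Function.Injective (singHom μ w) :=
  LinearMap.injective_of_ne_zero fun h => hw (Subtype.ext (by
    rw [← singHom_hw, h, LinearMap.zero_apply]; rfl))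

theorem summand_mem (μ : HookPartition d m n)
    (t : LGl d (glWeight d μ.1) ⊗[ℂ] LGlSuper m n (naturalWeight m n μ.1)) :
    summand μ t ∈ isotypicComponent (UGl d) (HoweSpace d m n) (LGl d (glWeight d μ.1)) := by
  induction t with
  | zero => rw [map_zero]; exact zero_mem _
  | add s t hs ht => rw [map_add]; exact add_mem hs ht
  | tmul x y =>
    rw [summand_tmul]
    by_cases hy : multEquiv μ y = 0
    · rw [hy, eq_singHom (φ := 0) (by simp), LinearMap.zero_apply]
      exact zero_mem _
    · have h : LinearMap.range (singHom μ (multEquiv μ y))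
          ≤ isotypicComponent (UGl d) (HoweSpace d m n) (LGl d (glWeight d μ.1)) :=
        le_sSup ⟨(LinearEquiv.ofInjective _ (singHom_injective hy)).symm⟩
      exact h ⟨x, rfl⟩

/-- Distinct isotypic components are independent, and different hook partitions give different
components because isomorphic simple highest weight modules have equal weights. -/
theorem iSupIndep_isotypic : iSupIndep fun μ : HookPartition d m n =>
    isotypicComponent (UGl d) (HoweSpace d m n) (LGl d (glWeight d μ.1)) := by
  have hrange : ∀ μ : HookPartition d m n, ∃ N : Submodule (UGl d) (HoweSpace d m n),
      Nonempty (N ≃ₗ[UGl d] LGl d (glWeight d μ.1)) := by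
    intro μ
    obtain ⟨w, hw0, -⟩ := exists_joint_singular_hook μ
    exact ⟨_, ⟨(LinearEquiv.ofInjective _ (singHom_injective hw0)).symm⟩⟩
  choose N hN using hrange
  have hsimple : ∀ μ, IsSimpleModule (UGl d) (N μ) := fun μ =>
    IsSimpleModule.congr (hN μ).some
  have hmem : ∀ μ : HookPartition d m n,
      isotypicComponent (UGl d) (HoweSpace d m n) (LGl d (glWeight d μ.1))
        ∈ isotypicComponents (UGl d) (HoweSpace d m n) :=
    fun μ => ⟨N μ, hsimple μ, ((hN μ).some.isotypicComponent_eq).symm⟩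
  have h := (sSupIndep_iff _).1 (sSupIndep_isotypicComponents (UGl d) (HoweSpace d m n))
  refine h.comp (f := fun μ => ⟨_, hmem μ⟩) fun μ ν hμν => ?_
  have hle : N μ ≤ isotypicComponent (UGl d) (HoweSpace d m n) (LGl d (glWeight d ν.1)) := by
    have h1 : isotypicComponent (UGl d) (HoweSpace d m n) (LGl d (glWeight d μ.1))
        = isotypicComponent (UGl d) (HoweSpace d m n) (LGl d (glWeight d ν.1)) :=
      congrArg Subtype.val hμν
    refine le_trans ?_ h1.le
    exact le_sSup (hN μ)
  have := hsimple μ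
  obtain ⟨g⟩ := isIsotypicOfType_submodule_iff.1
    (IsIsotypicOfType.isotypicComponent (UGl d) (HoweSpace d m n) (LGl d (glWeight d ν.1))) _ hle
  exact glWeight_injective (matrixUnits_rowE.weight_eq_of_equiv Fin.val_injective
    (fun i j => id) ((hN μ).some.symm.trans g))

theorem exists_summand_eq {μ : HookPartition d m n} {v : HoweSpace d m n}
    (hv : v ∈ rowSing d m n (glWeight d μ.1)) : ∃ t, summand μ t = v :=
  ⟨hwGl μ ⊗ₜ (multEquiv μ).symm ⟨v, hv⟩, by
    rw [summand_tmul, singHom_hw, LinearEquiv.apply_symm_apply]⟩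

/-- A `gl(d)`-submodule containing all singular vectors is everything. -/
theorem eq_top_of_singular_mem (p : Submodule (UGl d) (HoweSpace d m n))
    (hp : ∀ (v : HoweSpace d m n) (wt : Fin d → ℂ), v ≠ 0 →
      IsSingular (rowE d) (fun i => i) wt v → v ∈ p) : p = ⊤ := by
  rw [eq_top_iff]
  have hk : ∀ (k : ℕ), ∀ v ∈ howePow d m n k, v ∈ p := by
    intro k v hv
    let ι : howePow d m n k →ₗ[UGl d] HoweSpace d m n :=
      { toFun := Subtype.val
        map_add' := fun _ _ => rfl
        map_smul' := fun _ _ => rfl }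
    -- A nonzero complement within S^k would be finite-dimensional, hence contain a singular vector,
    -- which lies in `p` by hypothesis.
    obtain ⟨q, hq⟩ := exists_isCompl (p.comap ι)
    have hq0 : q = ⊥ := by
      by_contra hne
      have : Nontrivial q := Submodule.nontrivial_iff_ne_bot.2 hne
      have : FiniteDimensional ℂ q :=
        FiniteDimensional.of_injective (q.subtype.restrictScalars ℂ) Subtype.val_injective
      obtain ⟨w, wt, hw0, hw⟩ := (matrixUnits_rowE (d := d)).exists_singular (M := q) fun i => i
      have h1 : (w : howePow d m n k) ∈ p.comap ι :=
        hp _ wt (fun h => hw0 (Subtype.ext (Subtype.ext h))) ((hw.map q.subtype).map ι)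
      exact hw0 (Subtype.ext ((Submodule.mem_bot _).1 (hq.disjoint.le_bot ⟨h1, w.2⟩)))
    have htop := hq.sup_eq_top
    rw [hq0, sup_bot_eq] at htop
    have : (⟨v, hv⟩ : howePow d m n k) ∈ p.comap ι := by rw [htop]; trivial
    exact this
  intro v _
  have hv : v ∈ ⨆ k, howePow d m n k := by rw [iSup_superSymPow]; trivial
  exact Submodule.iSup_induction (p := howePow d m n) (motive := fun v => v ∈ p) hv hk (zero_mem _)
    (fun v w hv hw => add_mem hv hw)

open scoped Classical in
variable (d m n) in
/-- The map from the direct sum of the summands. -/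
def assemble : (⨁ μ : HookPartition d m n,
    LGl d (glWeight d μ.1) ⊗[ℂ] LGlSuper m n (naturalWeight m n μ.1)) →ₗ[ℂ] HoweSpace d m n :=
  DirectSum.toModule ℂ _ _ summand

theorem assemble_row (u : UGl d) (t) : assemble d m n
    (DirectSum.lmap (fun _ => (Algebra.lsmul ℂ ℂ _ u).rTensor _) t) = u • assemble d m n t := by
  classical
  exact toModule_lmap (summand (d := d) (m := m) (n := n)) _ (Algebra.lsmul ℂ ℂ (HoweSpace d m n) u)
    (fun μ t => summand_row μ u t) t

theorem assemble_col (u : UGlSuper (Fin m) (Fin n)) (t) : assemble d m n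
    (DirectSum.lmap (fun _ => (Algebra.lsmul ℂ ℂ _ u).lTensor _) t) = u • assemble d m n t := by
  classical
  exact toModule_lmap (summand (d := d) (m := m) (n := n)) _ (Algebra.lsmul ℂ ℂ (HoweSpace d m n) u)
    (fun μ t => summand_col μ u t) t

theorem assemble_surjective : Function.Surjective (assemble d m n) := by
  classical
  let p : Submodule (UGl d) (HoweSpace d m n) :=
    { carrier := Set.range (assemble d m n)
      zero_mem' := ⟨0, map_zero _⟩
      add_mem' := by
        rintro _ _ ⟨s, rfl⟩ ⟨t, rfl⟩
        exact ⟨s + t, map_add _ s t⟩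
      smul_mem' := by
        rintro u _ ⟨t, rfl⟩
        exact ⟨_, assemble_row u t⟩ }
  have hp : p = ⊤ := by
    refine eq_top_of_singular_mem p fun v wt hv0 hv => ?_
    obtain ⟨μ, rfl⟩ := exists_hook hv0 hv
    obtain ⟨t, rfl⟩ := exists_summand_eq (μ := μ) hv
    exact ⟨DirectSum.lof ℂ _ _ μ t, DirectSum.toModule_lof ..⟩
  intro v
  have : v ∈ p := by rw [hp]; trivial
  exact this

theorem assemble_injective : Function.Injective (assemble d m n) := by
  classical
  exact toModule_injective (summand (d := d) (m := m) (n := n)) summand_injective summand_mem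
    iSupIndep_isotypic

theorem exists_decomposition : ∃ f : HoweSpace d m n ≃ₗ[ℂ] ⨁ μ : HookPartition d m n,
      LGl d (glWeight d μ.1) ⊗[ℂ] LGlSuper m n (naturalWeight m n μ.1),
    (∀ (u : UGl d) (v : HoweSpace d m n), f (glRep d m n u v)
        = DirectSum.lmap (fun _ => (Algebra.lsmul ℂ ℂ _ u).rTensor _) (f v)) ∧
      ∀ (u : UGlSuper (Fin m) (Fin n)) (v : HoweSpace d m n), f (glSuperRep d m n u v)
        = DirectSum.lmap (fun _ => (Algebra.lsmul ℂ ℂ _ u).lTensor _) (f v) := by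
  let g := LinearEquiv.ofBijective (assemble d m n) ⟨assemble_injective, assemble_surjective⟩
  refine ⟨g.symm, fun u v => ?_, fun u v => ?_⟩
  · rw [LinearEquiv.symm_apply_eq]
    change _ = assemble d m n _
    rw [assemble_row]
    change _ = u • g (g.symm v)
    rw [LinearEquiv.apply_symm_apply, row_smul]
  · rw [LinearEquiv.symm_apply_eq]
    change _ = assemble d m n _
    rw [assemble_col]
    change _ = u • g (g.symm v)
    rw [LinearEquiv.apply_symm_apply, col_smul]

end Decomposition

end SuperHowe

end

theorem mainTheorem2 (d m n : ℕ) :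
    -- double centralizer property in each degree
    (∀ k : ℕ,
      Subalgebra.centralizer ℂ ((SuperHowe.glSuperRepPow d m n k).range : Set _)
          = (SuperHowe.glRepPow d m n k).range ∧
        Subalgebra.centralizer ℂ ((SuperHowe.glRepPow d m n k).range : Set _)
          = (SuperHowe.glSuperRepPow d m n k).range) ∧
    -- double centralizer property on the whole algebra
    (Set.centralizer ((SuperHowe.glSuperRep d m n).range : Set _)
          = SuperHowe.finiteClosure (SuperHowe.glRep d m n).range ∧
      Set.centralizer ((SuperHowe.glRep d m n).range : Set _)
          = SuperHowe.finiteClosure (SuperHowe.glSuperRep d m n).range) ∧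
    -- the modules in the decomposition are simple
    (∀ μ : SuperHowe.HookPartition d m n,
      IsSimpleModule (SuperHowe.UGl d) (SuperHowe.LGl d (SuperHowe.glWeight d μ.1)) ∧
        IsSimpleModule (SuperHowe.UGlSuper (Fin m) (Fin n))
          (SuperHowe.LGlSuper m n (SuperHowe.naturalWeight m n μ.1))) ∧
    -- the decomposition as a module over both algebras
    ∃ f : SuperHowe.HoweSpace d m n ≃ₗ[ℂ]
        ⨁ μ : SuperHowe.HookPartition d m n,
          SuperHowe.LGl d (SuperHowe.glWeight d μ.1) ⊗[ℂ]
            SuperHowe.LGlSuper m n (SuperHowe.naturalWeight m n μ.1),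
      (∀ (u : SuperHowe.UGl d) (v : SuperHowe.HoweSpace d m n),
        f (SuperHowe.glRep d m n u v)
          = DirectSum.lmap (fun _ => (Algebra.lsmul ℂ ℂ _ u).rTensor _) (f v)) ∧
      (∀ (u : SuperHowe.UGlSuper (Fin m) (Fin n)) (v : SuperHowe.HoweSpace d m n),
        f (SuperHowe.glSuperRep d m n u v)
          = DirectSum.lmap (fun _ => (Algebra.lsmul ℂ ℂ _ u).lTensor _) (f v)) := by
  exact ⟨fun k => ⟨SuperHowe.centralizer_glSuperRepPow k, SuperHowe.centralizer_glRepPow k⟩,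
    ⟨SuperHowe.centralizer_glSuperRep, SuperHowe.centralizer_glRep⟩,
    fun μ => ⟨(SuperHowe.LGl_simple μ).1, (SuperHowe.LGlSuper_simple μ).1⟩,
    SuperHowe.exists_decomposition⟩
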